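/- **Setting.** Let $d,n\in\mathbb N$ and let $\rho_1:\mathbb R^d\to\mathbb R$, $\rho_2:\mathbb R^n\to\mathbb C$ be smooth, compactly supported and spherically symmetric, with $\hat\rho_2(k)=(2\pi)^{-n/2}\int_{\mathbb R^n}e^{-ik\cdot y}\rho_2(y)\,dy$. Let $V:\mathbb R^d\to\mathbb R$ satisfy (C) $V\in L^2_{loc}(\mathbb R^d)$ and $\lim_{|q|\to\infty}V(q)=+\infty$, and, if $d\ge 4$, assume moreover that $V$ is (essentially) bounded from below. Let $H_p=-\Delta+V$ (in the sense of distributions) on $L^2(\mathbb R^d)$ with domain $\mathcal D(H_p)=\{\psi\in L^2(\mathbb R^d): H_p\psi\in L^2(\mathbb R^d)\}$. Let $\mathcal F=\bigoplus_{m\ge0}L^2_{sym}((\mathbb R^{d}\times\mathbb R^{n})^m)$ be the bosonic Fock space over $L^2(\mathbb R^{d+n},dx\,dk)$, with its usual creation and annihilation operators $a^*(h)$ (linear in $h$) and $a(h)$ (antilinear in $h$). Let $H_f=\mathrm d\Gamma(\omega)$ be the second quantization of multiplication by $\omega(x,k)=|k|$, that is, multiplication by $\sum_{j=1}^m|k_j|$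 on the $m$-particle sector, with its maximal domain. On $\mathcal H=L^2(\mathbb R^d)\otimes\mathcal F\cong L^2(\mathbb R^d,dq;\mathcal F)$ let $H_0=H_p\otimes 1+1\otimes H_f$, meaning the closure of this operator defined on the algebraic tensor product $\mathcal D(H_p)\otimes\mathcal D(H_f)$. For $q\in\mathbb R^d$ put $$g_q(x,k)=\rho_1(x-q)\,\frac{\hat\rho_2(k)}{\sqrt{2\omega(x,k)}},$$ and let $H_I$ be the operator $(H_I\Psi)(q)=a^*(g_q)\Psi(q)+a(g_q)\Psi(q)$, with domain the set of all $\Psi\in\mathcal H$ such that $\Psi(q)\in\mathcal D(a^*(g_q))\cap\mathcal D(a(g_q))$ for almost every $q$ and $H_I\Psi\in\mathcal H$. Finally let $H=H_0+H_I$ on $\mathcal D(H)=\mathcal D(H_0)\cap\mathcal D(H_I)$. **Proposition.** If $n\ge3$, then $\mathcal D(H)=\mathcal D(H_0)$ and $H$ is self-adjoint on this domain. Moreover, $H$ is essentially self-adjoint on any core for $H_0$, and $H$ is bounded from below: there is $c\in\mathbb R$ with $\langle\Psi,H\Psi\rangle\ge c\|\Psi\|^2$ for all $\Psi\in\mathcal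 D(H)$. -/

import Mathlib

noncomputable section

namespace FrictionModel

open MeasureTheory Filter Topology ComplexConjugate
open scoped ENNReal ContDiff Laplacian

/-! ### Bosonic Fock space over `L²(Y)` -/

section Fock

variable (Y : Type) [MeasureSpace Y] [SigmaFinite (volume : Measure Y)]

/-- Permuting the particle labels preserves the product measure on `Yᵐ`. -/
theorem measurePreserving_perm {m : ℕ} (σ : Equiv.Perm (Fin m)) :
    MeasurePreserving (fun p : Fin m → Y => p ∘ σ) volume volume := by
  have h := volume_measurePreserving_piCongrLeft (fun _ : Fin m => Y) σ.symm
  have e : (fun p : Fin m → Y => p ∘ σ) = MeasurableEquiv.piCongrLeft (fun _ : Fin m => Y) σ.symm := by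
    funext p i
    have := MeasurableEquiv.piCongrLeft_apply_apply (β := fun _ : Fin m => Y) σ.symm p (σ i)
    simpa using this.symm
  rwa [e]

/-- The `m`-particle sector: the `m`-fold symmetric tensor power of `L²(Y)`, realised as the
subspace of `L²(Yᵐ)` of functions invariant under all permutations of the `m` variables.
For `m = 0` the space `Y⁰` is a point of mass one and the sector is `ℂ`. -/
def sector (m : ℕ) : Submodule ℂ (Lp ℂ 2 (volume : Measure (Fin m → Y))) where
  carrier := {f | ∀ σ : Equiv.Perm (Fin m),
    Lp.compMeasurePreserving (fun p : Fin m → Y => p ∘ σ) (measurePreserving_perm Y σ) f = f}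
  zero_mem' := fun _ => map_zero _
  add_mem' := fun hf hg σ => by rw [map_add, hf σ, hg σ]
  smul_mem' := fun c f hf σ => by
    have h := (Lp.compMeasurePreservingₗ (E := ℂ) (p := 2) ℂ (fun p : Fin m → Y => p ∘ σ)
      (measurePreserving_perm Y σ)).map_smul c f
    exact h.trans (congrArg (c • ·) (hf σ))

theorem isClosed_sector (m : ℕ) :
    IsClosed (sector Y m : Set (Lp ℂ 2 (volume : Measure (Fin m → Y)))) := by
  have : (sector Y m : Set (Lp ℂ 2 (volume : Measure (Fin m → Y)))) =
      ⋂ σ : Equiv.Perm (Fin m), {f | Lp.compMeasurePreserving (fun p : Fin m → Y => p ∘ σ)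
        (measurePreserving_perm Y σ) f = f} := by
    ext f
    rw [Set.mem_iInter]
    rfl
  rw [this]
  exact isClosed_iInter fun σ => isClosed_eq
    (Lp.isometry_compMeasurePreserving (measurePreserving_perm Y σ)).continuous continuous_id

instance completeSpace_sector (m : ℕ) : CompleteSpace (sector Y m) :=
  (isClosed_sector Y m).completeSpace_coe

/-- The bosonic Fock space over `L²(Y)`: the Hilbert sum of the `m`-particle sectors. -/
abbrev Fock : Type := lp (fun m : ℕ => sector Y m) 2

variable {Y}

/-- The `m`-particle wave function of a Fock vector (defined up to null sets). -/
def wave (φ : Fock Y) (m : ℕ) : (Fin m → Y) → ℂ :=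
  ((φ m : sector Y m) : Lp ℂ 2 (volume : Measure (Fin m → Y)))

theorem wave_zero (m : ℕ) : wave (0 : Fock Y) m =ᵐ[volume] 0 := Lp.coeFn_zero _ _ _

theorem wave_add (φ χ : Fock Y) (m : ℕ) :
    wave (φ + χ) m =ᵐ[volume] wave φ m + wave χ m := Lp.coeFn_add _ _

theorem wave_smul (c : ℂ) (φ : Fock Y) (m : ℕ) :
    wave (c • φ) m =ᵐ[volume] c • wave φ m := Lp.coeFn_smul _ _

theorem fock_eq_zero {φ : Fock Y} (h : ∀ m, wave φ m =ᵐ[volume] 0) : φ = 0 := by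
  ext1
  funext m
  exact Subtype.ext ((Lp.eq_zero_iff_ae_eq_zero).2 (h m))

/-- Almost every point of `Yᵐ⁺¹` is almost every `y` joined to almost every point of `Yᵐ`. -/
theorem ae_ae_cons {m : ℕ} {P : (Fin (m + 1) → Y) → Prop} (h : ∀ᵐ p, P p) :
    ∀ᵐ p : Fin m → Y, ∀ᵐ y : Y, P (Fin.cons y p) := by
  have h1 := (measurePreserving_piFinSuccAbove (fun _ : Fin (m + 1) => (volume : Measure Y)) 0).symm
  have h2 := (h1.quasiMeasurePreserving.ae h)
  have h3 := (Measure.measurePreserving_swap (μ := (volume : Measure (Fin m → Y)))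
    (ν := (volume : Measure Y))).quasiMeasurePreserving.ae h2
  have h4 := Measure.ae_ae_of_ae_prod h3
  simpa [MeasurableEquiv.piFinSuccAbove, Fin.insertNthEquiv] using h4

/-- Dropping one coordinate pulls null sets back to null sets. -/
theorem ae_removeNth {m : ℕ} (j : Fin (m + 1)) {P : (Fin m → Y) → Prop} (h : ∀ᵐ p, P p) :
    ∀ᵐ p : Fin (m + 1) → Y, P (fun i => p (j.succAbove i)) := by
  have h1 := (measurePreserving_piFinSuccAbove (fun _ : Fin (m + 1) => (volume : Measure Y)) j)
  exact (Measure.quasiMeasurePreserving_snd.comp h1.quasiMeasurePreserving).ae h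

/-- The graph of the annihilation operator `a(h) = ∫ dy conj(h(y)) a(y)`:
`(a(h) φ)ₘ(y₁,…,yₘ) = √(m+1) ∫ conj(h(y)) φₘ₊₁(y, y₁,…,yₘ) dy`. -/
def annihilationGraph (h : Y → ℂ) : Submodule ℂ (Fock Y × Fock Y) where
  carrier := {φχ | ∀ m : ℕ, ∀ᵐ p : Fin m → Y,
    Integrable (fun y => conj (h y) * wave φχ.1 (m + 1) (Fin.cons y p)) ∧
    wave φχ.2 m p =
      (Real.sqrt (m + 1) : ℂ) * ∫ y, conj (h y) * wave φχ.1 (m + 1) (Fin.cons y p)}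
  zero_mem' := fun m => by
    filter_upwards [ae_ae_cons (wave_zero (Y := Y) (m + 1)), wave_zero (Y := Y) m] with p hp hp'
    have e : (fun y => conj (h y) * wave (0 : Fock Y) (m + 1) (Fin.cons y p)) =ᵐ[volume] 0 := by
      filter_upwards [hp] with y hy
      simp [hy]
    refine ⟨(integrable_congr e).2 (integrable_zero _ _ _), ?_⟩
    simp only [Prod.fst_zero, Prod.snd_zero]
    rw [integral_congr_ae e, hp']
    simp
  add_mem' := by
    rintro ⟨φ, χ⟩ ⟨φ', χ'⟩ h1 h2 m
    filter_upwards [h1 m, h2 m, ae_ae_cons (wave_add φ φ' (m + 1)), wave_add χ χ' m]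
      with p ⟨i1, e1⟩ ⟨i2, e2⟩ hp hp'
    have e : (fun y => conj (h y) * wave (φ + φ') (m + 1) (Fin.cons y p)) =ᵐ[volume]
        (fun y => conj (h y) * wave φ (m + 1) (Fin.cons y p)) +
          (fun y => conj (h y) * wave φ' (m + 1) (Fin.cons y p)) := by
      filter_upwards [hp] with y hy
      simp [hy, mul_add]
    refine ⟨(integrable_congr e).2 (i1.add i2), ?_⟩
    simp only [Prod.mk_add_mk]
    rw [integral_congr_ae e, hp', integral_add' i1 i2, Pi.add_apply]
    rw [e1, e2]
    ring
  smul_mem' := by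
    rintro c ⟨φ, χ⟩ h1 m
    filter_upwards [h1 m, ae_ae_cons (wave_smul c φ (m + 1)), wave_smul c χ m]
      with p ⟨i1, e1⟩ hp hp'
    have e : (fun y => conj (h y) * wave (c • φ) (m + 1) (Fin.cons y p)) =ᵐ[volume]
        (fun y => c * (conj (h y) * wave φ (m + 1) (Fin.cons y p))) := by
      filter_upwards [hp] with y hy
      simp only [hy, Pi.smul_apply, smul_eq_mul]
      ring
    refine ⟨(integrable_congr e).2 (i1.const_mul c), ?_⟩
    simp only [Prod.smul_mk]
    rw [integral_congr_ae e, hp', integral_const_mul, Pi.smul_apply]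
    rw [e1, smul_eq_mul]
    ring

theorem annihilationGraph_single_valued (h : Y → ℂ) (x : Fock Y × Fock Y)
    (hx : x ∈ annihilationGraph h) (hx' : x.1 = 0) : x.2 = 0 := by
  refine fock_eq_zero fun m => ?_
  filter_upwards [hx m, ae_ae_cons (wave_zero (Y := Y) (m + 1))] with p ⟨_, e1⟩ hp
  have e : (fun y => conj (h y) * wave x.1 (m + 1) (Fin.cons y p)) =ᵐ[volume] 0 := by
    filter_upwards [hp] with y hy
    simp [hx', hy]
  rw [e1, integral_congr_ae e]
  simp

/-- The annihilation operator `a(h)` on its natural domain. -/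
def annihilation (h : Y → ℂ) : Fock Y →ₗ.[ℂ] Fock Y := (annihilationGraph h).toLinearPMap

/-- The graph of the creation operator `a*(h) = ∫ dy h(y) a*(y)`: `(a*(h) φ)₀ = 0` and
`(a*(h) φ)ₘ₊₁(y₀,…,yₘ) = (m+1)^(-1/2) ∑ⱼ h(yⱼ) φₘ(y₀,…,yⱼ omitted,…,yₘ)`. -/
def creationGraph (h : Y → ℂ) : Submodule ℂ (Fock Y × Fock Y) where
  carrier := {φχ | (∀ᵐ p : Fin 0 → Y, wave φχ.2 0 p = 0) ∧
    ∀ m : ℕ, ∀ᵐ p : Fin (m + 1) → Y, wave φχ.2 (m + 1) p =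
      (Real.sqrt (m + 1) : ℂ)⁻¹ *
        ∑ j : Fin (m + 1), h (p j) * wave φχ.1 m (fun i => p (j.succAbove i))}
  zero_mem' := by
    refine ⟨wave_zero 0, fun m => ?_⟩
    filter_upwards [ae_all_iff.2 fun j => ae_removeNth j (wave_zero (Y := Y) m),
      wave_zero (Y := Y) (m + 1)] with p hp hp'
    simp [hp, hp']
  add_mem' := by
    rintro ⟨φ, χ⟩ ⟨φ', χ'⟩ ⟨a1, h1⟩ ⟨a2, h2⟩
    refine ⟨?_, fun m => ?_⟩
    · filter_upwards [a1, a2, wave_add χ χ' 0] with p e1 e2 hp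
      simp [hp, e1, e2]
    · filter_upwards [h1 m, h2 m, ae_all_iff.2 fun j => ae_removeNth j (wave_add φ φ' m),
        wave_add χ χ' (m + 1)] with p e1 e2 hp hp'
      simp only [Prod.mk_add_mk, hp, hp', Pi.add_apply, e1, e2, mul_add, Finset.sum_add_distrib]
  smul_mem' := by
    rintro c ⟨φ, χ⟩ ⟨a1, h1⟩
    refine ⟨?_, fun m => ?_⟩
    · filter_upwards [a1, wave_smul c χ 0] with p e1 hp
      simp [hp, e1]
    · filter_upwards [h1 m, ae_all_iff.2 fun j => ae_removeNth j (wave_smul c φ m),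
        wave_smul c χ (m + 1)] with p e1 hp hp'
      simp only [Prod.smul_mk, hp, hp', Pi.smul_apply, e1, smul_eq_mul, Finset.mul_sum]
      exact Finset.sum_congr rfl fun j _ => by ring

theorem creationGraph_single_valued (h : Y → ℂ) (x : Fock Y × Fock Y)
    (hx : x ∈ creationGraph h) (hx' : x.1 = 0) : x.2 = 0 := by
  refine fock_eq_zero fun m => ?_
  cases m with
  | zero => exact hx.1
  | succ m =>
    filter_upwards [hx.2 m, ae_all_iff.2 fun j => ae_removeNth j (wave_zero (Y := Y) m)]
      with p e1 hp
    simp [e1, hx', hp]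

/-- The creation operator `a*(h)` on its natural domain. -/
def creation (h : Y → ℂ) : Fock Y →ₗ.[ℂ] Fock Y := (creationGraph h).toLinearPMap

/-- The graph of the second quantization `dΓ(w)` of the operator of multiplication by `w`:
`(dΓ(w) φ)ₘ(y₁,…,yₘ) = (w(y₁) + ⋯ + w(yₘ)) φₘ(y₁,…,yₘ)`. -/
def secondQuantizationGraph (w : Y → ℝ) : Submodule ℂ (Fock Y × Fock Y) where
  carrier := {φχ | ∀ m : ℕ, ∀ᵐ p : Fin m → Y,
    wave φχ.2 m p = ((∑ j, w (p j) : ℝ) : ℂ) * wave φχ.1 m p}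
  zero_mem' := fun m => by
    filter_upwards [wave_zero (Y := Y) m] with p hp
    simp [hp]
  add_mem' := by
    rintro ⟨φ, χ⟩ ⟨φ', χ'⟩ h1 h2 m
    filter_upwards [h1 m, h2 m, wave_add φ φ' m, wave_add χ χ' m] with p e1 e2 hp hp'
    simp only [Prod.mk_add_mk, hp, hp', Pi.add_apply, e1, e2, mul_add]
  smul_mem' := by
    rintro c ⟨φ, χ⟩ h1 m
    filter_upwards [h1 m, wave_smul c φ m, wave_smul c χ m] with p e1 hp hp'
    simp only [Prod.smul_mk, hp, hp', Pi.smul_apply, e1, smul_eq_mul]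
    ring

theorem secondQuantizationGraph_single_valued (w : Y → ℝ) (x : Fock Y × Fock Y)
    (hx : x ∈ secondQuantizationGraph w) (hx' : x.1 = 0) : x.2 = 0 := by
  refine fock_eq_zero fun m => ?_
  filter_upwards [hx m, wave_zero (Y := Y) m] with p e1 hp
  simp [e1, hx', hp]

/-- `dΓ(w)` on its natural (maximal) domain. -/
def secondQuantization (w : Y → ℝ) : Fock Y →ₗ.[ℂ] Fock Y :=
  (secondQuantizationGraph w).toLinearPMap

end Fock

/-! ### The particle -/

/-- The Hilbert space `L²(ℝᵈ)` of the particle. -/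
abbrev Particle (d : ℕ) : Type := Lp ℂ 2 (volume : Measure (EuclideanSpace ℝ (Fin d)))

/-- Condition (C): `V ∈ L²_loc(ℝᵈ)` and `V(q) → +∞` as `|q| → ∞`. -/
def ConditionC {d : ℕ} (V : EuclideanSpace ℝ (Fin d) → ℝ) : Prop :=
  (∀ K : Set (EuclideanSpace ℝ (Fin d)), IsCompact K → MemLp V 2 (volume.restrict K)) ∧
    Tendsto V (cocompact (EuclideanSpace ℝ (Fin d))) atTop

/-- The test-function side `(-Δη + Vη) ψ` is integrable as soon as `Vψ ∈ L¹_loc`. -/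
theorem integrable_test {d : ℕ} (V : EuclideanSpace ℝ (Fin d) → ℝ) (ψ : Particle d)
    (hψ : LocallyIntegrable (fun q => V q • ψ q)) (η : EuclideanSpace ℝ (Fin d) → ℝ)
    (h1 : ContDiff ℝ ∞ η) (h2 : HasCompactSupport η) :
    Integrable (fun q => (-(Δ η) q + V q * η q) • ψ q) := by
  have hψ' : LocallyIntegrable (fun q => ψ q) := (Lp.memLp ψ).locallyIntegrable (by norm_num)
  have c1 : Continuous (Δ η) := by
    rw [InnerProductSpace.laplacian_eq_iteratedFDeriv_stdOrthonormalBasis]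
    have := h1.continuous_iteratedFDeriv (m := 2) (by norm_cast)
    fun_prop
  have s1 : HasCompactSupport (Δ η) := by
    rw [InnerProductSpace.laplacian_eq_iteratedFDeriv_stdOrthonormalBasis]
    refine (h2.iteratedFDeriv (𝕜 := ℝ) 2).mono fun x hx => ?_
    contrapose! hx
    simp only [Function.mem_support, not_not] at hx ⊢
    simp [hx]
  have i1 := (hψ'.integrable_smul_left_of_hasCompactSupport c1 s1).neg
  have i2 := hψ.integrable_smul_left_of_hasCompactSupport h1.continuous h2
  refine (i1.add i2).congr (Eventually.of_forall fun q => ?_)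
  simp only [Pi.add_apply, Pi.neg_apply, Complex.real_smul]
  push_cast
  ring

/-- The graph of `H_p = -Δ + V` on `{ψ ∈ L² : H_p ψ ∈ L²}`, where `H_p ψ` is taken in the sense of
distributions: `Vψ ∈ L¹_loc` and `∫ (-Δη + Vη) ψ = ∫ η χ` for all test functions `η`. -/
def particleGraph {d : ℕ} (V : EuclideanSpace ℝ (Fin d) → ℝ) :
    Submodule ℂ (Particle d × Particle d) where
  carrier := {ψχ | LocallyIntegrable (fun q => V q • ψχ.1 q) ∧
    ∀ η : EuclideanSpace ℝ (Fin d) → ℝ, ContDiff ℝ ∞ η → HasCompactSupport η →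
      ∫ q, (-(Δ η) q + V q * η q) • ψχ.1 q = ∫ q, η q • ψχ.2 q}
  zero_mem' := by
    have e : ((0 : Particle d) : EuclideanSpace ℝ (Fin d) → ℂ) =ᵐ[volume] 0 :=
      Lp.coeFn_zero _ _ _
    refine ⟨?_, fun η _ _ => ?_⟩
    · refine (locallyIntegrable_congr (f := fun _ => (0 : ℂ)) ?_).1 locallyIntegrable_zero
      filter_upwards [e] with q hq
      simp only [Prod.fst_zero, hq, Pi.zero_apply, smul_zero]
    · have a1 : (fun q => (-(Δ η) q + V q * η q) • (0 : Particle d) q) =ᵐ[volume] 0 := by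
        filter_upwards [e] with q hq
        rw [hq]
        exact smul_zero _
      have a2 : (fun q => η q • (0 : Particle d) q) =ᵐ[volume] 0 := by
        filter_upwards [e] with q hq
        rw [hq]
        exact smul_zero _
      exact (integral_congr_ae a1).trans (integral_congr_ae a2).symm
  add_mem' := by
    rintro ⟨ψ, χ⟩ ⟨ψ', χ'⟩ ⟨l1, h1⟩ ⟨l2, h2⟩
    have e := Lp.coeFn_add ψ ψ'
    have e' := Lp.coeFn_add χ χ'
    refine ⟨?_, fun η hη hη' => ?_⟩
    · refine (locallyIntegrable_congr ?_).1 (l1.add l2)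
      filter_upwards [e] with q hq
      simp only [Prod.mk_add_mk, hq, Pi.add_apply, smul_add]
    · have j (x : Particle d) : Integrable (fun q => η q • x q) :=
        ((Lp.memLp x).locallyIntegrable (by norm_num)).integrable_smul_left_of_hasCompactSupport
          hη.continuous hη'
      have k1 := h1 η hη hη'
      have k2 := h2 η hη hη'
      simp only at k1 k2
      calc ∫ q, (-(Δ η) q + V q * η q) • (ψ + ψ' : Particle d) q
          = ∫ q, ((-(Δ η) q + V q * η q) • ψ q + (-(Δ η) q + V q * η q) • ψ' q) := by
            refine integral_congr_ae ?_
            filter_upwards [e] with q hq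
            simp only [hq, Pi.add_apply, smul_add]
        _ = ∫ q, (η q • χ q + η q • χ' q) := by
            rw [integral_add (integrable_test V ψ l1 η hη hη') (integrable_test V ψ' l2 η hη hη'),
              k1, k2, integral_add (j χ) (j χ')]
        _ = ∫ q, η q • (χ + χ' : Particle d) q := by
            refine integral_congr_ae ?_
            filter_upwards [e'] with q hq
            simp only [hq, Pi.add_apply, smul_add]
  smul_mem' := by
    rintro c ⟨ψ, χ⟩ ⟨l1, h1⟩
    have e := Lp.coeFn_smul c ψ
    have e' := Lp.coeFn_smul c χ
    refine ⟨?_, fun η hη hη' => ?_⟩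
    · refine (locallyIntegrable_congr ?_).1 (l1.smul c)
      filter_upwards [e] with q hq
      simp only [Prod.smul_mk, hq, Pi.smul_apply]
      exact smul_comm _ _ _
    · have k1 := h1 η hη hη'
      simp only at k1
      calc ∫ q, (-(Δ η) q + V q * η q) • (c • ψ : Particle d) q
          = ∫ q, c • ((-(Δ η) q + V q * η q) • ψ q) := by
            refine integral_congr_ae ?_
            filter_upwards [e] with q hq
            simp only [hq, Pi.smul_apply]
            exact smul_comm _ _ _
        _ = ∫ q, c • (η q • χ q) := by rw [integral_smul, k1, integral_smul]
        _ = ∫ q, η q • (c • χ : Particle d) q := by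
            refine integral_congr_ae ?_
            filter_upwards [e'] with q hq
            simp only [hq, Pi.smul_apply]
            exact smul_comm _ _ _

theorem particleGraph_single_valued {d : ℕ} (V : EuclideanSpace ℝ (Fin d) → ℝ)
    (x : Particle d × Particle d) (hx : x ∈ particleGraph V) (hx' : x.1 = 0) : x.2 = 0 := by
  refine (Lp.eq_zero_iff_ae_eq_zero).2 (ae_eq_zero_of_integral_contDiff_smul_eq_zero
    ((Lp.memLp x.2).locallyIntegrable (by norm_num)) fun η hη hη' => ?_)
  have e : ((0 : Particle d) : EuclideanSpace ℝ (Fin d) → ℂ) =ᵐ[volume] 0 :=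
    Lp.coeFn_zero _ _ _
  rw [← hx.2 η hη hη', hx', integral_congr_ae (g := fun _ => (0 : ℂ))]
  · simp
  · filter_upwards [e] with q hq
    rw [hq]
    exact smul_zero _

/-- The Schrödinger operator `H_p = -Δ + V` on `{ψ ∈ L² : H_p ψ ∈ L²}`. -/
def Hp {d : ℕ} (V : EuclideanSpace ℝ (Fin d) → ℝ) : Particle d →ₗ.[ℂ] Particle d :=
  (particleGraph V).toLinearPMap

/-! ### The field and the coupled system -/

/-- The one-boson configuration space `ℝᵈ × ℝⁿ ∋ (x, k)`, with Lebesgue measure `dx dk`. -/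
abbrev Boson (d n : ℕ) : Type := EuclideanSpace ℝ (Fin d) × EuclideanSpace ℝ (Fin n)

/-- The dispersion relation `ω(x, k) = |k|`. -/
def dispersion {d n : ℕ} (y : Boson d n) : ℝ := ‖y.2‖

/-- The field Hamiltonian `H_f = dΓ(ω)`. -/
def Hf (d n : ℕ) : Fock (Boson d n) →ₗ.[ℂ] Fock (Boson d n) := secondQuantization dispersion

/-- The Hilbert space `L²(ℝᵈ) ⊗ 𝓕` of the coupled system, realised as `L²(ℝᵈ; 𝓕)`. -/
abbrev Total (d n : ℕ) : Type :=
  Lp (Fock (Boson d n)) 2 (volume : Measure (EuclideanSpace ℝ (Fin d)))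

/-- The simple tensor `f ⊗ φ`, i.e. the function `q ↦ f(q) φ`. -/
def tensor {d n : ℕ} (f : Particle d) (φ : Fock (Boson d n)) : Total d n :=
  (ContinuousLinearMap.toSpanSingleton ℂ φ).compLp f

/-- The graph of `H_p ⊗ 1 + 1 ⊗ H_f` on the algebraic tensor product `D(H_p) ⊗ D(H_f)`. -/
def freeGraph {d : ℕ} (n : ℕ) (V : EuclideanSpace ℝ (Fin d) → ℝ) :
    Submodule ℂ (Total d n × Total d n) :=
  Submodule.span ℂ (Set.range fun x : (Hp V).domain × (Hf d n).domain =>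
    (tensor (x.1 : Particle d) (x.2 : Fock (Boson d n)),
      tensor (Hp V x.1) (x.2 : Fock (Boson d n)) + tensor (x.1 : Particle d) (Hf d n x.2)))

/-- The free Hamiltonian `H₀ = H_p ⊗ 1 + 1 ⊗ H_f`: the closure of the operator so defined on
`D(H_p) ⊗ D(H_f)`. -/
def H0 {d : ℕ} (n : ℕ) (V : EuclideanSpace ℝ (Fin d) → ℝ) : Total d n →ₗ.[ℂ] Total d n :=
  (freeGraph n V).toLinearPMap.closure

/-- The Fourier transform `ρ̂(k) = (2π)^(-n/2) ∫ exp(-i k·y) ρ(y) dy`. -/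
def fourier {n : ℕ} (ρ : EuclideanSpace ℝ (Fin n) → ℂ) (k : EuclideanSpace ℝ (Fin n)) : ℂ :=
  (((2 * Real.pi) ^ (-(n : ℝ) / 2) : ℝ) : ℂ) *
    ∫ y, Complex.exp (-Complex.I * (inner ℝ k y : ℝ)) * ρ y

/-- The coupling function of a particle at `q`:
`g_q(x, k) = ρ₁(x - q) ρ̂₂(k) / √(2ω(k))`. -/
def coupling {d n : ℕ} (ρ₁ : EuclideanSpace ℝ (Fin d) → ℝ) (ρ₂ : EuclideanSpace ℝ (Fin n) → ℂ)
    (q : EuclideanSpace ℝ (Fin d)) (y : Boson d n) : ℂ :=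
  (ρ₁ (y.1 - q) : ℂ) * fourier ρ₂ y.2 / (Real.sqrt (2 * dispersion y) : ℂ)

/-- The graph of the interaction: `(H_I Ψ)(q) = a*(g_q) Ψ(q) + a(g_q) Ψ(q)` for almost every `q`. -/
def interactionGraph {d n : ℕ} (ρ₁ : EuclideanSpace ℝ (Fin d) → ℝ)
    (ρ₂ : EuclideanSpace ℝ (Fin n) → ℂ) : Submodule ℂ (Total d n × Total d n) where
  carrier := {ΨΦ | ∀ᵐ q, (ΨΦ.1 q, ΨΦ.2 q) ∈
    (creation (coupling ρ₁ ρ₂ q) + annihilation (coupling ρ₁ ρ₂ q)).graph}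
  zero_mem' := by
    filter_upwards [Lp.coeFn_zero (Fock (Boson d n)) 2
      (volume : Measure (EuclideanSpace ℝ (Fin d)))] with q hq
    simp only [Prod.fst_zero, Prod.snd_zero, hq, Pi.zero_apply]
    exact Submodule.zero_mem _
  add_mem' := by
    rintro ⟨Ψ, Φ⟩ ⟨Ψ', Φ'⟩ h1 h2
    filter_upwards [h1, h2, Lp.coeFn_add Ψ Ψ', Lp.coeFn_add Φ Φ'] with q m1 m2 e e'
    simp only [Prod.mk_add_mk, e, e', Pi.add_apply]
    exact Submodule.add_mem _ m1 m2
  smul_mem' := by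
    rintro c ⟨Ψ, Φ⟩ h1
    filter_upwards [h1, Lp.coeFn_smul c Ψ, Lp.coeFn_smul c Φ] with q m1 e e'
    simp only [Prod.smul_mk, e, e', Pi.smul_apply]
    exact Submodule.smul_mem _ c m1

theorem interactionGraph_single_valued {d n : ℕ} (ρ₁ : EuclideanSpace ℝ (Fin d) → ℝ)
    (ρ₂ : EuclideanSpace ℝ (Fin n) → ℂ) (x : Total d n × Total d n)
    (hx : x ∈ interactionGraph ρ₁ ρ₂) (hx' : x.1 = 0) : x.2 = 0 := by
  refine (Lp.eq_zero_iff_ae_eq_zero).2 ?_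
  filter_upwards [hx, Lp.coeFn_zero (Fock (Boson d n)) 2
      (volume : Measure (EuclideanSpace ℝ (Fin d)))] with q hq h0
  exact LinearPMap.graph_fst_eq_zero_snd _ hq (by rw [hx', h0]; rfl)

/-- The interaction `H_I`, on all `Ψ` with `Ψ(q) ∈ D(a*(g_q)) ∩ D(a(g_q))` for almost every `q`
for which the result is again in `L²(ℝᵈ; 𝓕)`. -/
def HI {d n : ℕ} (ρ₁ : EuclideanSpace ℝ (Fin d) → ℝ) (ρ₂ : EuclideanSpace ℝ (Fin n) → ℂ) :
    Total d n →ₗ.[ℂ] Total d n := (interactionGraph ρ₁ ρ₂).toLinearPMap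

/-- The full Hamiltonian `H = H₀ + H_I`, on `D(H₀) ∩ D(H_I)`. -/
def H {d n : ℕ} (V : EuclideanSpace ℝ (Fin d) → ℝ) (ρ₁ : EuclideanSpace ℝ (Fin d) → ℝ)
    (ρ₂ : EuclideanSpace ℝ (Fin n) → ℂ) : Total d n →ₗ.[ℂ] Total d n := H0 n V + HI ρ₁ ρ₂

/-! ### Operator-theoretic notions -/

section Operators

variable {E : Type*} [NormedAddCommGroup E] [InnerProductSpace ℂ E] [CompleteSpace E]

/-- An operator is essentially self-adjoint if it is closable and its closure is self-adjoint. -/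
def EssentiallySelfAdjoint (T : E →ₗ.[ℂ] E) : Prop :=
  T.IsClosable ∧ IsSelfAdjoint T.closure

/-- `T` is bounded from below: `⟨ψ, Tψ⟩ ≥ c ‖ψ‖²` on `D(T)` for some real `c`. -/
def BoundedFromBelow (T : E →ₗ.[ℂ] E) : Prop :=
  ∃ c : ℝ, ∀ ψ : T.domain, c * ‖(ψ : E)‖ ^ 2 ≤ (inner ℂ (ψ : E) (T ψ)).re

end Operators

end FrictionModel

end

/-! The interaction is linear in creation and annihilation operators, and these are controlled by
the square root of the field energy. Write `g_q = √ω k_q`. For `n ≥ 3` the function `|k|⁻²` is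
integrable near the origin of `ℝⁿ`, so `g_q` and `k_q` are both square integrable, with norms
independent of `q` (`exists_couplingFamily`). Two applications of Cauchy–Schwarz on each particle
sector give `‖a(g_q)φ‖² ≤ ‖k_q‖² ⟨φ, H_f φ⟩` and the same bound plus `‖g_q‖² ‖φ‖²` for `a*(g_q)`
(`exists_annihilation`, `exists_creation`). Integrate over `q` and use that `H_p` is bounded from
below: `‖H_I Ψ‖² ≤ a ⟨Ψ, H₀Ψ⟩ + b ‖Ψ‖²` for suitable `a`, `b`. The right side is at most `a ‖Ψ‖
‖H₀Ψ‖ + b ‖Ψ‖²`, so `H_I` is infinitesimally small relative to `H₀`; it is symmetric because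
`a*(g_q)` and `a(g_q)` are formally adjoint. All the claims are then the Kato–Rellich theorem
(`kato_rellich`, `kato_rellich_fiber`).

What remains is that `H₀` is self-adjoint and bounded from below. For the particle, split `V` into
its positive and negative parts. Kato's inequality shows that a square integrable weak solution of
`Δψ = (V₊ + μ)ψ` vanishes, so `-Δ + V₊` is essentially self-adjoint on test functions. The negative
part is an infinitesimally small perturbation: either it is bounded, or `d ≤ 3` and it has compact
support, hence lies in `L²`, while test functions are bounded in sup norm by a small multiple of
`‖(-Δ + V₊)η‖` plus a multiple of `‖η‖` (`exists_forall_norm_le`). The maximal operator `H_p` is the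
closure of the resulting operator. For the sum `H_p ⊗ 1 + 1 ⊗ H_f` the range of `H₀ + μ` is shown to
be dense by a telescoping Neumann series on vectors of bounded field energy (`freeTriples_dense`).

Operators are handled throughout as graphs, that is, submodules of `E × E`, and a perturbation
problem as a submodule of triples `(ψ, Aψ, Bψ)`. The notion carried along is `SemiboundedGraph`:
symmetric, form bounded from below, and `G + μ` of dense range for large real `μ`. It passes to
closures, is stable under small perturbations, and gives (essential) self-adjointness for densely
defined operators. -/

noncomputable section

namespace FrictionModel

open MeasureTheory Filter Topology ComplexConjugate
open scoped ENNReal ContDiff Laplacian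

/-! ### Semibounded graphs, self-adjointness and perturbation theory -/

section AbstractOperators

variable {E : Type*} [NormedAddCommGroup E] [InnerProductSpace ℂ E]

/-- A symmetric linear relation is essentially self-adjoint and bounded from below as soon as
its form is bounded from below and `G + μ` has dense range for all large real `μ`. -/
structure SemiboundedGraph (G : Submodule ℂ (E × E)) : Prop where
  symm : ∀ x ∈ G, ∀ y ∈ G, inner ℂ x.1 y.2 = inner ℂ x.2 y.1
  lower : ∃ c : ℝ, ∀ x ∈ G, c * ‖x.1‖ ^ 2 ≤ (inner ℂ x.1 x.2).re
  dense : ∃ μ₀ : ℝ, ∀ μ : ℝ, μ₀ ≤ μ → ∀ w : E,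
    (∀ x ∈ G, inner ℂ (x.2 + (μ : ℂ) • x.1) w = 0) → w = 0

theorem re_inner_add_smul (a b : E) (μ : ℝ) :
    (inner ℂ a (b + (μ : ℂ) • a)).re = (inner ℂ a b).re + μ * ‖a‖ ^ 2 := by
  rw [inner_add_right, inner_smul_right, inner_self_eq_norm_sq_to_K, Complex.add_re]
  congr 1
  rw [Complex.re_ofReal_mul]
  norm_cast

/-- Cauchy–Schwarz applied to `⟨a, b + μa⟩`, whose real part is at least `(μ + c) ‖a‖²`. This is the
resolvent bound for a form bounded from below. -/
theorem norm_le_norm_shift {a b : E} {c μ : ℝ} (h : c * ‖a‖ ^ 2 ≤ (inner ℂ a b).re) :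
    (μ + c) * ‖a‖ ≤ ‖b + (μ : ℂ) • a‖ := by
  rcases eq_or_lt_of_le (norm_nonneg a) with h0 | h0
  · rw [← h0, mul_zero]; exact norm_nonneg _
  · have h1 := re_inner_add_smul a b μ
    have h2 : (inner ℂ a (b + (μ : ℂ) • a)).re ≤ ‖a‖ * ‖b + (μ : ℂ) • a‖ :=
      (Complex.re_le_norm _).trans (norm_inner_le_norm _ _)
    nlinarith

/-- Symmetry and the lower bound are closed conditions; the density condition only weakens its
demand when the graph grows. -/
theorem SemiboundedGraph.closure {G : Submodule ℂ (E × E)} (h : SemiboundedGraph G) :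
    SemiboundedGraph G.topologicalClosure := by
  have key : ∀ {p : E × E → Prop}, IsClosed {x | p x} → (∀ x ∈ G, p x) →
      ∀ x ∈ G.topologicalClosure, p x := fun {p} hp hG x hx =>
    closure_minimal (s := (G : Set (E × E))) (t := {x | p x}) (fun y hy => hG y hy) hp hx
  refine ⟨?_, ?_, ?_⟩
  · refine key ?_ fun x hx => key ?_ fun y hy => h.symm x hx y hy
    · have : {x : E × E | ∀ y ∈ G.topologicalClosure, inner ℂ x.1 y.2 = inner ℂ x.2 y.1} =
          ⋂ y ∈ G.topologicalClosure, {x : E × E | inner ℂ x.1 y.2 = inner ℂ x.2 y.1} := by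
        ext; simp
      rw [this]
      exact isClosed_biInter fun y _ => isClosed_eq (by fun_prop) (by fun_prop)
    · exact isClosed_eq (by fun_prop) (by fun_prop)
  · obtain ⟨c, hc⟩ := h.lower
    refine ⟨c, key ?_ hc⟩
    exact isClosed_le (by fun_prop) (Complex.continuous_re.comp (by fun_prop))
  · obtain ⟨μ₀, hμ⟩ := h.dense
    exact ⟨μ₀, fun μ hμ' w hw => hμ μ hμ' w fun x hx => hw x (G.le_topologicalClosure hx)⟩

/-- If `(0, χ)` lies in the closed graph, symmetry against `(v, Tv)` gives `⟨χ, v⟩ = 0` for all `v`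
in the dense domain. -/
theorem isClosable_of_symm {T : E →ₗ.[ℂ] E} (hd : Dense (T.domain : Set E))
    (h : SemiboundedGraph T.graph) : T.IsClosable := by
  refine ⟨T.graph.topologicalClosure.toLinearPMap, ?_⟩
  rw [Submodule.toLinearPMap_graph_eq]
  intro x hx hx'
  refine hd.eq_zero_of_inner_left (𝕜 := ℂ) fun v hv => ?_
  have h1 := h.closure.symm x hx _ (T.graph.le_topologicalClosure (T.mem_graph ⟨v, hv⟩))
  rw [hx', inner_zero_left] at h1
  exact h1.symm

section Complete

variable [CompleteSpace E]

/-- A map bounded below on a complete subspace whose range has trivial orthogonal complement is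
onto. -/
theorem exists_mem_map_eq {F : Type*} [NormedAddCommGroup F] [NormedSpace ℂ F] [CompleteSpace F]
    {G : Submodule ℂ F} (hG : IsClosed (G : Set F)) (L : F →L[ℂ] E) {C : NNReal}
    (hC : ∀ x ∈ G, ‖x‖ ≤ C * ‖L x‖) (hd : ∀ w : E, (∀ x ∈ G, inner ℂ (L x) w = 0) → w = 0)
    (f : E) : ∃ x ∈ G, L x = f := by
  have : CompleteSpace G := hG.completeSpace_coe
  let K : G →ₗ[ℂ] E := L.toLinearMap.comp G.subtype
  have hK : AntilipschitzWith C K := AddMonoidHomClass.antilipschitz_of_bound K fun x => hC x x.2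
  have hu : UniformContinuous K := (L.comp G.subtypeL).uniformContinuous
  have hcl : IsClosed (Set.range K) := hK.isClosed_range hu
  have hcl' : IsClosed ((LinearMap.range K : Submodule ℂ E) : Set E) := hcl
  have : CompleteSpace (LinearMap.range K) := hcl'.completeSpace_coe
  have htop : LinearMap.range K = ⊤ := by
    rw [← Submodule.orthogonal_eq_bot_iff, Submodule.eq_bot_iff]
    intro w hw
    refine hd w fun x hx => ?_
    exact (Submodule.mem_orthogonal _ _).1 hw _ ⟨⟨x, hx⟩, rfl⟩
  have : f ∈ LinearMap.range K := htop ▸ Submodule.mem_top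
  obtain ⟨x, hx⟩ := this
  exact ⟨x, x.2, hx⟩

/-- For a closed semibounded graph, `G + μ` is onto for all large `μ`. -/
theorem SemiboundedGraph.surjective {G : Submodule ℂ (E × E)} (h : SemiboundedGraph G)
    (hG : IsClosed (G : Set (E × E))) :
    ∃ μ₀ : ℝ, ∀ μ : ℝ, μ₀ ≤ μ → ∀ f : E, ∃ x ∈ G, x.2 + (μ : ℂ) • x.1 = f := by
  obtain ⟨c, hc⟩ := h.lower
  obtain ⟨μ₀, hμ₀⟩ := h.dense
  -- Taking `μ ≥ 1 - c` makes `μ + c ≥ 1`, so that `‖x.1‖ ≤ ‖(G + μ) x‖` and `G + μ` is bounded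
  -- below in the graph norm.
  refine ⟨max μ₀ (1 - c), fun μ hμ f => ?_⟩
  have h1 : 1 ≤ μ + c := by linarith [le_max_right μ₀ (1 - c)]
  let L : E × E →L[ℂ] E := ContinuousLinearMap.snd ℂ E E + (μ : ℂ) • ContinuousLinearMap.fst ℂ E E
  have hL : ∀ x, L x = x.2 + (μ : ℂ) • x.1 := fun x => rfl
  refine exists_mem_map_eq hG L (C := ⟨1 + |μ|, by positivity⟩) (fun x hx => ?_)
    (fun w hw => hμ₀ μ ((le_max_left _ _).trans hμ) w hw) f
  have h2 := norm_le_norm_shift (μ := μ) (hc x hx)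
  have h3 : ‖x.1‖ ≤ ‖L x‖ := by rw [hL]; nlinarith [norm_nonneg x.1]
  have h4 : ‖x.2‖ ≤ ‖L x‖ + |μ| * ‖x.1‖ := by
    have : x.2 = L x - (μ : ℂ) • x.1 := by rw [hL]; abel
    calc ‖x.2‖ = ‖L x - (μ : ℂ) • x.1‖ := by rw [← this]
      _ ≤ ‖L x‖ + ‖(μ : ℂ) • x.1‖ := norm_sub_le _ _
      _ = _ := by rw [norm_smul, Complex.norm_real, Real.norm_eq_abs]
  have h5 := mul_le_mul_of_nonneg_left h3 (abs_nonneg μ)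
  rw [Prod.norm_def]
  refine max_le ?_ ?_
  · change ‖x.1‖ ≤ (1 + |μ|) * ‖L x‖
    nlinarith [norm_nonneg (L x), abs_nonneg μ, mul_nonneg (abs_nonneg μ) (norm_nonneg (L x))]
  · change ‖x.2‖ ≤ (1 + |μ|) * ‖L x‖
    linarith

/-- A closed semibounded graph contains its adjoint. -/
theorem SemiboundedGraph.mem_of_adjoint {G : Submodule ℂ (E × E)} (h : SemiboundedGraph G)
    (hG : IsClosed (G : Set (E × E))) {ψ χ : E}
    (hx : ∀ x ∈ G, inner ℂ x.2 ψ = inner ℂ x.1 χ) : (ψ, χ) ∈ G := by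
  obtain ⟨μ₀, hμ₀⟩ := h.dense
  obtain ⟨μ₁, hμ₁⟩ := h.surjective hG
  -- Solve `(G + μ) y = χ + μψ`. Then `ψ - y` is orthogonal to the range of `G + μ`, hence zero, and
  -- `(ψ, χ)` is the element `y` of `G`.
  obtain ⟨y, hy, hy'⟩ := hμ₁ (max μ₀ μ₁) (le_max_right _ _) (χ + ((max μ₀ μ₁ : ℝ) : ℂ) • ψ)
  have e : ψ - y.1 = 0 := by
    refine hμ₀ (max μ₀ μ₁) (le_max_left _ _) _ fun x hx' => ?_
    have h1 := hx x hx'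
    have h2 := h.symm x hx' y hy
    rw [inner_sub_right, inner_add_left, inner_add_left, h1, inner_smul_left, inner_smul_left,
      Complex.conj_ofReal]
    have h3 := congrArg (fun v => inner ℂ x.1 v) hy'
    simp only [inner_add_right, inner_smul_right] at h3
    rw [← h2]
    linear_combination -h3
  have e1 : ψ = y.1 := sub_eq_zero.1 e
  have e2 : χ = y.2 := by rw [e1] at hy'; exact (add_right_cancel hy').symm
  rw [e1, e2]; exact hy

/-- Symmetry puts the graph inside its adjoint; `SemiboundedGraph.mem_of_adjoint` gives the
converse. -/
theorem isSelfAdjoint_of_semiboundedGraph {T : E →ₗ.[ℂ] E} (hd : Dense (T.domain : Set E))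
    (hc : T.IsClosed) (h : SemiboundedGraph T.graph) : IsSelfAdjoint T := by
  rw [LinearPMap.isSelfAdjoint_def]
  apply LinearPMap.eq_of_eq_graph
  rw [LinearPMap.adjoint_graph_eq_graph_adjoint hd]
  ext ⟨ψ, χ⟩
  rw [Submodule.mem_adjoint_iff]
  constructor
  · intro hx
    exact h.mem_of_adjoint hc fun x hx' => sub_eq_zero.1 (hx x.1 x.2 hx')
  · intro hx a b hab
    exact sub_eq_zero.2 (h.symm _ hab _ hx).symm

theorem essentiallySelfAdjoint_of_semiboundedGraph {T : E →ₗ.[ℂ] E}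
    (hd : Dense (T.domain : Set E)) (h : SemiboundedGraph T.graph) :
    EssentiallySelfAdjoint T := by
  have hcl := isClosable_of_symm hd h
  refine ⟨hcl, isSelfAdjoint_of_semiboundedGraph (hd.mono T.le_closure.1) hcl.closure_isClosed ?_⟩
  rw [← hcl.graph_closure_eq_closure_graph]
  exact h.closure

end Complete

/-- Schwarz's inequality for a symmetric form that is nonnegative on a subspace. -/
theorem sq_re_inner_le {G : Submodule ℂ (E × E)}
    (hs : ∀ x ∈ G, ∀ y ∈ G, inner ℂ x.1 y.2 = inner ℂ x.2 y.1)
    (hp : ∀ x ∈ G, 0 ≤ (inner ℂ x.1 x.2).re) {x y : E × E} (hx : x ∈ G) (hy : y ∈ G) :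
    (inner ℂ x.1 y.2).re ^ 2 ≤ (inner ℂ x.1 x.2).re * (inner ℂ y.1 y.2).re := by
  -- The form evaluated at `x + ty` is a nonnegative quadratic in `t`, so its discriminant is
  -- nonpositive.
  have h1 : ∀ t : ℝ, 0 ≤ (inner ℂ y.1 y.2).re * (t * t) + (2 * (inner ℂ x.1 y.2).re) * t +
      (inner ℂ x.1 x.2).re := by
    intro t
    have h := hp (x + (t : ℂ) • y) (G.add_mem hx (G.smul_mem _ hy))
    have h2 : (inner ℂ y.1 x.2).re = (inner ℂ x.1 y.2).re := by
      rw [← inner_conj_symm, Complex.conj_re, hs x hx y hy]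
    simp only [Prod.fst_add, Prod.snd_add, Prod.smul_fst, Prod.smul_snd, inner_add_left,
      inner_add_right, inner_smul_left, inner_smul_right, Complex.add_re, Complex.conj_ofReal,
      Complex.re_ofReal_mul] at h
    rw [h2] at h
    linarith
  have h2 := discrim_le_zero h1
  rw [discrim] at h2
  nlinarith

theorem le_of_pow_two_pow_le {r δ M : ℝ} (hδ : 0 < δ)
    (h : ∀ n : ℕ, r ^ (2 ^ n) ≤ M * δ ^ (2 ^ n)) : r ≤ δ := by
  by_contra! hlt
  have h1 : 1 < r / δ := (one_lt_div hδ).2 hlt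
  have ht : Tendsto (fun n : ℕ => (r / δ) ^ (2 ^ n)) atTop atTop :=
    (tendsto_pow_atTop_atTop_of_one_lt h1).comp
      (tendsto_pow_atTop_atTop_of_one_lt (by norm_num))
  obtain ⟨n, hn⟩ := (ht.eventually (eventually_gt_atTop M)).exists
  have h2 := h n
  rw [div_pow, lt_div_iff₀ (by positivity)] at hn
  linarith

/-- Heinz' inequality for symmetric operators: an operator bound implies the form bound with the
same constant. The triples are `(ψ, Pψ, Bψ)`. -/
theorem abs_re_inner_le_of_norm_le {G : Submodule ℂ (E × E × E)} {δ : ℝ} (hδ : 0 < δ)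
    (hP : ∀ x ∈ G, ∀ y ∈ G, inner ℂ x.1 y.2.1 = inner ℂ x.2.1 y.1)
    (hpos : ∀ x ∈ G, 0 ≤ (inner ℂ x.1 x.2.1).re)
    (hB : ∀ x ∈ G, ∀ y ∈ G, inner ℂ x.1 y.2.2 = inner ℂ x.2.2 y.1)
    (hsurj : ∀ f : E, ∃ x ∈ G, x.2.1 = f)
    (hle : ∀ x ∈ G, ‖x.2.2‖ ≤ δ * ‖x.2.1‖) {x : E × E × E} (hx : x ∈ G) :
    |(inner ℂ x.1 x.2.2).re| ≤ δ * (inner ℂ x.1 x.2.1).re := by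
  choose S hS hS' using hsurj
  -- The sequence is `uₙ = (P⁻¹B)ⁿ ψ`: each `uₙ₊₁` solves `P uₙ₊₁ = B uₙ`.
  obtain ⟨u, u0, us⟩ : ∃ u : ℕ → E × E × E, u 0 = x ∧ ∀ n, u (n + 1) = S (u n).2.2 :=
    ⟨fun n => Nat.rec x (fun _ y => S y.2.2) n, rfl, fun n => rfl⟩
  have uG : ∀ n, u n ∈ G := by
    intro n
    cases n with
    | zero => exact u0 ▸ hx
    | succ n => rw [us]; exact hS _
  have uP : ∀ n, (u (n + 1)).2.1 = (u n).2.2 := fun n => by rw [us]; exact hS' _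
  -- `P⁻¹B` is symmetric for the form of `P`, so the moments `⟨uⱼ, P uₖ⟩` depend on `j + k` only.
  have hank : ∀ j k, (inner ℂ (u j).1 (u (k + 1)).2.1 : ℂ) = inner ℂ (u (j + 1)).1 (u k).2.1 := by
    intro j k
    rw [uP k, hB _ (uG j) _ (uG k), ← uP j, ← hP _ (uG (j + 1)) _ (uG k)]
  have hank' : ∀ j k, (inner ℂ (u j).1 (u k).2.1 : ℂ) = inner ℂ x.1 (u (j + k)).2.1 := by
    intro j
    induction j with
    | zero => intro k; rw [Nat.zero_add, u0]
    | succ j ih => intro k; rw [← hank j k, ih, show j + (k + 1) = j + 1 + k by ring]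
  set s : ℕ → ℝ := fun k => (inner ℂ x.1 (u k).2.1).re with hs
  have hs0 : s 0 = (inner ℂ x.1 x.2.1).re := by simp only [hs, u0]
  have hs1 : s 1 = (inner ℂ x.1 x.2.2).re := by simp only [hs]; rw [show 1 = 0 + 1 from rfl, uP 0, u0]
  -- Schwarz for the form of `P` at `ψ` and `uₖ`, since `⟨uₖ, P uₖ⟩ = s (2k)`.
  have cs : ∀ k, s k ^ 2 ≤ s 0 * s (2 * k) := by
    intro k
    have := sq_re_inner_le (G := G.map (LinearMap.id.prodMap (LinearMap.fst ℂ E E)))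
      (by rintro _ ⟨a, ha, rfl⟩ _ ⟨b, hb, rfl⟩; exact hP a ha b hb)
      (by rintro _ ⟨a, ha, rfl⟩; exact hpos a ha)
      (Submodule.mem_map_of_mem hx) (Submodule.mem_map_of_mem (uG k))
    simp only [LinearMap.prodMap_apply, LinearMap.id_apply, LinearMap.fst_apply] at this
    rw [hank' k k, ← two_mul] at this
    rw [hs0]; exact this
  have hgrow : ∀ k, ‖(u k).2.1‖ ≤ δ ^ k * ‖x.2.1‖ := by
    intro k
    induction k with
    | zero => simp [u0]
    | succ k ih =>
      rw [uP, pow_succ']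
      calc ‖(u k).2.2‖ ≤ δ * ‖(u k).2.1‖ := hle _ (uG k)
        _ ≤ δ * (δ ^ k * ‖x.2.1‖) := by gcongr
        _ = _ := by ring
  have hsle : ∀ k, |s k| ≤ ‖x.1‖ * ‖x.2.1‖ * δ ^ k := by
    intro k
    calc |s k| ≤ ‖(inner ℂ x.1 (u k).2.1 : ℂ)‖ := Complex.abs_re_le_norm _
      _ ≤ ‖x.1‖ * ‖(u k).2.1‖ := norm_inner_le_norm _ _
      _ ≤ ‖x.1‖ * (δ ^ k * ‖x.2.1‖) := by gcongr; exact hgrow k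
      _ = _ := by ring
  rw [← hs0, ← hs1]
  have h0 : 0 ≤ s 0 := hs0 ▸ hpos x hx
  rcases h0.eq_or_lt with h00 | h00
  · have := cs 1
    rw [← h00, zero_mul] at this
    have : s 1 = 0 := by nlinarith [sq_nonneg (s 1)]
    rw [this, ← h00]; simp
  -- Repeated doubling of the index bounds `s (2ⁿ)` from below by a power of `|s 1| / s 0`. The
  -- operator bound gives growth of order at most `δ ^ (2ⁿ)`, so comparing rates yields `|s 1| / s 0
  -- ≤ δ`.
  · have hlow : ∀ n : ℕ, s 0 * (|s 1| / s 0) ^ (2 ^ n) ≤ |s (2 ^ n)| := by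
      intro n
      induction n with
      | zero => simp [mul_div_cancel₀ _ h00.ne']
      | succ n ih =>
        have h3 := cs (2 ^ n)
        have h4 : (s 0 * (|s 1| / s 0) ^ (2 ^ n)) ^ 2 ≤ s (2 ^ n) ^ 2 := by
          rw [← sq_abs (s (2 ^ n))]
          gcongr
        rw [show 2 ^ (n + 1) = 2 * 2 ^ n by ring]
        have h5 : s 0 * (|s 1| / s 0) ^ (2 * 2 ^ n) * s 0 ≤ s (2 * 2 ^ n) * s 0 := by
          calc s 0 * (|s 1| / s 0) ^ (2 * 2 ^ n) * s 0 = (s 0 * (|s 1| / s 0) ^ (2 ^ n)) ^ 2 := by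
                rw [mul_pow, ← pow_mul]; ring
            _ ≤ s 0 * s (2 * 2 ^ n) := h4.trans h3
            _ = _ := mul_comm _ _
        exact (le_of_mul_le_mul_right h5 h00).trans (le_abs_self _)
    have := le_of_pow_two_pow_le (r := |s 1| / s 0) (δ := δ) (M := ‖x.1‖ * ‖x.2.1‖ / s 0)
      hδ fun n => by
        rw [div_mul_eq_mul_div, le_div_iff₀ h00, mul_comm]
        exact (hlow n).trans (hsle _)
    rwa [div_le_iff₀ h00] at this

/-- The map `(ψ, Aψ, Bψ) ↦ (ψ, Aψ)`. -/
def firstPart : E × E × E →ₗ[ℂ] E × E := LinearMap.id.prodMap (LinearMap.fst ℂ E E)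

/-- The map `(ψ, Aψ, Bψ) ↦ (ψ, Aψ + Bψ)`. -/
def totalPart : E × E × E →ₗ[ℂ] E × E :=
  LinearMap.id.prodMap (LinearMap.fst ℂ E E + LinearMap.snd ℂ E E)

theorem firstPart_apply (x : E × E × E) : firstPart x = (x.1, x.2.1) := rfl

theorem totalPart_apply (x : E × E × E) : totalPart x = (x.1, x.2.1 + x.2.2) := rfl

variable [CompleteSpace E]

/-- The Kato–Rellich theorem for an infinitesimally small symmetric perturbation, in terms of the
triples `(ψ, Aψ, Bψ)`. -/
theorem SemiboundedGraph.perturb {G : Submodule ℂ (E × E × E)}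
    (hA : SemiboundedGraph (G.map firstPart))
    (hB : ∀ x ∈ G, ∀ y ∈ G, inner ℂ x.1 y.2.2 = inner ℂ x.2.2 y.1)
    (hrel : ∀ ε > 0, ∃ C : ℝ, ∀ x ∈ G, ‖x.2.2‖ ≤ ε * ‖x.2.1‖ + C * ‖x.1‖) :
    SemiboundedGraph (G.map totalPart) := by
  have hAs : ∀ x ∈ G, ∀ y ∈ G, inner ℂ x.1 y.2.1 = inner ℂ x.2.1 y.1 := fun x hx y hy =>
    hA.symm _ (Submodule.mem_map_of_mem hx) _ (Submodule.mem_map_of_mem hy)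
  obtain ⟨c, hc'⟩ := hA.lower
  have hc : ∀ x ∈ G, c * ‖x.1‖ ^ 2 ≤ (inner ℂ x.1 x.2.1).re := fun x hx =>
    hc' _ (Submodule.mem_map_of_mem hx)
  obtain ⟨μ₀, hμ₀'⟩ := hA.dense
  have hμ₀ : ∀ μ : ℝ, μ₀ ≤ μ → ∀ w : E,
      (∀ x ∈ G, inner ℂ (x.2.1 + (μ : ℂ) • x.1) w = 0) → w = 0 := fun μ hμ w hw =>
    hμ₀' μ hμ w (by rintro _ ⟨x, hx, rfl⟩; exact hw x hx)
  -- For `μ ≥ μ₁` one has `‖Aψ‖ ≤ 3 ‖(A + μ)ψ‖` and `4C ‖ψ‖ ≤ ‖(A + μ)ψ‖`. With relative bound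
  -- `1/12` this gives `‖Bψ‖ ≤ (1/4 + 1/4) ‖(A + μ)ψ‖`.
  obtain ⟨C, hC⟩ := hrel (1 / 12) (by norm_num)
  set μ₁ : ℝ := max (max μ₀ 0) (max (2 * |c|) (1 + |c| + 4 * |C|)) with hμ₁
  have hhalf : ∀ μ : ℝ, μ₁ ≤ μ → ∀ x ∈ G, ‖x.2.2‖ ≤ 1 / 2 * ‖x.2.1 + (μ : ℂ) • x.1‖ := by
    intro μ hμ x hx
    have m0 : 0 ≤ μ := ((le_max_right _ _).trans (le_max_left _ _)).trans hμ
    have m1 : 2 * |c| ≤ μ := ((le_max_left _ _).trans (le_max_right _ _)).trans hμ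
    have m2 : 1 + |c| + 4 * |C| ≤ μ := ((le_max_right _ _).trans (le_max_right _ _)).trans hμ
    have h1 := hC x hx
    have h2 := norm_le_norm_shift (μ := μ) (hc x hx)
    have h3 : ‖x.2.1‖ ≤ ‖x.2.1 + (μ : ℂ) • x.1‖ + μ * ‖x.1‖ := by
      calc ‖x.2.1‖ = ‖x.2.1 + (μ : ℂ) • x.1 - (μ : ℂ) • x.1‖ := by rw [add_sub_cancel_right]
        _ ≤ _ := norm_sub_le _ _
        _ = _ := by rw [norm_smul, Complex.norm_real, Real.norm_eq_abs, abs_of_nonneg m0]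
    have hcabs := neg_abs_le c
    have hCabs := le_abs_self C
    have n1 := norm_nonneg x.1
    have h4 : μ / 2 * ‖x.1‖ ≤ ‖x.2.1 + (μ : ℂ) • x.1‖ := by nlinarith
    have h5 : 4 * C * ‖x.1‖ ≤ ‖x.2.1 + (μ : ℂ) • x.1‖ := by nlinarith
    linarith
  -- If `w` is orthogonal to the range of `A + B + μ`, then `⟨v, w⟩ = -⟨Bψ, w⟩` for `v = (A + μ)ψ`,
  -- so `|⟨v, w⟩| ≤ ½ ‖v‖ ‖w‖`. Such `v` are dense; the choice `v = w` forces `w = 0`.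
  have hdense : ∀ μ : ℝ, μ₁ ≤ μ → ∀ w : E,
      (∀ x ∈ G, inner ℂ (x.2.1 + x.2.2 + (μ : ℂ) • x.1) w = 0) → w = 0 := by
    intro μ hμ w hw
    let L : E × E × E →ₗ[ℂ] E := (LinearMap.fst ℂ E E).comp (LinearMap.snd ℂ E (E × E)) +
      (μ : ℂ) • LinearMap.fst ℂ E (E × E)
    have hLtop : (G.map L).topologicalClosure = ⊤ := by
      rw [Submodule.topologicalClosure_eq_top_iff, Submodule.eq_bot_iff]
      intro v hv
      refine hμ₀ μ (((le_max_left _ _).trans (le_max_left _ _)).trans hμ) v fun x hx => ?_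
      exact (Submodule.mem_orthogonal _ _).1 hv _ (Submodule.mem_map_of_mem (f := L) hx)
    have hb : ∀ v ∈ (G.map L).topologicalClosure, ‖(inner ℂ v w : ℂ)‖ ≤ 1 / 2 * ‖v‖ * ‖w‖ := by
      intro v hv
      refine closure_minimal (s := (G.map L : Set E))
        (t := {v | ‖(inner ℂ v w : ℂ)‖ ≤ 1 / 2 * ‖v‖ * ‖w‖}) ?_
        (isClosed_le (by fun_prop) (by fun_prop)) hv
      rintro _ ⟨x, hx, rfl⟩
      have h1 := hw x hx
      have h2 : L x = x.2.1 + (μ : ℂ) • x.1 := rfl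
      have h3 : (inner ℂ (L x) w : ℂ) = - inner ℂ x.2.2 w := by
        rw [h2, eq_neg_iff_add_eq_zero, ← inner_add_left, ← h1]
        congr 1; abel
      change ‖(inner ℂ (L x) w : ℂ)‖ ≤ 1 / 2 * ‖L x‖ * ‖w‖
      rw [h3, norm_neg]
      refine (norm_inner_le_norm _ _).trans ?_
      gcongr
      exact hhalf μ hμ x hx
    have h1 := hb w (hLtop ▸ Submodule.mem_top)
    rw [inner_self_eq_norm_sq_to_K] at h1
    simp only [Complex.coe_algebraMap, norm_pow, Complex.norm_real, norm_norm] at h1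
    have : ‖w‖ = 0 := by nlinarith [norm_nonneg w]
    exact norm_eq_zero.1 this
  have key : ∀ {p : E × E × E → Prop}, IsClosed {x | p x} → (∀ x ∈ G, p x) →
      ∀ x ∈ G.topologicalClosure, p x := fun {p} hp hG x hx =>
    closure_minimal (s := (G : Set (E × E × E))) (t := {x | p x}) (fun y hy => hG y hy) hp hx
  have key2 : ∀ {f g : E × E × E → E × E × E → ℂ}, (∀ x, Continuous (f x)) →
      (∀ x, Continuous (g x)) → (∀ y, Continuous fun x => f x y) →
      (∀ y, Continuous fun x => g x y) → (∀ x ∈ G, ∀ y ∈ G, f x y = g x y) →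
      ∀ x ∈ G.topologicalClosure, ∀ y ∈ G.topologicalClosure, f x y = g x y := by
    intro f g h1 h2 h3 h4 h5
    refine key ?_ fun x hx => key (isClosed_eq (h1 x) (h2 x)) fun y hy => h5 x hx y hy
    have : {x : E × E × E | ∀ y ∈ G.topologicalClosure, f x y = g x y} =
          ⋂ y ∈ G.topologicalClosure, {x : E × E × E | f x y = g x y} := by
        ext; simp
    rw [this]
    exact isClosed_biInter fun y _ => isClosed_eq (h3 y) (h4 y)
  -- The lower bound of `A + B` comes from Heinz' inequality with `P = A + μ₁`. That inequality
  -- needs `P` to be onto, so it is applied to the closure of the space of triples.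
  have hform : ∀ x ∈ G, |(inner ℂ x.1 x.2.2).re| ≤
      1 / 2 * (inner ℂ x.1 (x.2.1 + (μ₁ : ℂ) • x.1)).re := by
    have m0 : 0 ≤ μ₁ := (le_max_right _ _).trans (le_max_left _ _)
    have m2 : 1 + |c| ≤ μ₁ := by
      have := (le_max_right (2 * |c|) (1 + |c| + 4 * |C|)).trans
        (le_max_right (max μ₀ 0) (max (2 * |c|) (1 + |c| + 4 * |C|)))
      have h4 := abs_nonneg C
      linarith
    have m3 : 1 ≤ μ₁ + c := by linarith [neg_abs_le c]
    let Sh : E × E × E →ₗ[ℂ] E × E × E := LinearMap.id.prodMap 0 +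
      ((LinearMap.inr ℂ E (E × E)).comp (LinearMap.inl ℂ E E)).comp
        ((LinearMap.fst ℂ E E).comp (LinearMap.snd ℂ E (E × E)) +
          (μ₁ : ℂ) • LinearMap.fst ℂ E (E × E)) +
      ((LinearMap.inr ℂ E (E × E)).comp (LinearMap.inr ℂ E E)).comp
        ((LinearMap.snd ℂ E E).comp (LinearMap.snd ℂ E (E × E)))
    have hSh : ∀ x, Sh x = (x.1, x.2.1 + (μ₁ : ℂ) • x.1, x.2.2) := by
      intro x; simp [Sh]
    intro x hx
    have := abs_re_inner_le_of_norm_le (G := G.topologicalClosure.map Sh) (δ := 1 / 2)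
      (by norm_num) ?_ ?_ ?_ ?_ ?_ (Submodule.mem_map_of_mem (G.le_topologicalClosure hx))
    · simpa only [hSh] using this
    · rintro _ ⟨a, ha, rfl⟩ _ ⟨b, hb, rfl⟩
      simp only [hSh]
      refine key2 (f := fun a b => inner ℂ a.1 (b.2.1 + (μ₁ : ℂ) • b.1))
        (g := fun a b => inner ℂ (a.2.1 + (μ₁ : ℂ) • a.1) b.1) (by fun_prop) (by fun_prop)
        (by fun_prop) (by fun_prop) (fun x hx y hy => ?_) a ha b hb
      simp only [inner_add_left, inner_add_right, inner_smul_left, inner_smul_right,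
        Complex.conj_ofReal, hAs x hx y hy]
    · rintro _ ⟨a, ha, rfl⟩
      simp only [hSh]
      refine key (p := fun a => 0 ≤ (inner ℂ a.1 (a.2.1 + (μ₁ : ℂ) • a.1)).re)
        (isClosed_le (by fun_prop) (Complex.continuous_re.comp (by fun_prop))) (fun y hy => ?_) a ha
      rw [re_inner_add_smul]
      nlinarith [hc y hy, sq_nonneg ‖y.1‖]
    · rintro _ ⟨a, ha, rfl⟩ _ ⟨b, hb, rfl⟩
      simp only [hSh]
      exact key2 (f := fun a b => inner ℂ a.1 b.2.2)
        (g := fun a b => inner ℂ a.2.2 b.1) (by fun_prop) (by fun_prop)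
        (by fun_prop) (by fun_prop) hB a ha b hb
    · intro f
      let L : E × E × E →L[ℂ] E :=
        (ContinuousLinearMap.fst ℂ E E).comp (ContinuousLinearMap.snd ℂ E (E × E)) +
          (μ₁ : ℂ) • ContinuousLinearMap.fst ℂ E (E × E)
      have hL : ∀ x, L x = x.2.1 + (μ₁ : ℂ) • x.1 := fun x => rfl
      have hb : ∀ x ∈ G, ‖x‖ ≤ (1 + μ₁) * ‖L x‖ := by
        intro x hx
        have h1 := hhalf μ₁ le_rfl x hx
        rw [← hL] at h1
        have h2 := norm_le_norm_shift (μ := μ₁) (hc x hx)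
        rw [← hL] at h2
        have h3 : ‖x.2.1‖ ≤ ‖L x‖ + μ₁ * ‖x.1‖ := by
          calc ‖x.2.1‖ = ‖L x - (μ₁ : ℂ) • x.1‖ := by rw [hL, add_sub_cancel_right]
            _ ≤ _ := norm_sub_le _ _
            _ = _ := by rw [norm_smul, Complex.norm_real, Real.norm_eq_abs, abs_of_nonneg m0]
        have h4 : ‖x.1‖ ≤ ‖L x‖ := by nlinarith [norm_nonneg x.1]
        have h5 := mul_le_mul_of_nonneg_left h4 m0
        have h6 := mul_nonneg m0 (norm_nonneg (L x))
        have h7 := norm_nonneg (L x)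
        rw [Prod.norm_def, Prod.norm_def]
        refine max_le ?_ (max_le ?_ ?_) <;> linarith
      obtain ⟨y, hy, hy'⟩ := exists_mem_map_eq G.isClosed_topologicalClosure L
        (C := ⟨1 + μ₁, by positivity⟩) (key (p := fun x => ‖x‖ ≤ (1 + μ₁) * ‖L x‖)
          (isClosed_le (by fun_prop) (by fun_prop)) hb)
        (fun w hw => hμ₀ μ₁ ((le_max_left _ _).trans (le_max_left _ _)) w
            fun x hx => hw x (G.le_topologicalClosure hx)) f
      exact ⟨_, Submodule.mem_map_of_mem hy, by rw [hSh]; exact hy'⟩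
    · rintro _ ⟨a, ha, rfl⟩
      simp only [hSh]
      exact key (isClosed_le (by fun_prop) (by fun_prop)) (hhalf μ₁ le_rfl) a ha
  refine ⟨?_, ⟨-μ₁, ?_⟩, ⟨μ₁, fun μ hμ w hw => hdense μ hμ w fun x hx => ?_⟩⟩
  · rintro _ ⟨x, hx, rfl⟩ _ ⟨y, hy, rfl⟩
    simp only [totalPart_apply, inner_add_left, inner_add_right, hAs x hx y hy, hB x hx y hy]
  · rintro _ ⟨x, hx, rfl⟩
    simp only [totalPart_apply]
    have h1 := hform x hx
    rw [re_inner_add_smul] at h1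
    rw [inner_add_right, Complex.add_re]
    have h2 := neg_abs_le (inner ℂ x.1 x.2.2).re
    have h3 := hc x hx
    have m0 : 0 ≤ μ₁ := (le_max_right _ _).trans (le_max_left _ _)
    have m2 : -c ≤ μ₁ := by
      have := (le_max_right (2 * |c|) (1 + |c| + 4 * |C|)).trans
        (le_max_right (max μ₀ 0) (max (2 * |c|) (1 + |c| + 4 * |C|)))
      have h4 := abs_nonneg C
      linarith [neg_abs_le c]
    nlinarith [sq_nonneg ‖x.1‖]
  · exact hw _ (Submodule.mem_map_of_mem hx)

end AbstractOperators

/-! ### Partial derivatives, Green's identities, mollification and Kato's pointwise inequality -/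

section Calculus

variable {d : ℕ} {F G W : Type*} [NormedAddCommGroup F] [NormedSpace ℝ F]
  [NormedAddCommGroup G] [NormedSpace ℝ G] [NormedAddCommGroup W] [NormedSpace ℝ W]

/-- The derivative of `f` in the direction of the `i`-th basis vector. -/
def partialDeriv (i : Fin d) (f : EuclideanSpace ℝ (Fin d) → F) (x : EuclideanSpace ℝ (Fin d)) :
    F :=
  fderiv ℝ f x (EuclideanSpace.basisFun (Fin d) ℝ i)

theorem contDiff_partialDeriv {f : EuclideanSpace ℝ (Fin d) → F} (hf : ContDiff ℝ ∞ f)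
    (i : Fin d) : ContDiff ℝ ∞ (partialDeriv i f) :=
  (hf.fderiv_right (m := ∞) (by norm_cast)).clm_apply contDiff_const

theorem hasCompactSupport_partialDeriv {f : EuclideanSpace ℝ (Fin d) → F}
    (hf : HasCompactSupport f) (i : Fin d) : HasCompactSupport (partialDeriv i f) :=
  hf.fderiv_apply (𝕜 := ℝ) _

theorem laplacian_eq_sum_partialDeriv {f : EuclideanSpace ℝ (Fin d) → F} (hf : ContDiff ℝ ∞ f) :
    Δ f = fun x => ∑ i, partialDeriv i (partialDeriv i f) x := by
  rw [InnerProductSpace.laplacian_eq_iteratedFDeriv_orthonormalBasis f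
    (EuclideanSpace.basisFun (Fin d) ℝ)]
  funext x
  refine Finset.sum_congr rfl fun i _ => ?_
  rw [iteratedFDeriv_two_apply]
  simp only [partialDeriv, Matrix.cons_val_zero, Matrix.cons_val_one]
  have h : DifferentiableAt ℝ (fderiv ℝ f) x :=
    (hf.fderiv_right (m := ∞) (by norm_cast)).differentiable (by norm_num) x
  have e := fderiv_clm_apply h (differentiableAt_const (EuclideanSpace.basisFun (Fin d) ℝ i))
  rw [show partialDeriv i f = fun y => fderiv ℝ f y (EuclideanSpace.basisFun (Fin d) ℝ i) from rfl,
    e]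
  simp

theorem contDiff_laplacian {f : EuclideanSpace ℝ (Fin d) → F} (hf : ContDiff ℝ ∞ f) :
    ContDiff ℝ ∞ (Δ f) := by
  rw [laplacian_eq_sum_partialDeriv hf]
  exact ContDiff.sum fun i _ => contDiff_partialDeriv (contDiff_partialDeriv hf i) i

theorem hasCompactSupport_laplacian {f : EuclideanSpace ℝ (Fin d) → F} (hf : ContDiff ℝ ∞ f)
    (hc : HasCompactSupport f) : HasCompactSupport (Δ f) := by
  rw [laplacian_eq_sum_partialDeriv hf]
  refine hc.mono' fun x hx => ?_
  obtain ⟨i, _, hi⟩ := Finset.exists_ne_zero_of_sum_ne_zero hx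
  have h1 : tsupport (partialDeriv i (partialDeriv i f)) ⊆ tsupport f :=
    (tsupport_fderiv_apply_subset ℝ _).trans (tsupport_fderiv_apply_subset ℝ _)
  exact h1 (subset_tsupport _ hi)

theorem integrable_bilinear {f : EuclideanSpace ℝ (Fin d) → F} {g : EuclideanSpace ℝ (Fin d) → G}
    (hf : Continuous f) (hg : Continuous g) (hc : HasCompactSupport f) (B : F →L[ℝ] G →L[ℝ] W) :
    Integrable fun x => B (f x) (g x) := by
  refine Continuous.integrable_of_hasCompactSupport (by fun_prop) ?_
  refine hc.mono fun x hx => ?_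
  contrapose! hx
  simp only [Function.mem_support, not_not] at hx ⊢
  simp [hx]

/-- Integration by parts without a boundary term: it is enough that one of the two factors has
compact support. -/
theorem integral_bilinear_partialDeriv {f : EuclideanSpace ℝ (Fin d) → F}
    {g : EuclideanSpace ℝ (Fin d) → G} (hf : ContDiff ℝ ∞ f) (hg : ContDiff ℝ ∞ g)
    (hc : HasCompactSupport f) (B : F →L[ℝ] G →L[ℝ] W) (i : Fin d) :
    ∫ x, B (f x) (partialDeriv i g x) = -∫ x, B (partialDeriv i f x) (g x) := by
  refine integral_bilinear_fderiv_right_eq_neg_left_of_integrable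
    (integrable_bilinear (contDiff_partialDeriv hf i).continuous hg.continuous
      (hasCompactSupport_partialDeriv hc i) B)
    (integrable_bilinear hf.continuous (contDiff_partialDeriv hg i).continuous hc B)
    (integrable_bilinear hf.continuous hg.continuous hc B)
    (fun x _ => hf.differentiable (by norm_num) x) (fun x _ => hg.differentiable (by norm_num) x)

/-- Green's first identity. -/
theorem integral_bilinear_laplacian {f : EuclideanSpace ℝ (Fin d) → F}
    {g : EuclideanSpace ℝ (Fin d) → G} (hf : ContDiff ℝ ∞ f) (hg : ContDiff ℝ ∞ g)
    (hc : HasCompactSupport f) (B : F →L[ℝ] G →L[ℝ] W) :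
    ∫ x, B (f x) ((Δ g) x) = -∑ i, ∫ x, B (partialDeriv i f x) (partialDeriv i g x) := by
  rw [laplacian_eq_sum_partialDeriv hg, ← Finset.sum_neg_distrib]
  simp only [map_sum]
  rw [integral_finsetSum _ fun i _ => integrable_bilinear hf.continuous
    (contDiff_partialDeriv (contDiff_partialDeriv hg i) i).continuous hc B]
  exact Finset.sum_congr rfl fun i _ =>
    integral_bilinear_partialDeriv hf (contDiff_partialDeriv hg i) hc B i

/-- Green's second identity. -/
theorem integral_bilinear_laplacian_comm {f : EuclideanSpace ℝ (Fin d) → F}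
    {g : EuclideanSpace ℝ (Fin d) → G} (hf : ContDiff ℝ ∞ f) (hg : ContDiff ℝ ∞ g)
    (hc : HasCompactSupport f) (B : F →L[ℝ] G →L[ℝ] W) :
    ∫ x, B (f x) ((Δ g) x) = ∫ x, B ((Δ f) x) (g x) := by
  rw [integral_bilinear_laplacian hf hg hc, laplacian_eq_sum_partialDeriv hf]
  simp only [map_sum, sum_apply]
  rw [integral_finsetSum _ fun i _ => integrable_bilinear
    (contDiff_partialDeriv (contDiff_partialDeriv hf i) i).continuous hg.continuous
    (hasCompactSupport_partialDeriv (hasCompactSupport_partialDeriv hc i) i) B,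
    ← Finset.sum_neg_distrib]
  refine Finset.sum_congr rfl fun i _ => ?_
  rw [integral_bilinear_partialDeriv (contDiff_partialDeriv hf i) hg
    (hasCompactSupport_partialDeriv hc i), neg_neg]

theorem partialDeriv_comp_sub {f : EuclideanSpace ℝ (Fin d) → F} (hf : ContDiff ℝ ∞ f)
    (x : EuclideanSpace ℝ (Fin d)) (i : Fin d) :
    partialDeriv i (fun y => f (x - y)) = fun y => -partialDeriv i f (x - y) := by
  funext y
  have h1 : HasFDerivAt (fun y => f (x - y)) _ y :=
    (hf.differentiable (by norm_num) (x - y)).hasFDerivAt.comp y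
      ((hasFDerivAt_const x y).sub (hasFDerivAt_id y))
  simp [partialDeriv, h1.fderiv]

theorem laplacian_comp_sub {f : EuclideanSpace ℝ (Fin d) → F} (hf : ContDiff ℝ ∞ f)
    (x : EuclideanSpace ℝ (Fin d)) :
    Δ (fun y => f (x - y)) = fun y => (Δ f) (x - y) := by
  have hs : ContDiff ℝ ∞ fun y => f (x - y) := hf.comp (contDiff_const.sub contDiff_id)
  rw [laplacian_eq_sum_partialDeriv hf, laplacian_eq_sum_partialDeriv hs]
  funext y
  refine Finset.sum_congr rfl fun i _ => ?_
  have e : partialDeriv i (fun y => -partialDeriv i f (x - y)) y =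
      -partialDeriv i (fun y => partialDeriv i f (x - y)) y := by
    simp [partialDeriv, fderiv_fun_neg]
  rw [partialDeriv_comp_sub hf, e, congrFun (partialDeriv_comp_sub (contDiff_partialDeriv hf i) x i),
    neg_neg]

theorem partialDeriv_comp_smul {f : EuclideanSpace ℝ (Fin d) → F} (hf : ContDiff ℝ ∞ f)
    (c : ℝ) (a : EuclideanSpace ℝ (Fin d)) (i : Fin d) :
    partialDeriv i (fun y => f (a + c • y)) = fun y => c • partialDeriv i f (a + c • y) := by
  funext y
  have h1 : HasFDerivAt (fun y => f (a + c • y)) _ y :=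
    (hf.differentiable (by norm_num) (a + c • y)).hasFDerivAt.comp y
      (((hasFDerivAt_id y).const_smul c).const_add a)
  simp [partialDeriv, h1.fderiv]

theorem laplacian_comp_smul {f : EuclideanSpace ℝ (Fin d) → F} (hf : ContDiff ℝ ∞ f)
    (c : ℝ) (a : EuclideanSpace ℝ (Fin d)) :
    Δ (fun y => f (a + c • y)) = fun y => c ^ 2 • (Δ f) (a + c • y) := by
  have hs : ContDiff ℝ ∞ fun y => f (a + c • y) := by fun_prop
  have hs' : ∀ i, ContDiff ℝ ∞ fun y => partialDeriv i f (a + c • y) := fun i => by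
    have := contDiff_partialDeriv hf i
    fun_prop
  rw [laplacian_eq_sum_partialDeriv hf, laplacian_eq_sum_partialDeriv hs]
  funext y
  rw [Finset.smul_sum]
  refine Finset.sum_congr rfl fun i _ => ?_
  have e : partialDeriv i (fun y => c • partialDeriv i f (a + c • y)) y =
      c • partialDeriv i (fun y => partialDeriv i f (a + c • y)) y := by
    have e' := fderiv_fun_const_smul ((hs' i).differentiable (by norm_num) y) c
    rw [partialDeriv, e']
    rfl
  rw [partialDeriv_comp_smul hf, e,
    congrFun (partialDeriv_comp_smul (contDiff_partialDeriv hf i) c a i), smul_smul, pow_two]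

section Mollify

variable {ρ : EuclideanSpace ℝ (Fin d) → ℝ} {ψ : EuclideanSpace ℝ (Fin d) → F}

/-- The convolution of a scalar test function with a locally integrable function. -/
def mollify (ρ : EuclideanSpace ℝ (Fin d) → ℝ) (ψ : EuclideanSpace ℝ (Fin d) → F) :
    EuclideanSpace ℝ (Fin d) → F :=
  convolution ρ ψ (ContinuousLinearMap.lsmul ℝ ℝ) volume

theorem mollify_apply (x : EuclideanSpace ℝ (Fin d)) :
    mollify ρ ψ x = ∫ y, ρ (x - y) • ψ y := by
  rw [mollify, convolution_eq_swap]
  rfl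

theorem contDiff_mollify (hρ : ContDiff ℝ ∞ ρ) (hc : HasCompactSupport ρ)
    (hψ : LocallyIntegrable ψ) : ContDiff ℝ ∞ (mollify ρ ψ) :=
  hc.contDiff_convolution_left _ (n := ⊤) hρ hψ

theorem partialDeriv_mollify (hρ : ContDiff ℝ ∞ ρ) (hc : HasCompactSupport ρ)
    (hψ : LocallyIntegrable ψ) (i : Fin d) :
    partialDeriv i (mollify ρ ψ) = mollify (partialDeriv i ρ) ψ := by
  funext x
  have h := hc.hasFDerivAt_convolution_left (ContinuousLinearMap.lsmul ℝ ℝ) (μ := volume)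
    (hρ.of_le (by norm_cast)) hψ x
  rw [partialDeriv, mollify, h.fderiv, mollify, convolution, convolution,
    ContinuousLinearMap.integral_apply]
  · rfl
  · exact (hc.fderiv (𝕜 := ℝ)).convolutionExists_left _
      ((hρ.fderiv_right (m := ∞) (by norm_cast)).continuous) hψ x

/-- All derivatives fall on the kernel. They are taken in the integration variable, so that `y ↦ ρ
(x - y)` can serve as the test function in a weak equation. -/
theorem laplacian_mollify (hρ : ContDiff ℝ ∞ ρ) (hc : HasCompactSupport ρ)
    (hψ : LocallyIntegrable ψ) (x : EuclideanSpace ℝ (Fin d)) :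
    (Δ (mollify ρ ψ)) x = ∫ y, (Δ fun y => ρ (x - y)) y • ψ y := by
  rw [laplacian_eq_sum_partialDeriv (contDiff_mollify hρ hc hψ), laplacian_comp_sub hρ,
    laplacian_eq_sum_partialDeriv hρ]
  simp only [Finset.sum_smul]
  rw [integral_finsetSum]
  · refine Finset.sum_congr rfl fun i _ => ?_
    rw [partialDeriv_mollify hρ hc hψ, partialDeriv_mollify (contDiff_partialDeriv hρ i)
      (hasCompactSupport_partialDeriv hc i) hψ, mollify_apply]
  · intro i _
    have h1 := contDiff_partialDeriv (contDiff_partialDeriv hρ i) i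
    have h2 := hasCompactSupport_partialDeriv (hasCompactSupport_partialDeriv hc i) i
    refine hψ.integrable_smul_left_of_hasCompactSupport (h1.continuous.comp (by fun_prop)) ?_
    exact h2.comp_homeomorph (Homeomorph.subLeft x)

/-- Mollification of a weak identity `Δψ = g`. -/
theorem laplacian_mollify_eq {g : EuclideanSpace ℝ (Fin d) → F} (hρ : ContDiff ℝ ∞ ρ)
    (hc : HasCompactSupport ρ) (hψ : LocallyIntegrable ψ)
    (h : ∀ η : EuclideanSpace ℝ (Fin d) → ℝ, ContDiff ℝ ∞ η → HasCompactSupport η →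
      ∫ x, (Δ η) x • ψ x = ∫ x, η x • g x) :
    Δ (mollify ρ ψ) = mollify ρ g := by
  funext x
  rw [laplacian_mollify hρ hc hψ, mollify_apply]
  exact h _ (hρ.comp (contDiff_const.sub contDiff_id)) (hc.comp_homeomorph (Homeomorph.subLeft x))

end Mollify

section RegularizedNorm

variable {H : Type*} [NormedAddCommGroup H]

/-- The smooth approximation `√(|z|² + ε²) - ε` of `|z|`. -/
def regNorm (ε : ℝ) (z : H) : ℝ := Real.sqrt (‖z‖ ^ 2 + ε ^ 2) - ε

theorem regNorm_nonneg {ε : ℝ} (z : H) : 0 ≤ regNorm ε z :=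
  sub_nonneg.2 (Real.le_sqrt_of_sq_le (by nlinarith [sq_nonneg ‖z‖]))

theorem regNorm_zero {ε : ℝ} (hε : 0 < ε) : regNorm ε (0 : H) = 0 := by
  simp [regNorm, Real.sqrt_sq hε.le]

theorem regNorm_le {ε : ℝ} (hε : 0 < ε) (z : H) : regNorm ε z ≤ ‖z‖ := by
  rw [regNorm, sub_le_iff_le_add]
  refine Real.sqrt_le_iff.2 ⟨by positivity, ?_⟩
  nlinarith [mul_nonneg (norm_nonneg z) hε.le]

theorem norm_le_regNorm_add {ε : ℝ} (z : H) : ‖z‖ ≤ regNorm ε z + ε := by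
  rw [regNorm, sub_add_cancel]
  exact Real.le_sqrt_of_sq_le (by nlinarith [sq_nonneg ε])

theorem hasCompactSupport_regNorm {ε : ℝ} (hε : 0 < ε) {ψ : EuclideanSpace ℝ (Fin d) → H}
    (hψ : HasCompactSupport ψ) : HasCompactSupport fun x => regNorm ε (ψ x) :=
  hψ.comp_left (regNorm_zero hε)

variable [InnerProductSpace ℝ H]

theorem contDiff_regNorm {ε : ℝ} (hε : 0 < ε) {ψ : EuclideanSpace ℝ (Fin d) → H}
    (hψ : ContDiff ℝ ∞ ψ) : ContDiff ℝ ∞ fun x => regNorm ε (ψ x) := by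
  refine ContDiff.sub (ContDiff.sqrt ((hψ.norm_sq ℝ).add contDiff_const) fun x => ?_) contDiff_const
  positivity

/-- Kato's inequality for smooth functions. -/
theorem inner_laplacian_le {ε : ℝ} (hε : 0 < ε) {ψ : EuclideanSpace ℝ (Fin d) → H}
    (hψ : ContDiff ℝ ∞ ψ) (x : EuclideanSpace ℝ (Fin d)) :
    inner ℝ (ψ x) ((Δ ψ) x) ≤
      Real.sqrt (‖ψ x‖ ^ 2 + ε ^ 2) * (Δ fun x => regNorm ε (ψ x)) x := by
  set u : EuclideanSpace ℝ (Fin d) → ℝ := fun x => regNorm ε (ψ x) with hu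
  set s : EuclideanSpace ℝ (Fin d) → ℝ := fun x => Real.sqrt (‖ψ x‖ ^ 2 + ε ^ 2) with hs
  have hsu : s = fun x => u x + ε := by funext x; simp [hs, hu, regNorm]
  have hus : ContDiff ℝ ∞ u := contDiff_regNorm hε hψ
  have hss : ContDiff ℝ ∞ s := hsu ▸ hus.add contDiff_const
  have hspos : ∀ x, 0 < s x := fun x => Real.sqrt_pos.2 (by positivity)
  have hs2 : (fun x => s x * s x) = fun x => inner ℝ (ψ x) (ψ x) + ε ^ 2 := by
    funext x
    rw [real_inner_self_eq_norm_sq]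
    exact Real.mul_self_sqrt (by positivity)
  have hDs : ∀ i, partialDeriv i s = partialDeriv i u := by
    intro i; funext x; rw [hsu]; simp [partialDeriv]
  have dψ : Differentiable ℝ ψ := hψ.differentiable (by norm_num)
  have ds : Differentiable ℝ s := hss.differentiable (by norm_num)
  -- Differentiate `s² = |ψ|² + ε²` once, and in `h2` a second time. The inequality then reduces to
  -- `|∂ᵢu| ≤ |∂ᵢψ|`, which holds because `|ψ| ≤ s`.
  have h1 : ∀ i, (fun x => s x * partialDeriv i u x) =
      fun x => inner ℝ (ψ x) (partialDeriv i ψ x) := by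
    intro i
    funext x
    have := congrArg (fun f => partialDeriv i f x) hs2
    simp only [partialDeriv] at this
    rw [fderiv_fun_mul (ds x) (ds x), fderiv_add_const] at this
    rw [fderiv_inner_apply ℝ (dψ x) (dψ x)] at this
    simp only [add_apply, smul_apply, smul_eq_mul] at this
    have h2 := congrFun (hDs i) x
    simp only [partialDeriv] at h2
    simp only [partialDeriv]
    rw [h2, real_inner_comm (ψ x) ((fderiv ℝ ψ x) _)] at this
    linarith
  have h2 : ∀ i, s x * partialDeriv i (partialDeriv i u) x + partialDeriv i u x ^ 2 =
      inner ℝ (ψ x) (partialDeriv i (partialDeriv i ψ) x) + ‖partialDeriv i ψ x‖ ^ 2 := by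
    intro i
    have := congrArg (fun f => partialDeriv i f x) (h1 i)
    simp only [partialDeriv] at this
    have du : DifferentiableAt ℝ (partialDeriv i u) x :=
      (contDiff_partialDeriv hus i).differentiable (by norm_num) x
    have dψ' : DifferentiableAt ℝ (partialDeriv i ψ) x :=
      (contDiff_partialDeriv hψ i).differentiable (by norm_num) x
    have e1 := fderiv_fun_mul (ds x) du
    have e2 := fderiv_inner_apply ℝ (dψ x) dψ' (EuclideanSpace.basisFun (Fin d) ℝ i)
    simp only [partialDeriv] at e1 e2
    rw [e1, e2] at this
    simp only [add_apply, smul_apply, smul_eq_mul] at this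
    have h3 := congrFun (hDs i) x
    simp only [partialDeriv] at h3 ⊢
    rw [h3, real_inner_self_eq_norm_sq] at this
    linarith
  rw [laplacian_eq_sum_partialDeriv hψ, laplacian_eq_sum_partialDeriv hus]
  simp only [inner_sum, Finset.mul_sum]
  refine Finset.sum_le_sum fun i _ => ?_
  have h3 : partialDeriv i u x ^ 2 ≤ ‖partialDeriv i ψ x‖ ^ 2 := by
    have h4 : |s x * partialDeriv i u x| ≤ s x * ‖partialDeriv i ψ x‖ := by
      rw [show s x * partialDeriv i u x = _ from congrFun (h1 i) x]
      refine (abs_real_inner_le_norm _ _).trans ?_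
      gcongr
      exact Real.le_sqrt_of_sq_le (by nlinarith [sq_nonneg ε])
    rw [abs_mul, abs_of_pos (hspos x)] at h4
    have h5 := le_of_mul_le_mul_left h4 (hspos x)
    rw [← sq_abs]
    gcongr
  have := h2 i
  linarith

end RegularizedNorm

end Calculus

/-! ### Approximate identities and Kato's inequality in the sense of distributions -/

section Kato

variable {d : ℕ} {F : Type*} [NormedAddCommGroup F]

/-- Translation is continuous in `Lᵖ`. -/
theorem tendsto_eLpNorm_translate {p : ℝ≥0∞} [Fact (1 ≤ p)] (hp : p ≠ ⊤)
    {f : EuclideanSpace ℝ (Fin d) → F} (hf : MemLp f p) (a : EuclideanSpace ℝ (Fin d)) :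
    Tendsto (fun t => eLpNorm (fun x => f (x - t) - f (x - a)) p volume) (𝓝 a) (𝓝 0) := by
  let T : C(EuclideanSpace ℝ (Fin d), C(EuclideanSpace ℝ (Fin d), EuclideanSpace ℝ (Fin d))) :=
    ContinuousMap.curry ⟨fun z => z.2 - z.1, by fun_prop⟩
  have hT : ∀ t, MeasurePreserving (T t) volume volume := fun t =>
    measurePreserving_sub_right volume t
  have hc : Continuous fun t => Lp.compMeasurePreserving (T t) (hT t) (hf.toLp f) :=
    Continuous.compMeasurePreservingLp (f := fun _ => hf.toLp f) continuous_const T.continuous hT hp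
  have h1 := (tendsto_iff_edist_tendsto_0.1 (hc.tendsto a))
  refine h1.congr fun t => ?_
  rw [Lp.edist_def]
  refine eLpNorm_congr_ae ?_
  have h2 : ∀ t, Lp.compMeasurePreserving (T t) (hT t) (hf.toLp f) =ᵐ[volume]
      fun x => f (x - t) := fun t =>
    (Lp.coeFn_compMeasurePreserving _ (hT t)).trans
      ((hT t).quasiMeasurePreserving.ae_eq_comp hf.coeFn_toLp)
  filter_upwards [h2 t, h2 a] with x e1 e2
  simp only [Pi.sub_apply, e1, e2]

variable [NormedSpace ℝ F]

/-- A sequence of bump functions shrinking to the origin. -/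
def shrinkingBump (d n : ℕ) : ContDiffBump (0 : EuclideanSpace ℝ (Fin d)) where
  rIn := 1 / (2 * (n + 1))
  rOut := 1 / (n + 1)
  rIn_pos := by positivity
  rIn_lt_rOut := by
    apply one_div_lt_one_div_of_lt <;> linarith [(n.cast_nonneg : (0 : ℝ) ≤ n)]

/-- The corresponding approximate identity. -/
def mollifier (d n : ℕ) : EuclideanSpace ℝ (Fin d) → ℝ := (shrinkingBump d n).normed volume

theorem contDiff_mollifier (n : ℕ) : ContDiff ℝ ∞ (mollifier d n) :=
  (shrinkingBump d n).contDiff_normed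

theorem hasCompactSupport_mollifier (n : ℕ) : HasCompactSupport (mollifier d n) :=
  (shrinkingBump d n).hasCompactSupport_normed

theorem mollifier_nonneg (n : ℕ) (x : EuclideanSpace ℝ (Fin d)) : 0 ≤ mollifier d n x :=
  (shrinkingBump d n).nonneg_normed x

theorem mollifier_eq_zero (n : ℕ) {x : EuclideanSpace ℝ (Fin d)} (hx : 1 / ((n : ℝ) + 1) ≤ ‖x‖) :
    mollifier d n x = 0 := by
  rw [← Function.notMem_support, mollifier, ContDiffBump.support_normed_eq]
  simpa [shrinkingBump] using hx

theorem tendsto_shrinkingBump_rOut :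
    Tendsto (fun n => (shrinkingBump d n).rOut) atTop (𝓝 0) :=
  tendsto_one_div_add_atTop_nhds_zero_nat

theorem integrable_mollifier_smul {f : EuclideanSpace ℝ (Fin d) → F} (hf : LocallyIntegrable f)
    (n : ℕ) (x : EuclideanSpace ℝ (Fin d)) : Integrable fun t => mollifier d n t • f (x - t) :=
  (hasCompactSupport_mollifier n).convolutionExists_left (ContinuousLinearMap.lsmul ℝ ℝ)
    (contDiff_mollifier n).continuous hf x

theorem integrable_mollifier (n : ℕ) : Integrable (mollifier d n) :=
  ContDiffBump.integrable_normed _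

theorem integral_mollifier (n : ℕ) : ∫ t, mollifier d n t = 1 := ContDiffBump.integral_normed _

theorem lintegral_mollifier (n : ℕ) :
    ∫⁻ t : EuclideanSpace ℝ (Fin d), ENNReal.ofReal (mollifier d n t) = 1 := by
  rw [← ofReal_integral_eq_lintegral_ofReal (integrable_mollifier n)
    (Eventually.of_forall (mollifier_nonneg n)), integral_mollifier, ENNReal.ofReal_one]

variable [CompleteSpace F]

theorem ae_tendsto_mollify {f : EuclideanSpace ℝ (Fin d) → F} (hf : LocallyIntegrable f) :
    ∀ᵐ x, Tendsto (fun n => mollify (mollifier d n) f x) atTop (𝓝 (f x)) := by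
  -- The outer radius is twice the inner one for every `n`; this fixed ratio is what convergence at
  -- Lebesgue points requires.
  refine ContDiffBump.ae_convolution_tendsto_right_of_locallyIntegrable (K := 2)
    tendsto_shrinkingBump_rOut (Eventually.of_forall fun n => le_of_eq ?_) hf
  simp only [shrinkingBump]
  have : (n : ℝ) + 1 ≠ 0 := by positivity
  field_simp

theorem enorm_mollify_sub_le {f : EuclideanSpace ℝ (Fin d) → F} (hf : LocallyIntegrable f)
    (n : ℕ) (x : EuclideanSpace ℝ (Fin d)) :
    ‖mollify (mollifier d n) f x - f x‖ₑ ≤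
      ∫⁻ t, ENNReal.ofReal (mollifier d n t) * ‖f (x - t) - f x‖ₑ := by
  have h1 : ∫ t, mollifier d n t • f x = f x := by
    rw [integral_smul_const, integral_mollifier, one_smul]
  have h2 : mollify (mollifier d n) f x - f x = ∫ t, mollifier d n t • (f (x - t) - f x) := by
    simp only [smul_sub]
    rw [integral_sub (integrable_mollifier_smul hf n x)
      ((integrable_mollifier n).smul_const _), h1]
    rfl
  rw [h2]
  refine (enorm_integral_le_lintegral_enorm _).trans (lintegral_mono fun t => ?_)
  rw [enorm_smul, Real.enorm_of_nonneg (mollifier_nonneg n t)]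

/-- By Tonelli the error is at most the mollifier average of `‖f(· - t) - f‖₁` over small `t`, and
translation is continuous in `L¹`. -/
theorem tendsto_lintegral_mollify_sub {f : EuclideanSpace ℝ (Fin d) → F} (hf : Integrable f) :
    Tendsto (fun n => ∫⁻ x, ‖mollify (mollifier d n) f x - f x‖ₑ) atTop (𝓝 0) := by
  rw [ENNReal.tendsto_nhds_zero]
  intro ε hε
  have h1 := tendsto_eLpNorm_translate ENNReal.one_ne_top (memLp_one_iff_integrable.2 hf) 0
  rw [ENNReal.tendsto_nhds_zero] at h1
  obtain ⟨δ, hδ, h2⟩ := Metric.eventually_nhds_iff.1 (h1 ε hε)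
  filter_upwards [(tendsto_shrinkingBump_rOut (d := d)).eventually (gt_mem_nhds hδ)] with n hn
  have hm : AEMeasurable (Function.uncurry fun (x t : EuclideanSpace ℝ (Fin d)) =>
      ENNReal.ofReal (mollifier d n t) * ‖f (x - t) - f x‖ₑ) (volume.prod volume) := by
    refine AEMeasurable.mul (f := fun z : EuclideanSpace ℝ (Fin d) × EuclideanSpace ℝ (Fin d) =>
      ENNReal.ofReal (mollifier d n z.2)) (g := fun z => ‖f (z.1 - z.2) - f z.1‖ₑ) ?_ ?_
    · exact (((contDiff_mollifier n).continuous.comp continuous_snd).measurable.ennreal_ofReal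
        ).aemeasurable
    · refine (AEStronglyMeasurable.sub ?_ ?_).enorm
      · exact hf.aestronglyMeasurable.comp_quasiMeasurePreserving
          (quasiMeasurePreserving_sub volume volume)
      · exact hf.aestronglyMeasurable.comp_fst
  calc ∫⁻ x, ‖mollify (mollifier d n) f x - f x‖ₑ
      ≤ ∫⁻ x, ∫⁻ t, ENNReal.ofReal (mollifier d n t) * ‖f (x - t) - f x‖ₑ :=
        lintegral_mono fun x => enorm_mollify_sub_le hf.locallyIntegrable n x
    _ = ∫⁻ t, ∫⁻ x, ENNReal.ofReal (mollifier d n t) * ‖f (x - t) - f x‖ₑ :=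
        lintegral_lintegral_swap hm
    _ ≤ ∫⁻ t : EuclideanSpace ℝ (Fin d), ENNReal.ofReal (mollifier d n t) * ε := by
        refine lintegral_mono fun t => ?_
        rw [lintegral_const_mul' _ _ ENNReal.ofReal_ne_top]
        by_cases ht : ‖t‖ < δ
        · have h3 := h2 (y := t) (by simpa using ht)
          rw [eLpNorm_one_eq_lintegral_enorm] at h3
          simp only [sub_zero] at h3
          gcongr
        · have : mollifier d n t = 0 := mollifier_eq_zero n ((le_of_lt hn).trans (not_lt.1 ht))
          simp [this]
    _ = ε := by
        rw [lintegral_mul_const _ (contDiff_mollifier n).continuous.measurable.ennreal_ofReal,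
          lintegral_mollifier, one_mul]

/-- Mollifications converge in `L¹` on compact sets. -/
theorem tendsto_setLIntegral_mollify_sub {f : EuclideanSpace ℝ (Fin d) → F}
    (hf : LocallyIntegrable f) {K : Set (EuclideanSpace ℝ (Fin d))} (hK : IsCompact K) :
    Tendsto (fun n => ∫⁻ x in K, ‖mollify (mollifier d n) f x - f x‖ₑ) atTop (𝓝 0) := by
  -- All the mollifiers vanish outside the unit ball, so on `K` the mollification sees only the
  -- values of `f` within distance one, and `f` may be cut off to an integrable function.
  set K' := Metric.cthickening 1 K with hK'
  have hKc : IsCompact K' := hK.cthickening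
  have hi : Integrable (K'.indicator f) :=
    (integrable_indicator_iff hKc.measurableSet).2 (hf.integrableOn_isCompact hKc)
  refine tendsto_of_tendsto_of_tendsto_of_le_of_le tendsto_const_nhds
    (tendsto_lintegral_mollify_sub hi) (fun _ => bot_le) fun n => ?_
  refine le_trans (le_of_eq (setLIntegral_congr_fun hK.measurableSet fun x hx => ?_))
    (setLIntegral_le_lintegral _ _)
  have hin : ∀ y, ‖x - y‖ < 1 → y ∈ K' := fun y hy => by
    refine Metric.thickening_subset_cthickening _ _ (Metric.mem_thickening_iff.2 ⟨x, hx, ?_⟩)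
    rwa [dist_eq_norm, norm_sub_rev]
  have e1 : K'.indicator f x = f x := Set.indicator_of_mem (hin x (by simp)) f
  have e2 : mollify (mollifier d n) (K'.indicator f) x = mollify (mollifier d n) f x := by
    rw [mollify_apply, mollify_apply]
    refine integral_congr_ae (Eventually.of_forall fun y => ?_)
    by_cases hy : ‖x - y‖ < 1
    · simp only [Set.indicator_of_mem (hin y hy) f]
    · have : mollifier d n (x - y) = 0 := by
        refine mollifier_eq_zero n (le_trans ?_ (not_lt.1 hy))
        rw [div_le_one (by positivity)]
        linarith [(n.cast_nonneg : (0 : ℝ) ≤ n)]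
      simp only [this, zero_smul]
  simp only [e1, e2]

/-- If `|bₙ| ≤ |ρₙ * f - f|`, then `∫ η bₙ → 0` for every test function `η`. -/
theorem tendsto_integral_mul_of_norm_le {f : EuclideanSpace ℝ (Fin d) → F}
    (hf : LocallyIntegrable f) {η : EuclideanSpace ℝ (Fin d) → ℝ} (hη : Continuous η)
    (hc : HasCompactSupport η) {b : ℕ → EuclideanSpace ℝ (Fin d) → ℝ}
    (hb : ∀ n x, |b n x| ≤ ‖mollify (mollifier d n) f x - f x‖) :
    Tendsto (fun n => ∫ x, η x * b n x) atTop (𝓝 0) := by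
  obtain ⟨M, hM⟩ := hη.bounded_above_of_compact_support hc
  have h1 := (ENNReal.Tendsto.const_mul (a := ENNReal.ofReal M)
    (tendsto_setLIntegral_mollify_sub hf hc.isCompact) (Or.inr ENNReal.ofReal_ne_top))
  rw [mul_zero] at h1
  rw [tendsto_iff_edist_tendsto_0]
  refine tendsto_of_tendsto_of_tendsto_of_le_of_le tendsto_const_nhds h1 (fun _ => bot_le)
    fun n => ?_
  rw [edist_zero_right]
  refine (enorm_integral_le_lintegral_enorm _).trans ?_
  rw [← lintegral_const_mul' _ _ ENNReal.ofReal_ne_top, ← lintegral_indicator hc.isCompact.measurableSet]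
  refine lintegral_mono fun x => ?_
  by_cases hx : x ∈ tsupport η
  · rw [Set.indicator_of_mem hx, enorm_mul]
    gcongr
    · rw [← ofReal_norm]
      exact ENNReal.ofReal_le_ofReal (hM x)
    · rw [← ofReal_norm, ← ofReal_norm]
      exact ENNReal.ofReal_le_ofReal (hb n x)
  · simp [image_eq_zero_of_notMem_tsupport hx]

theorem abs_regNorm_sub_le {H : Type*} [NormedAddCommGroup H] {ε : ℝ} (z w : H) :
    |regNorm ε z - regNorm ε w| ≤ ‖z - w‖ := by
  have h : ∀ z w : H, regNorm ε z - regNorm ε w ≤ ‖z - w‖ := by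
    intro z w
    simp only [regNorm, sub_sub_sub_cancel_right, sub_le_iff_le_add]
    refine Real.sqrt_le_iff.2 ⟨by positivity, ?_⟩
    have h1 : ‖z‖ ≤ ‖z - w‖ + ‖w‖ := by simpa using norm_add_le (z - w) w
    have h2 := Real.sq_sqrt (show 0 ≤ ‖w‖ ^ 2 + ε ^ 2 by positivity)
    have h3 : ‖w‖ ≤ √(‖w‖ ^ 2 + ε ^ 2) := Real.le_sqrt_of_sq_le (by nlinarith [sq_nonneg ε])
    have h4 : ‖z‖ ^ 2 ≤ (‖z - w‖ + ‖w‖) ^ 2 := by gcongr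
    nlinarith [mul_le_mul_of_nonneg_left h3 (norm_nonneg (z - w))]
  exact abs_sub_le_iff.2 ⟨h z w, norm_sub_rev z w ▸ h w z⟩

/-- Unlike `|ψ|`, the regularised norm is quadratically small near zero, hence integrable for every
square integrable `ψ`. This is why Kato's inequality is used below with parameter one instead of
letting it tend to zero. -/
theorem regNorm_one_le {H : Type*} [NormedAddCommGroup H] (z : H) :
    regNorm 1 z ≤ ‖z‖ ^ 2 := by
  rw [regNorm, sub_le_iff_le_add]
  refine Real.sqrt_le_iff.2 ⟨by positivity, ?_⟩
  nlinarith [sq_nonneg ‖z‖, sq_nonneg (‖z‖ ^ 2)]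

section

variable {H : Type*} [NormedAddCommGroup H] [InnerProductSpace ℝ H]

/-- The normalised pairing `⟨z, w⟩ / √(|z|² + 1)`. -/
def signInner (z w : H) : ℝ := inner ℝ z w / √(‖z‖ ^ 2 + 1)

theorem abs_signInner_le (z w : H) : |signInner z w| ≤ ‖w‖ := by
  have h3 : ‖z‖ ≤ √(‖z‖ ^ 2 + 1) := Real.le_sqrt_of_sq_le (by linarith)
  rw [signInner, abs_div, abs_of_nonneg (Real.sqrt_nonneg _), div_le_iff₀ (by positivity)]
  refine (abs_real_inner_le_norm z w).trans ?_
  rw [mul_comm]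
  gcongr

theorem signInner_sub (z v w : H) : signInner z v - signInner z w = signInner z (v - w) := by
  simp only [signInner, inner_sub_right, sub_div]

theorem continuous_signInner : Continuous fun p : H × H => signInner p.1 p.2 := by
  unfold signInner
  refine Continuous.div (by fun_prop) (by fun_prop) fun p => ?_
  positivity

variable [CompleteSpace H]

/-- Kato's inequality in the sense of distributions, for the convex function `√(|ψ|² + 1) - 1`. -/
theorem integral_signInner_le {ψ g : EuclideanSpace ℝ (Fin d) → H} (hψ : LocallyIntegrable ψ)
    (hg : LocallyIntegrable g)
    (h : ∀ η : EuclideanSpace ℝ (Fin d) → ℝ, ContDiff ℝ ∞ η → HasCompactSupport η →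
      ∫ x, (Δ η) x • ψ x = ∫ x, η x • g x)
    {η : EuclideanSpace ℝ (Fin d) → ℝ} (hη : ContDiff ℝ ∞ η) (hc : HasCompactSupport η)
    (hpos : ∀ x, 0 ≤ η x) :
    ∫ x, η x * signInner (ψ x) (g x) ≤ ∫ x, (Δ η) x * regNorm 1 (ψ x) := by
  set ψn := fun n => mollify (mollifier d n) ψ with hψn
  set gn := fun n => mollify (mollifier d n) g with hgn
  have sψ : ∀ n, ContDiff ℝ ∞ (ψn n) := fun n =>
    contDiff_mollify (contDiff_mollifier n) (hasCompactSupport_mollifier n) hψ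
  have sg : ∀ n, ContDiff ℝ ∞ (gn n) := fun n =>
    contDiff_mollify (contDiff_mollifier n) (hasCompactSupport_mollifier n) hg
  -- The mollified functions satisfy `Δψₙ = gₙ` classically: divide the pointwise inequality by the
  -- square root, multiply by `η ≥ 0`, and move the Laplacian onto `η`.
  have hle : ∀ n, ∫ x, η x * signInner (ψn n x) (gn n x) ≤
      ∫ x, (Δ η) x * regNorm 1 (ψn n x) := by
    intro n
    have h1 := integral_bilinear_laplacian_comm hη (contDiff_regNorm one_pos (sψ n)) hc
      (ContinuousLinearMap.mul ℝ ℝ)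
    simp only [ContinuousLinearMap.mul_apply'] at h1
    rw [← h1]
    have cS : Continuous fun x => signInner (ψn n x) (gn n x) :=
      continuous_signInner.comp ((sψ n).continuous.prodMk (sg n).continuous)
    refine integral_mono
      (integrable_bilinear hη.continuous cS hc (ContinuousLinearMap.mul ℝ ℝ))
      (integrable_bilinear hη.continuous
        (contDiff_laplacian (contDiff_regNorm one_pos (sψ n))).continuous hc
        (ContinuousLinearMap.mul ℝ ℝ)) fun x => ?_
    refine mul_le_mul_of_nonneg_left ?_ (hpos x)
    have h2 := inner_laplacian_le one_pos (sψ n) x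
    have h3 : Δ (ψn n) = gn n := laplacian_mollify_eq (contDiff_mollifier n)
      (hasCompactSupport_mollifier n) hψ h
    rw [h3, one_pow] at h2
    rw [signInner, div_le_iff₀ (by positivity), mul_comm]
    exact h2
  have aeψ := ae_tendsto_mollify hψ
  have hl1 : Tendsto (fun n => ∫ x, η x * signInner (ψn n x) (g x)) atTop
      (𝓝 (∫ x, η x * signInner (ψ x) (g x))) := by
    refine tendsto_integral_of_dominated_convergence (fun x => ‖η x • g x‖) (fun n => ?_)
      (hg.integrable_smul_left_of_hasCompactSupport hη.continuous hc).norm (fun n => ?_) ?_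
    · exact hη.continuous.aestronglyMeasurable.mul (continuous_signInner.comp_aestronglyMeasurable
        ((sψ n).continuous.aestronglyMeasurable.prodMk hg.aestronglyMeasurable))
    · refine Eventually.of_forall fun x => ?_
      rw [norm_mul, norm_smul]
      gcongr
      exact abs_signInner_le _ _
    · filter_upwards [aeψ] with x hx
      refine Tendsto.const_mul _ ?_
      exact (continuous_signInner.tendsto _).comp (hx.prodMk_nhds tendsto_const_nhds)
  -- Only local `L¹` convergence of `gₙ` is available. The pairing is therefore split: dominated
  -- convergence moves its first argument, and the bound by `|gₙ - g|` moves the second.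
  have hl2 : Tendsto (fun n => ∫ x, η x * signInner (ψn n x) (gn n x - g x)) atTop (𝓝 0) :=
    tendsto_integral_mul_of_norm_le hg hη.continuous hc fun n x => abs_signInner_le _ _
  have hl : Tendsto (fun n => ∫ x, η x * signInner (ψn n x) (gn n x)) atTop
      (𝓝 (∫ x, η x * signInner (ψ x) (g x))) := by
    have := hl1.add hl2
    rw [add_zero] at this
    refine this.congr fun n => ?_
    have cS : Continuous fun x => signInner (ψn n x) (gn n x) :=
      continuous_signInner.comp ((sψ n).continuous.prodMk (sg n).continuous)
    have i1 : Integrable fun x => η x * signInner (ψn n x) (g x) := by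
      refine (hg.integrable_smul_left_of_hasCompactSupport hη.continuous hc).mono ?_ ?_
      · exact hη.continuous.aestronglyMeasurable.mul (continuous_signInner.comp_aestronglyMeasurable
          ((sψ n).continuous.aestronglyMeasurable.prodMk hg.aestronglyMeasurable))
      · refine Eventually.of_forall fun x => ?_
        rw [norm_mul, norm_smul]
        gcongr
        exact abs_signInner_le _ _
    have i2 : Integrable fun x => η x * signInner (ψn n x) (gn n x) :=
      integrable_bilinear hη.continuous cS hc (ContinuousLinearMap.mul ℝ ℝ)
    simp only [← signInner_sub, mul_sub]
    rw [integral_sub i2 i1]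
    ring
  have hΔ := contDiff_laplacian hη
  have hΔc := hasCompactSupport_laplacian hη hc
  have hr : Tendsto (fun n => ∫ x, (Δ η) x * regNorm 1 (ψn n x)) atTop
      (𝓝 (∫ x, (Δ η) x * regNorm 1 (ψ x))) := by
    have := tendsto_integral_mul_of_norm_le hψ hΔ.continuous hΔc
      (b := fun n x => regNorm 1 (ψn n x) - regNorm 1 (ψ x)) fun n x => abs_regNorm_sub_le _ _
    have i1 : Integrable fun x => (Δ η) x * regNorm 1 (ψ x) := by
      refine (hψ.integrable_smul_left_of_hasCompactSupport hΔ.continuous hΔc).mono ?_ ?_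
      · refine hΔ.continuous.aestronglyMeasurable.mul (Continuous.comp_aestronglyMeasurable
          (g := regNorm 1) ?_ hψ.aestronglyMeasurable)
        unfold regNorm
        fun_prop
      · refine Eventually.of_forall fun x => ?_
        rw [norm_mul, norm_smul]
        gcongr
        rw [Real.norm_of_nonneg (regNorm_nonneg _)]
        exact regNorm_le one_pos _
    have i2 : ∀ n, Integrable fun x => (Δ η) x * regNorm 1 (ψn n x) := fun n =>
      integrable_bilinear hΔ.continuous (contDiff_regNorm one_pos (sψ n)).continuous hΔc
        (ContinuousLinearMap.mul ℝ ℝ)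
    rw [← tendsto_sub_nhds_zero_iff]
    refine this.congr fun n => ?_
    simp only [mul_sub]
    rw [integral_sub (i2 n) i1]
  exact le_of_tendsto_of_tendsto' hl hr hle

/-- A square integrable weak solution of `Δψ = g` with `⟨ψ, g⟩ ≥ μ|ψ|²`, `μ > 0`, vanishes. -/
theorem ae_eq_zero_of_laplacian_eq {ψ g : EuclideanSpace ℝ (Fin d) → H} (hψ : MemLp ψ 2)
    (hg : LocallyIntegrable g)
    (h : ∀ η : EuclideanSpace ℝ (Fin d) → ℝ, ContDiff ℝ ∞ η → HasCompactSupport η →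
      ∫ x, (Δ η) x • ψ x = ∫ x, η x • g x)
    {μ : ℝ} (hμ : 0 < μ) (hpos : ∀ᵐ x, μ * ‖ψ x‖ ^ 2 ≤ inner ℝ (ψ x) (g x)) :
    ψ =ᵐ[volume] 0 := by
  have hψl : LocallyIntegrable ψ := hψ.locallyIntegrable (by norm_num)
  let χ : ContDiffBump (0 : EuclideanSpace ℝ (Fin d)) := ⟨1, 2, one_pos, one_lt_two⟩
  have hχ : ContDiff ℝ ∞ χ := χ.contDiff
  set c : ℕ → ℝ := fun n => 1 / ((n : ℝ) + 1) with hc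
  have hcpos : ∀ n, 0 < c n := fun n => by positivity
  have hc0 : Tendsto c atTop (𝓝 0) := tendsto_one_div_add_atTop_nhds_zero_nat
  set η : ℕ → EuclideanSpace ℝ (Fin d) → ℝ := fun n x => χ (0 + c n • x) with hη
  have sη : ∀ n, ContDiff ℝ ∞ (η n) := fun n => by fun_prop
  have cη : ∀ n, HasCompactSupport (η n) := fun n => by
    have := χ.hasCompactSupport.comp_smul (hcpos n).ne'
    simpa [hη] using this
  obtain ⟨M, hM⟩ := (contDiff_laplacian hχ).continuous.bounded_above_of_compact_support
    (hasCompactSupport_laplacian hχ χ.hasCompactSupport)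
  have hi : Integrable fun x => ‖ψ x‖ ^ 2 := hψ.integrable_norm_pow (by norm_num)
  set f : EuclideanSpace ℝ (Fin d) → ℝ := fun x => μ * ‖ψ x‖ ^ 2 / √(‖ψ x‖ ^ 2 + 1) with hf
  have f0 : ∀ x, 0 ≤ f x := fun x => by positivity
  have fm : AEStronglyMeasurable f := by
    have h1 := hψ.aestronglyMeasurable.norm
    refine Continuous.comp_aestronglyMeasurable (g := fun r : ℝ => μ * r ^ 2 / √(r ^ 2 + 1)) ?_ h1
    refine Continuous.div (by fun_prop) (by fun_prop) fun r => ?_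
    positivity
  have fle : ∀ x, f x ≤ μ * ‖ψ x‖ ^ 2 := fun x => by
    refine div_le_self (by positivity) ?_
    exact Real.one_le_sqrt.2 (by nlinarith [sq_nonneg ‖ψ x‖])
  have fi : Integrable f := (hi.const_mul μ).mono' fm (Eventually.of_forall fun x => by
    rw [Real.norm_of_nonneg (f0 x)]; exact fle x)
  -- The cutoffs are `χ(cₙ x)` with `cₙ → 0`. Scaling puts a factor `cₙ²` on their Laplacians, so
  -- the right side of Kato's inequality vanishes in the limit while the left side tends to `∫ f`.
  have hbound : ∀ n, ∫ x, η n x * f x ≤ c n ^ 2 * (M * ∫ x, ‖ψ x‖ ^ 2) := by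
    intro n
    have h1 := integral_signInner_le hψl hg h (sη n) (cη n) fun x => χ.nonneg
    have h2 : ∫ x, η n x * f x ≤ ∫ x, η n x * signInner (ψ x) (g x) := by
      refine integral_mono_ae ?_ ?_ ?_
      · exact fi.locallyIntegrable.integrable_smul_left_of_hasCompactSupport (sη n).continuous (cη n)
      · refine (hg.integrable_smul_left_of_hasCompactSupport (sη n).continuous (cη n)).mono ?_ ?_
        · exact (sη n).continuous.aestronglyMeasurable.mul
            (continuous_signInner.comp_aestronglyMeasurable
              (hψ.aestronglyMeasurable.prodMk hg.aestronglyMeasurable))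
        · refine Eventually.of_forall fun x => ?_
          rw [norm_mul, norm_smul]
          gcongr
          exact abs_signInner_le _ _
      · filter_upwards [hpos] with x hx
        refine mul_le_mul_of_nonneg_left ?_ χ.nonneg
        simp only [hf, signInner]
        gcongr
    refine h2.trans (h1.trans ?_)
    rw [← integral_const_mul, ← integral_const_mul]
    refine (Real.le_norm_self _).trans (norm_integral_le_of_norm_le
      ((hi.const_mul M).const_mul (c n ^ 2)) (Eventually.of_forall fun x => ?_))
    have e : (Δ (η n)) x = c n ^ 2 • (Δ (χ : EuclideanSpace ℝ (Fin d) → ℝ)) (0 + c n • x) :=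
      congrFun (laplacian_comp_smul hχ (c n) 0) x
    rw [e, norm_mul, norm_smul, Real.norm_of_nonneg (regNorm_nonneg _),
      Real.norm_of_nonneg (sq_nonneg (c n)), mul_assoc]
    have hM0 : 0 ≤ M := (norm_nonneg _).trans (hM 0)
    gcongr
    · exact regNorm_nonneg _
    · exact hM _
    · exact regNorm_one_le _
  have hlim : Tendsto (fun n => ∫ x, η n x * f x) atTop (𝓝 (∫ x, f x)) := by
    refine tendsto_integral_of_dominated_convergence f (fun n => ?_) fi (fun n => ?_) ?_
    · exact (sη n).continuous.aestronglyMeasurable.mul fm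
    · refine Eventually.of_forall fun x => ?_
      rw [norm_mul, Real.norm_of_nonneg (f0 x), Real.norm_of_nonneg χ.nonneg]
      exact mul_le_of_le_one_left (f0 x) χ.le_one
    · refine Eventually.of_forall fun x => ?_
      refine tendsto_const_nhds.congr' ?_
      have h1 : Tendsto (fun n => ‖c n • x‖) atTop (𝓝 0) := by
        have := (hc0.smul_const x).norm
        simpa using this
      filter_upwards [h1.eventually (gt_mem_nhds one_pos)] with n hn
      have : η n x = 1 := χ.one_of_mem_closedBall (by simpa using hn.le)
      rw [this, one_mul]
  have hz : ∫ x, f x ≤ 0 := by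
    have h2 : Tendsto (fun n => c n ^ 2 * (M * ∫ x, ‖ψ x‖ ^ 2)) atTop (𝓝 0) := by
      have := (hc0.pow 2).mul_const (M * ∫ x, ‖ψ x‖ ^ 2)
      simpa using this
    exact le_of_tendsto_of_tendsto' hlim h2 hbound
  have hz' : ∫ x, f x = 0 := le_antisymm hz (integral_nonneg f0)
  rw [integral_eq_zero_iff_of_nonneg f0 fi] at hz'
  filter_upwards [hz'] with x hx
  have h3 : √(‖ψ x‖ ^ 2 + 1) ≠ 0 := by positivity
  simp only [hf, Pi.zero_apply, div_eq_zero_iff, h3, or_false, mul_eq_zero, hμ.ne', false_or,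
    pow_eq_zero_iff two_ne_zero, norm_eq_zero] at hx
  exact hx

end

end Kato

theorem integral_mul_le_sqrt_mul_sqrt {α : Type*} {m : MeasurableSpace α} {ν : Measure α}
    {f g : α → ℝ} (hf : MemLp f 2 ν) (hg : MemLp g 2 ν) :
    ∫ x, f x * g x ∂ν ≤ √(∫ x, f x ^ 2 ∂ν) * √(∫ x, g x ^ 2 ∂ν) := by
  have h1 : ∫ x, f x * g x ∂ν ≤ ∫ x, ‖f x‖ * ‖g x‖ ∂ν := by
    refine integral_mono (hf.integrable_mul hg) (hf.norm.integrable_mul hg.norm) fun x => ?_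
    rw [← norm_mul]
    exact Real.le_norm_self _
  have h2 := integral_mul_le_Lp_mul_Lq_of_nonneg (μ := ν) Real.HolderConjugate.two_two
    (f := fun x => ‖f x‖) (g := fun x => ‖g x‖)
    (Eventually.of_forall fun x => norm_nonneg _) (Eventually.of_forall fun x => norm_nonneg _)
    (by simpa using hf.norm) (by simpa using hg.norm)
  refine h1.trans (h2.trans (le_of_eq ?_))
  simp [Real.sqrt_eq_rpow]

/-! ### A sup bound for test functions in dimension at most three, by Gaussian means -/

section SupBound

variable {d : ℕ}

/-- The Gaussian `exp(-|z|²/2)`. -/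
def gauss (z : EuclideanSpace ℝ (Fin d)) : ℝ := Real.exp (-(1 / 2) * ‖z‖ ^ 2)

theorem gauss_pos (z : EuclideanSpace ℝ (Fin d)) : 0 < gauss z := Real.exp_pos _

theorem contDiff_gauss : ContDiff ℝ ∞ (gauss (d := d)) :=
  (contDiff_const.mul (contDiff_id.norm_sq ℝ)).exp

theorem integrable_exp_neg_norm_sq {b : ℝ} (hb : 0 < b) :
    Integrable fun z : EuclideanSpace ℝ (Fin d) => Real.exp (-b * ‖z‖ ^ 2) := by
  have h := (GaussianFourier.integrable_cexp_neg_mul_sq_norm_add (b := (b : ℂ)) (by simpa) 0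
    (0 : EuclideanSpace ℝ (Fin d))).norm
  refine h.congr (Eventually.of_forall fun z => ?_)
  simp only [Complex.norm_exp, zero_mul, add_zero]
  congr 1
  norm_cast

theorem integrable_gauss : Integrable (gauss (d := d)) :=
  integrable_exp_neg_norm_sq (by norm_num)

theorem memLp_gauss : MemLp (gauss (d := d)) 2 := by
  rw [memLp_two_iff_integrable_sq contDiff_gauss.continuous.aestronglyMeasurable]
  refine (integrable_exp_neg_norm_sq one_pos).congr (Eventually.of_forall fun z => ?_)
  simp only [gauss, ← Real.exp_nat_mul]
  congr 1
  push_cast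
  ring

theorem integrable_gauss_mul_norm :
    Integrable fun z : EuclideanSpace ℝ (Fin d) => gauss z * ‖z‖ := by
  refine ((integrable_exp_neg_norm_sq (d := d) (b := 1 / 4) (by norm_num)).const_mul 2).mono'
    (contDiff_gauss.continuous.mul continuous_norm).aestronglyMeasurable
    (Eventually.of_forall fun z => ?_)
  rw [Real.norm_of_nonneg (mul_nonneg (gauss_pos z).le (norm_nonneg z))]
  -- Half of the Gaussian decay is spent on absorbing the factor `‖z‖`.
  have h1 : ‖z‖ ≤ 2 * Real.exp (1 / 4 * ‖z‖ ^ 2) := by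
    have := Real.add_one_le_exp (1 / 4 * ‖z‖ ^ 2)
    nlinarith [sq_nonneg (‖z‖ - 2)]
  calc gauss z * ‖z‖ ≤ gauss z * (2 * Real.exp (1 / 4 * ‖z‖ ^ 2)) :=
        mul_le_mul_of_nonneg_left h1 (gauss_pos z).le
    _ = 2 * Real.exp (-(1 / 4) * ‖z‖ ^ 2) := by
        rw [gauss, mul_left_comm, ← Real.exp_add]
        congr 2
        ring

theorem integral_gauss_pos : 0 < ∫ z : EuclideanSpace ℝ (Fin d), gauss z := by
  refine (integral_pos_iff_support_of_nonneg (fun z => (gauss_pos z).le) integrable_gauss).2 ?_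
  have : Function.support (gauss (d := d)) = Set.univ := by
    ext z; simp [(gauss_pos z).ne']
  rw [this]
  exact Measure.measure_univ_pos.2 (NeZero.ne _)

theorem partialDeriv_gauss (i : Fin d) (z : EuclideanSpace ℝ (Fin d)) :
    partialDeriv i gauss z = -(z i * gauss z) := by
  have h1 : HasFDerivAt (fun z : EuclideanSpace ℝ (Fin d) => ‖z‖ ^ 2) _ z :=
    (hasStrictFDerivAt_norm_sq z).hasFDerivAt
  have h2 := (h1.const_mul (-(1 / 2) : ℝ)).exp
  rw [partialDeriv, show gauss = fun z : EuclideanSpace ℝ (Fin d) =>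
    Real.exp (-(1 / 2) * ‖z‖ ^ 2) from rfl, h2.fderiv]
  simp [EuclideanSpace.inner_single_right]
  ring

theorem fderiv_apply_eq_sum (u : EuclideanSpace ℝ (Fin d) → ℝ) (y z : EuclideanSpace ℝ (Fin d)) :
    fderiv ℝ u y z = ∑ i, z i * partialDeriv i u y := by
  conv_lhs => rw [← (EuclideanSpace.basisFun (Fin d) ℝ).sum_repr z]
  simp [partialDeriv]

/-- The Gaussian mean of `u` around `x` at scale `s`. -/
def gaussMean (u : EuclideanSpace ℝ (Fin d) → ℝ) (x : EuclideanSpace ℝ (Fin d)) (s : ℝ) : ℝ :=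
  ∫ z, gauss z * u (x + s • z)

theorem gaussMean_zero (u : EuclideanSpace ℝ (Fin d) → ℝ) (x : EuclideanSpace ℝ (Fin d)) :
    gaussMean u x 0 = (∫ z : EuclideanSpace ℝ (Fin d), gauss z) * u x := by
  simp [gaussMean, integral_mul_const]

theorem hasCompactSupport_comp_affine {u : EuclideanSpace ℝ (Fin d) → ℝ}
    (hc : HasCompactSupport u) (x : EuclideanSpace ℝ (Fin d)) {s : ℝ} (hs : 0 < s) :
    HasCompactSupport fun z => u (x + s • z) :=
  (hc.comp_homeomorph (Homeomorph.addLeft x)).comp_smul hs.ne'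

/-- Cauchy–Schwarz; the factor `s^(-d/2)` is the square root of the Jacobian of `z ↦ x + sz`. -/
theorem gaussMean_le {u : EuclideanSpace ℝ (Fin d) → ℝ} (hu : Continuous u)
    (hc : HasCompactSupport u) (x : EuclideanSpace ℝ (Fin d)) {s : ℝ} (hs : 0 < s) :
    gaussMean u x s ≤ √(∫ z : EuclideanSpace ℝ (Fin d), gauss z ^ 2) *
      (s ^ (-(d : ℝ) / 2) * √(∫ y, u y ^ 2)) := by
  have h1 : Continuous fun z => u (x + s • z) := by fun_prop
  have h2 := hasCompactSupport_comp_affine hc x hs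
  refine (integral_mul_le_sqrt_mul_sqrt memLp_gauss (h1.memLp_of_hasCompactSupport h2)).trans ?_
  refine le_of_eq ?_
  congr 1
  have h3 : ∫ z, u (x + s • z) ^ 2 = (s ^ d)⁻¹ * ∫ y, u y ^ 2 := by
    have := Measure.integral_comp_smul_of_nonneg volume (fun y => u (x + y) ^ 2) s (hR := hs.le)
    rw [this, finrank_euclideanSpace_fin, smul_eq_mul]
    congr 1
    exact integral_add_left_eq_self (fun y => u y ^ 2) x
  rw [h3, Real.sqrt_mul (by positivity)]
  congr 1
  rw [Real.sqrt_eq_rpow, ← Real.rpow_natCast, ← Real.rpow_neg hs.le, ← Real.rpow_mul hs.le]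
  congr 1
  ring

/-- Differentiating under the integral gives `∑ zᵢ ∂ᵢu(x + sz)` against the Gaussian. As `zᵢ gauss =
-∂ᵢ gauss`, integration by parts moves one more derivative onto `u` and produces the factor `s`. In
effect this is the heat equation with time `s²/2`. -/
theorem hasDerivAt_gaussMean {u : EuclideanSpace ℝ (Fin d) → ℝ} (hu : ContDiff ℝ ∞ u)
    (hc : HasCompactSupport u) (x : EuclideanSpace ℝ (Fin d)) {s : ℝ} (hs : 0 < s) :
    HasDerivAt (gaussMean u x) (s * gaussMean (Δ u) x s) s := by
  have hdu : Continuous (fderiv ℝ u) := (hu.fderiv_right (m := ∞) (by norm_cast)).continuous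
  obtain ⟨M, hM⟩ := hdu.bounded_above_of_compact_support (hc.fderiv (𝕜 := ℝ))
  have hg := contDiff_gauss (d := d).continuous
  have hcs := fun {v : EuclideanSpace ℝ (Fin d) → ℝ} (hv : HasCompactSupport v) =>
    hasCompactSupport_comp_affine hv x hs
  have key := hasDerivAt_integral_of_dominated_loc_of_deriv_le (μ := volume)
    (F := fun s z => gauss z * u (x + s • z))
    (F' := fun s z => gauss z * fderiv ℝ u (x + s • z) z) (x₀ := s) (s := Set.univ)
    (bound := fun z => M * (gauss z * ‖z‖)) univ_mem
    (Eventually.of_forall fun t => by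
      have := hu.continuous
      exact Continuous.aestronglyMeasurable (by fun_prop))
    (by
      have := integrable_bilinear (hu.continuous.comp (by fun_prop)) hg (hcs hc)
        (ContinuousLinearMap.mul ℝ ℝ)
      simpa [mul_comm] using this)
    (Continuous.aestronglyMeasurable (by fun_prop))
    (Eventually.of_forall fun z t _ => by
      rw [norm_mul, Real.norm_of_nonneg (gauss_pos z).le]
      have h1 := ((fderiv ℝ u (x + t • z)).le_opNorm z).trans
        (mul_le_mul_of_nonneg_right (hM _) (norm_nonneg z))
      nlinarith [gauss_pos z])
    (integrable_gauss_mul_norm.const_mul M)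
    (Eventually.of_forall fun z t _ => by
      have h1 : HasDerivAt (fun t : ℝ => x + t • z) z t := by
        simpa using ((hasDerivAt_id t).smul_const z).const_add x
      have h2 := ((hu.differentiable (by norm_num) (x + t • z)).hasFDerivAt.comp_hasDerivAt t h1)
      exact h2.const_mul (gauss z))
  refine key.2.congr_deriv ?_
  simp only [fderiv_apply_eq_sum, Finset.mul_sum, gaussMean]
  have hp : ∀ i, ContDiff ℝ ∞ fun z => partialDeriv i u (x + s • z) := fun i => by
    have := contDiff_partialDeriv hu i
    fun_prop
  have hp' : ∀ i, HasCompactSupport fun z => partialDeriv i u (x + s • z) := fun i =>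
    hcs (hasCompactSupport_partialDeriv hc i)
  have hpp : ∀ i, Continuous fun z => partialDeriv i (partialDeriv i u) (x + s • z) := fun i => by
    have := (contDiff_partialDeriv (contDiff_partialDeriv hu i) i).continuous
    fun_prop
  have hpp' : ∀ i, HasCompactSupport fun z => partialDeriv i (partialDeriv i u) (x + s • z) :=
    fun i => hcs (hasCompactSupport_partialDeriv (hasCompactSupport_partialDeriv hc i) i)
  rw [laplacian_eq_sum_partialDeriv hu]
  simp only [Finset.mul_sum]
  rw [integral_finsetSum, integral_finsetSum, Finset.mul_sum]
  · refine Finset.sum_congr rfl fun i _ => ?_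
    have h1 := integral_bilinear_partialDeriv (hp i) contDiff_gauss (hp' i)
      (ContinuousLinearMap.mul ℝ ℝ) i
    simp only [ContinuousLinearMap.mul_apply', partialDeriv_gauss,
      partialDeriv_comp_smul (contDiff_partialDeriv hu i), smul_eq_mul, mul_neg, integral_neg,
      neg_inj] at h1
    rw [← integral_const_mul]
    refine Eq.trans (integral_congr_ae (Eventually.of_forall fun z => ?_))
      (h1.trans (integral_congr_ae (Eventually.of_forall fun z => ?_)))
    · ring
    · ring
  · intro i _
    have := integrable_bilinear (hpp i) hg (hpp' i) (ContinuousLinearMap.mul ℝ ℝ)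
    simpa [mul_comm] using this
  · intro i _
    have := integrable_bilinear (hp i).continuous
      (show Continuous fun z : EuclideanSpace ℝ (Fin d) => z i * gauss z by fun_prop) (hp' i)
      (ContinuousLinearMap.mul ℝ ℝ)
    refine this.congr (Eventually.of_forall fun z => ?_)
    simp only [ContinuousLinearMap.mul_apply']
    ring

theorem continuous_gaussMean {u : EuclideanSpace ℝ (Fin d) → ℝ} (hu : Continuous u)
    (hc : HasCompactSupport u) (x : EuclideanSpace ℝ (Fin d)) : Continuous (gaussMean u x) := by
  obtain ⟨M, hM⟩ := hu.bounded_above_of_compact_support hc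
  have hg := contDiff_gauss (d := d).continuous
  refine continuous_of_dominated (bound := fun z => gauss z * M) (fun s => ?_) (fun s => ?_)
    (integrable_gauss.mul_const M) ?_
  · exact Continuous.aestronglyMeasurable (by fun_prop)
  · refine Eventually.of_forall fun z => ?_
    rw [norm_mul, Real.norm_of_nonneg (gauss_pos z).le]
    exact mul_le_mul_of_nonneg_left (hM _) (gauss_pos z).le
  · exact Eventually.of_forall fun z => by fun_prop

/-- In dimension at most three a test function is bounded by the `L²` norms of `(-Δu)₊` and of `u`,
with an arbitrarily small constant in front of the former. -/
theorem exists_forall_le_laplacian (hd : d ≤ 3) {ε : ℝ} (hε : 0 < ε) :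
    ∃ C : ℝ, 0 ≤ C ∧ ∀ u : EuclideanSpace ℝ (Fin d) → ℝ, ContDiff ℝ ∞ u → HasCompactSupport u →
      ∀ x, u x ≤ ε * √(∫ y, max (-(Δ u) y) 0 ^ 2) + C * √(∫ y, u y ^ 2) := by
  set I := ∫ z : EuclideanSpace ℝ (Fin d), gauss z with hI
  set P := √(∫ z : EuclideanSpace ℝ (Fin d), gauss z ^ 2) with hP
  have hIpos : 0 < I := integral_gauss_pos
  have hP0 : 0 ≤ P := Real.sqrt_nonneg _
  -- The derivative of the mean is at least `-P N s^(1 - d/2)`, which is integrable at zero exactly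
  -- when this exponent `a` is positive, that is, `d ≤ 3`.
  set a : ℝ := 2 - (d : ℝ) / 2 with ha
  have hapos : 0 < a := by
    have : (d : ℝ) ≤ 3 := by exact_mod_cast hd
    rw [ha]; linarith
  have hlim : Tendsto (fun S : ℝ => P * (S ^ a / a) / I) (𝓝[>] 0) (𝓝 0) := by
    have h1 : ContinuousAt (fun S : ℝ => P * (S ^ a / a) / I) 0 := by
      have := Real.continuousAt_rpow_const 0 a (Or.inr hapos.le)
      fun_prop
    have h2 := h1.tendsto.mono_left (nhdsWithin_le_nhds (s := Set.Ioi 0))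
    simpa [Real.zero_rpow hapos.ne'] using h2
  -- The scale `S` is taken so small that the contribution of the Laplacian carries a factor below
  -- `ε`; the price is a large constant, of order `S^(-d/2)`, in front of the `L²` norm of `u`.
  obtain ⟨S, hSε, hS⟩ := ((hlim.eventually (gt_mem_nhds hε)).and self_mem_nhdsWithin).exists
  have hS : 0 < S := hS
  refine ⟨P * S ^ (-(d : ℝ) / 2) / I, by positivity, fun u hu hc x => ?_⟩
  set v : EuclideanSpace ℝ (Fin d) → ℝ := fun y => max (-(Δ u) y) 0 with hv
  set N := √(∫ y, v y ^ 2) with hN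
  have hN0 : 0 ≤ N := Real.sqrt_nonneg _
  have hΔ := (contDiff_laplacian hu).continuous
  have hvc : Continuous v := hΔ.neg.max continuous_const
  have hvs : HasCompactSupport v :=
    (hasCompactSupport_laplacian hu hc).comp_left (g := fun r : ℝ => max (-r) 0) (by simp)
  have hder : ∀ s, 0 < s → 0 ≤ s * gaussMean (Δ u) x s + P * N * s ^ (a - 1) := by
    intro s hs
    have h1 := gaussMean_le hvc hvs x hs
    have hg := contDiff_gauss (d := d).continuous
    have h2 : -gaussMean (Δ u) x s ≤ gaussMean v x s := by
      rw [gaussMean, gaussMean, ← integral_neg]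
      have i1 := integrable_bilinear (hΔ.comp (by fun_prop)) hg
        (hasCompactSupport_comp_affine (hasCompactSupport_laplacian hu hc) x hs)
        (ContinuousLinearMap.mul ℝ ℝ)
      have i2 := integrable_bilinear (hvc.comp (by fun_prop)) hg
        (hasCompactSupport_comp_affine hvs x hs) (ContinuousLinearMap.mul ℝ ℝ)
      refine integral_mono (i1.neg.congr (Eventually.of_forall fun z => ?_))
        (i2.congr (Eventually.of_forall fun z => ?_)) fun z => ?_
      · simp [mul_comm]
      · simp [mul_comm]
      · have : -(Δ u) (x + s • z) ≤ v (x + s • z) := le_max_left _ _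
        have h3 := mul_le_mul_of_nonneg_left this (gauss_pos z).le
        simp only
        linarith
    have h3 : s ^ (a - 1) = s * s ^ (-(d : ℝ) / 2) := by
      nth_rewrite 2 [← Real.rpow_one s]
      rw [← Real.rpow_add hs]
      congr 1
      rw [ha]
      ring
    rw [h3]
    have h4 := mul_le_mul_of_nonneg_left (h2.trans h1) hs.le
    rw [← hP, ← hN] at h4
    linarith
  -- Comparing the two ends of `[0, S]` bounds `I u(x)`, the mean at scale zero, by the mean at
  -- scale `S` plus `P N S^a / a`.
  have hmono : MonotoneOn (fun s => gaussMean u x s + P * N * (s ^ a / a)) (Set.Icc 0 S) := by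
    have hd1 : ∀ s, 0 < s → HasDerivAt (fun s => gaussMean u x s + P * N * (s ^ a / a))
        (s * gaussMean (Δ u) x s + P * N * s ^ (a - 1)) s := by
      intro s hs
      have h1 := ((Real.hasDerivAt_rpow_const (p := a) (Or.inl hs.ne')).div_const a).const_mul
        (P * N)
      rw [mul_div_cancel_left₀ _ hapos.ne'] at h1
      exact (hasDerivAt_gaussMean hu hc x hs).add h1
    refine monotoneOn_of_deriv_nonneg (convex_Icc 0 S) ?_ ?_ ?_
    · refine Continuous.continuousOn ?_
      have h1 := continuous_gaussMean hu.continuous hc x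
      have h2 := Real.continuous_rpow_const hapos.le
      fun_prop
    · rw [interior_Icc]
      exact fun s hs => (hd1 s hs.1).differentiableAt.differentiableWithinAt
    · rw [interior_Icc]
      intro s hs
      rw [(hd1 s hs.1).deriv]
      exact hder s hs.1
  have h1 := hmono (Set.left_mem_Icc.2 hS.le) (Set.right_mem_Icc.2 hS.le) hS.le
  simp only [gaussMean_zero, Real.zero_rpow hapos.ne', zero_div, mul_zero, add_zero] at h1
  have h2 := gaussMean_le hu.continuous hc x hS
  rw [← hI] at h1
  rw [← hP] at h2
  have h3 : u x ≤ (P * (S ^ (-(d : ℝ) / 2) * √(∫ y, u y ^ 2)) + P * N * (S ^ a / a)) / I := by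
    rw [le_div_iff₀ hIpos, mul_comm]
    linarith
  refine h3.trans ?_
  have h4 : P * (S ^ a / a) / I * N ≤ ε * N := mul_le_mul_of_nonneg_right hSε.le hN0
  calc _ = P * (S ^ a / a) / I * N + P * S ^ (-(d : ℝ) / 2) / I * √(∫ y, u y ^ 2) := by ring
    _ ≤ _ := by gcongr

end SupBound

/-! ### Norms and inner products in `L²` as integrals -/

section L2

variable {α : Type*} {m : MeasurableSpace α} {ν : Measure α} {E : Type*} [NormedAddCommGroup E]
  [InnerProductSpace ℂ E]

theorem norm_sq_eq_integral (f : Lp E 2 ν) : ‖f‖ ^ 2 = ∫ x, ‖f x‖ ^ 2 ∂ν := by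
  have h := L2.inner_def (𝕜 := ℂ) f f
  rw [inner_self_eq_norm_sq_to_K] at h
  simp only [inner_self_eq_norm_sq_to_K] at h
  have e : (∫ x, ((‖f x‖ : ℂ)) ^ 2 ∂ν) = ((∫ x, ‖f x‖ ^ 2 ∂ν : ℝ) : ℂ) := by
    rw [← integral_complex_ofReal]
    simp
  simp only [Complex.coe_algebraMap] at h
  rw [e] at h
  exact_mod_cast h

theorem norm_eq_sqrt_integral (f : Lp E 2 ν) : ‖f‖ = √(∫ x, ‖f x‖ ^ 2 ∂ν) := by
  rw [← norm_sq_eq_integral, Real.sqrt_sq (norm_nonneg _)]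

theorem inner_eq_integral_of_ae {f g : Lp ℂ 2 ν} {a b : α → ℂ}
    (hf : f =ᵐ[ν] a) (hg : g =ᵐ[ν] b) :
    (inner ℂ f g : ℂ) = ∫ q, conj (a q) * b q ∂ν := by
  rw [L2.inner_def]
  refine integral_congr_ae ?_
  filter_upwards [hf, hg] with q e1 e2
  rw [e1, e2, RCLike.inner_apply, mul_comm]

end L2

/-! ### The Schrödinger operator of the particle -/

section Particle

variable {d : ℕ}

/-- A function that is square integrable on compact sets. -/
def LocallyL2 (U : EuclideanSpace ℝ (Fin d) → ℝ) : Prop :=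
  ∀ K : Set (EuclideanSpace ℝ (Fin d)), IsCompact K → MemLp U 2 (volume.restrict K)

/-- Complex test functions. -/
structure IsTest (η : EuclideanSpace ℝ (Fin d) → ℂ) : Prop where
  smooth : ContDiff ℝ ∞ η
  compact : HasCompactSupport η

theorem IsTest.zero : IsTest (0 : EuclideanSpace ℝ (Fin d) → ℂ) :=
  ⟨contDiff_const, HasCompactSupport.zero⟩

theorem IsTest.add {η ζ : EuclideanSpace ℝ (Fin d) → ℂ} (h : IsTest η) (h' : IsTest ζ) :
    IsTest (η + ζ) :=
  ⟨h.smooth.add h'.smooth, h.compact.add h'.compact⟩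

theorem IsTest.smul {η : EuclideanSpace ℝ (Fin d) → ℂ} (c : ℂ) (h : IsTest η) :
    IsTest (c • η) :=
  ⟨contDiff_const.smul h.smooth, h.compact.smul_left (f := fun _ => c)⟩

theorem IsTest.conj {η : EuclideanSpace ℝ (Fin d) → ℂ} (h : IsTest η) :
    IsTest fun x => conj (η x) :=
  ⟨Complex.conjCLE.contDiff.comp h.smooth, h.compact.comp_left (map_zero _)⟩

theorem IsTest.ofReal {η : EuclideanSpace ℝ (Fin d) → ℝ} (h : ContDiff ℝ ∞ η)
    (hc : HasCompactSupport η) : IsTest fun x => (η x : ℂ) :=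
  ⟨Complex.ofRealCLM.contDiff.comp h, hc.comp_left Complex.ofReal_zero⟩

theorem contDiffAt_two {F : Type*} [NormedAddCommGroup F] [NormedSpace ℝ F]
    {f : EuclideanSpace ℝ (Fin d) → F} (h : ContDiff ℝ ∞ f) (x : EuclideanSpace ℝ (Fin d)) :
    ContDiffAt ℝ 2 f x := (h.of_le (by norm_cast)).contDiffAt

theorem laplacian_ofReal {η : EuclideanSpace ℝ (Fin d) → ℝ} (h : ContDiff ℝ ∞ η)
    (x : EuclideanSpace ℝ (Fin d)) : (Δ fun x => (η x : ℂ)) x = ((Δ η) x : ℂ) :=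
  (contDiffAt_two h x).laplacian_CLM_comp_left (l := Complex.ofRealCLM)

theorem laplacian_conj {η : EuclideanSpace ℝ (Fin d) → ℂ} (h : ContDiff ℝ ∞ η)
    (x : EuclideanSpace ℝ (Fin d)) : (Δ fun x => conj (η x)) x = conj ((Δ η) x) :=
  (contDiffAt_two h x).laplacian_CLM_comp_left (l := (Complex.conjCLE : ℂ →L[ℝ] ℂ))

theorem laplacian_re {η : EuclideanSpace ℝ (Fin d) → ℂ} (h : ContDiff ℝ ∞ η)
    (x : EuclideanSpace ℝ (Fin d)) : (Δ fun x => (η x).re) x = ((Δ η) x).re :=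
  (contDiffAt_two h x).laplacian_CLM_comp_left (l := Complex.reCLM)

theorem laplacian_im {η : EuclideanSpace ℝ (Fin d) → ℂ} (h : ContDiff ℝ ∞ η)
    (x : EuclideanSpace ℝ (Fin d)) : (Δ fun x => (η x).im) x = ((Δ η) x).im :=
  (contDiffAt_two h x).laplacian_CLM_comp_left (l := Complex.imCLM)

theorem integrableOn_of_memLp_two {α F : Type*} [MeasurableSpace α] [NormedAddCommGroup F]
    {ν : Measure α} {K : Set α} {f : α → F} (hK : ν K ≠ ⊤) (hf : MemLp f 2 (ν.restrict K)) : IntegrableOn f K ν := by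
  have : IsFiniteMeasure (ν.restrict K) := isFiniteMeasure_restrict.2 hK
  exact MemLp.integrable (q := 2) (by norm_num) hf

theorem LocallyL2.aestronglyMeasurable {U : EuclideanSpace ℝ (Fin d) → ℝ} (hU : LocallyL2 U) :
    AEStronglyMeasurable U := by
  have h : LocallyIntegrable U := by
    rw [locallyIntegrable_iff]
    intro K hK
    exact integrableOn_of_memLp_two hK.measure_ne_top (hU K hK)
  exact h.aestronglyMeasurable

theorem LocallyL2.memLp_mul {U : EuclideanSpace ℝ (Fin d) → ℝ} (hU : LocallyL2 U)
    {η : EuclideanSpace ℝ (Fin d) → ℂ} (hη : IsTest η) :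
    MemLp (fun x => (U x : ℂ) * η x) 2 := by
  obtain ⟨M, hM⟩ := hη.smooth.continuous.bounded_above_of_compact_support hη.compact
  have hK := hη.compact.isCompact
  have h1 : MemLp ((tsupport η).indicator U) 2 :=
    (memLp_indicator_iff_restrict hK.measurableSet).2 (hU _ hK)
  refine h1.of_le_mul (c := M) ?_ (Eventually.of_forall fun x => ?_)
  · exact (Complex.continuous_ofReal.comp_aestronglyMeasurable hU.aestronglyMeasurable).mul
      hη.smooth.continuous.aestronglyMeasurable
  · by_cases hx : x ∈ tsupport η
    · rw [Set.indicator_of_mem hx, norm_mul, Complex.norm_real, mul_comm]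
      exact mul_le_mul_of_nonneg_right (hM x) (norm_nonneg _)
    · simp [image_eq_zero_of_notMem_tsupport hx, Set.indicator_of_notMem hx]

theorem LocallyL2.locallyIntegrable_smul {U : EuclideanSpace ℝ (Fin d) → ℝ} (hU : LocallyL2 U)
    (ψ : Particle d) : LocallyIntegrable fun x => U x • ψ x := by
  rw [locallyIntegrable_iff]
  intro K hK
  exact memLp_one_iff_integrable.1 (((Lp.memLp ψ).restrict K).smul (hU K hK))

theorem IsTest.memLp {η : EuclideanSpace ℝ (Fin d) → ℂ} (hη : IsTest η) : MemLp η 2 :=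
  hη.smooth.continuous.memLp_of_hasCompactSupport hη.compact

theorem IsTest.laplacian {η : EuclideanSpace ℝ (Fin d) → ℂ} (hη : IsTest η) : IsTest (Δ η) :=
  ⟨contDiff_laplacian hη.smooth, hasCompactSupport_laplacian hη.smooth hη.compact⟩

/-- The triples `(η, -Δη + Uη, Wη)` with `η` a test function. -/
def testTriples (U W : EuclideanSpace ℝ (Fin d) → ℝ) :
    Submodule ℂ (Particle d × Particle d × Particle d) where
  carrier := {x | ∃ η, IsTest η ∧ x.1 =ᵐ[volume] η ∧
    x.2.1 =ᵐ[volume] (fun q => -(Δ η) q + U q * η q) ∧ x.2.2 =ᵐ[volume] fun q => W q * η q}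
  zero_mem' := by
    have e : ((0 : Particle d) : EuclideanSpace ℝ (Fin d) → ℂ) =ᵐ[volume] 0 :=
      Lp.coeFn_zero _ _ _
    have hΔ : Δ (0 : EuclideanSpace ℝ (Fin d) → ℂ) = 0 := by
      exact InnerProductSpace.laplacian_const
    refine ⟨0, IsTest.zero, e, e.trans ?_, e.trans ?_⟩
    · exact Eventually.of_forall fun q => by simp [hΔ]
    · exact Eventually.of_forall fun q => by simp
  add_mem' := by
    rintro x y ⟨η, hη, a1, a2, a3⟩ ⟨ζ, hζ, b1, b2, b3⟩
    refine ⟨η + ζ, hη.add hζ, ?_, ?_, ?_⟩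
    · filter_upwards [Lp.coeFn_add x.1 y.1, a1, b1] with q e1 e2 e3
      simp only [Prod.fst_add, e1, Pi.add_apply, e2, e3]
    · filter_upwards [Lp.coeFn_add x.2.1 y.2.1, a2, b2] with q e1 e2 e3
      rw [(contDiffAt_two hη.smooth q).laplacian_add (contDiffAt_two hζ.smooth q)]
      simp only [Prod.snd_add, Prod.fst_add, e1, Pi.add_apply, e2, e3]
      ring
    · filter_upwards [Lp.coeFn_add x.2.2 y.2.2, a3, b3] with q e1 e2 e3
      simp only [Prod.snd_add, e1, Pi.add_apply, e2, e3]
      ring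
  smul_mem' := by
    rintro c x ⟨η, hη, a1, a2, a3⟩
    refine ⟨c • η, hη.smul c, ?_, ?_, ?_⟩
    · filter_upwards [Lp.coeFn_smul c x.1, a1] with q e1 e2
      simp only [Prod.smul_fst, e1, Pi.smul_apply, e2]
    · filter_upwards [Lp.coeFn_smul c x.2.1, a2] with q e1 e2
      have e3 : (Δ (c • η)) q = c * (Δ η) q :=
        (contDiffAt_two hη.smooth q).laplacian_CLM_comp_left
          (l := (ContinuousLinearMap.mul ℝ ℂ c))
      simp only [Prod.smul_snd, Prod.smul_fst, e1, Pi.smul_apply, e2, e3, smul_eq_mul]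
      ring
    · filter_upwards [Lp.coeFn_smul c x.2.2, a3] with q e1 e2
      simp only [Prod.smul_snd, e1, Pi.smul_apply, e2, smul_eq_mul]
      ring

theorem exists_mem_testTriples {U W : EuclideanSpace ℝ (Fin d) → ℝ} (hU : LocallyL2 U)
    (hW : LocallyL2 W) {η : EuclideanSpace ℝ (Fin d) → ℂ} (hη : IsTest η) :
    ∃ x ∈ testTriples U W, x.1 =ᵐ[volume] η ∧
      x.2.1 =ᵐ[volume] (fun q => -(Δ η) q + U q * η q) ∧ x.2.2 =ᵐ[volume] fun q => W q * η q := by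
  have h2 : MemLp (fun q => -(Δ η) q + U q * η q) 2 := hη.laplacian.memLp.neg.add (hU.memLp_mul hη)
  have h3 := hW.memLp_mul hη
  refine ⟨(hη.memLp.toLp η, h2.toLp _, h3.toLp _),
    ⟨η, hη, hη.memLp.coeFn_toLp, h2.coeFn_toLp, h3.coeFn_toLp⟩, hη.memLp.coeFn_toLp,
    h2.coeFn_toLp, h3.coeFn_toLp⟩

/-- The sesquilinear pairing `(z, w) ↦ z̄ w` as a real bilinear map. -/
def conjMul : ℂ →L[ℝ] ℂ →L[ℝ] ℂ :=
  (ContinuousLinearMap.mul ℝ ℂ).comp (Complex.conjCLE : ℂ →L[ℝ] ℂ)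

theorem conjMul_apply (z w : ℂ) : conjMul z w = conj z * w := rfl

theorem integrable_conj_mul {a b : EuclideanSpace ℝ (Fin d) → ℂ} (ha : MemLp a 2)
    (hb : MemLp b 2) : Integrable fun q => conj (a q) * b q := by
  have : MemLp (fun q => conj (a q)) 2 := ha.star
  exact this.integrable_mul hb

/-- Green's first identity brings the form to a shape in which symmetry is visible and, for `U ≥ 0`,
so is positivity. -/
theorem integral_conj_mul_schroedinger {U : EuclideanSpace ℝ (Fin d) → ℝ} (hU : LocallyL2 U)
    {η ζ : EuclideanSpace ℝ (Fin d) → ℂ} (hη : IsTest η) (hζ : IsTest ζ) :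
    ∫ q, conj (η q) * (-(Δ ζ) q + U q * ζ q) =
      (∑ i, ∫ q, conj (partialDeriv i η q) * partialDeriv i ζ q) +
        ∫ q, conj (η q) * (U q * ζ q) := by
  have h := integral_bilinear_laplacian hη.smooth hζ.smooth hη.compact conjMul
  simp only [conjMul_apply] at h
  have i1 := integrable_conj_mul hη.memLp hζ.laplacian.memLp
  have i2 := integrable_conj_mul hη.memLp (hU.memLp_mul hζ)
  rw [← neg_eq_iff_eq_neg] at h
  have i1' : Integrable fun q => -(conj (η q) * (Δ ζ) q) := i1.neg
  rw [← h, ← integral_neg, ← integral_add i1' i2]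
  refine integral_congr_ae (Eventually.of_forall fun q => ?_)
  simp only
  ring

theorem locallyL2_zero : LocallyL2 (fun _ : EuclideanSpace ℝ (Fin d) => (0 : ℝ)) :=
  fun _ _ => MemLp.zero'

theorem testTriples_symm {U W : EuclideanSpace ℝ (Fin d) → ℝ} (hU : LocallyL2 U)
    {x y : Particle d × Particle d × Particle d} (hx : x ∈ testTriples U W)
    (hy : y ∈ testTriples U W) : (inner ℂ x.1 y.2.1 : ℂ) = inner ℂ x.2.1 y.1 := by
  obtain ⟨η, hη, a1, a2, -⟩ := hx
  obtain ⟨ζ, hζ, b1, b2, -⟩ := hy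
  rw [inner_eq_integral_of_ae a1 b2, ← inner_conj_symm, inner_eq_integral_of_ae b1 a2,
    integral_conj_mul_schroedinger hU hη hζ, integral_conj_mul_schroedinger hU hζ hη, map_add,
    map_sum, ← integral_conj]
  congr 1
  · refine Finset.sum_congr rfl fun i _ => ?_
    rw [← integral_conj]
    refine integral_congr_ae (Eventually.of_forall fun q => ?_)
    simp only [map_mul, Complex.conj_conj]
    ring
  · refine integral_congr_ae (Eventually.of_forall fun q => ?_)
    simp only [map_mul, Complex.conj_conj, Complex.conj_ofReal]
    ring

/-- `-Δ + U` with `U ≥ 0` in `L²_loc` is nonnegative and essentially self-adjoint on test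
functions. -/
theorem semiboundedGraph_testTriples {U W : EuclideanSpace ℝ (Fin d) → ℝ} (hU : LocallyL2 U)
    (hW : LocallyL2 W) (hpos : ∀ q, 0 ≤ U q) :
    SemiboundedGraph ((testTriples U W).map firstPart) := by
  refine ⟨?_, ⟨0, ?_⟩, ⟨1, ?_⟩⟩
  · rintro _ ⟨x, hx, rfl⟩ _ ⟨y, hy, rfl⟩
    exact testTriples_symm hU hx hy
  · rintro _ ⟨x, ⟨η, hη, a1, a2, -⟩, rfl⟩
    simp only [firstPart_apply, zero_mul]
    rw [inner_eq_integral_of_ae a1 a2, integral_conj_mul_schroedinger hU hη hη, Complex.add_re,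
      Complex.re_sum]
    have key : ∀ (a : EuclideanSpace ℝ (Fin d) → ℂ) (u : EuclideanSpace ℝ (Fin d) → ℝ),
        (∀ q, 0 ≤ u q) → 0 ≤ (∫ q, conj (a q) * (u q * a q)).re := by
      intro a u hu
      have e : (fun q => conj (a q) * (u q * a q)) = fun q => ((u q * ‖a q‖ ^ 2 : ℝ) : ℂ) := by
        funext q
        push_cast
        rw [← Complex.conj_mul']
        ring
      rw [e, integral_complex_ofReal, Complex.ofReal_re]
      exact integral_nonneg fun q => mul_nonneg (hu q) (sq_nonneg _)
    refine add_nonneg (Finset.sum_nonneg fun i _ => ?_) (key _ _ hpos)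
    simpa using key (partialDeriv i η) (fun _ => 1) fun _ => zero_le_one
  -- A vector `w` orthogonal to the range satisfies `Δw = (U + μ)w` weakly; real test functions
  -- suffice to see this. Since `⟨w, (U + μ)w⟩ ≥ μ|w|²` pointwise, Kato's inequality gives `w = 0`.
  · intro μ hμ w hw
    have hlU := hU.locallyIntegrable_smul w
    have hlw : LocallyIntegrable w := (Lp.memLp w).locallyIntegrable (by norm_num)
    refine (Lp.eq_zero_iff_ae_eq_zero).2 (ae_eq_zero_of_laplacian_eq (Lp.memLp w)
      (g := fun q => U q • w q + μ • w q) (μ := μ) (hlU.add (hlw.smul μ)) ?_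
      (by linarith) (Eventually.of_forall fun q => ?_))
    · intro η hη hηc
      have ht := IsTest.ofReal hη hηc
      obtain ⟨x, hx, e1, e2, -⟩ := exists_mem_testTriples hU hW ht
      have h1 := hw _ (Submodule.mem_map_of_mem hx)
      simp only [firstPart_apply] at h1
      have e3 : (x.2.1 + (μ : ℂ) • x.1 : Particle d) =ᵐ[volume]
          fun q => ((-(Δ η) q + U q * η q + μ * η q : ℝ) : ℂ) := by
        filter_upwards [Lp.coeFn_add x.2.1 ((μ : ℂ) • x.1), Lp.coeFn_smul (μ : ℂ) x.1, e1, e2]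
          with q c1 c2 c3 c4
        rw [c1, Pi.add_apply, c2, Pi.smul_apply, c3, c4, laplacian_ofReal hη]
        push_cast
        rw [smul_eq_mul]
      rw [inner_eq_integral_of_ae e3 (ae_eq_refl _)] at h1
      simp only [Complex.conj_ofReal] at h1
      have i1 : Integrable fun q => (Δ η) q • w q :=
        hlw.integrable_smul_left_of_hasCompactSupport (contDiff_laplacian hη).continuous
          (hasCompactSupport_laplacian hη hηc)
      have i2 : Integrable fun q => η q • (U q • w q + μ • w q) :=
        (hlU.add (hlw.smul μ)).integrable_smul_left_of_hasCompactSupport hη.continuous hηc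
      rw [← sub_eq_zero, ← integral_sub i1 i2, ← neg_eq_zero, ← integral_neg, ← h1]
      refine integral_congr_ae (Eventually.of_forall fun q => ?_)
      simp only [Complex.real_smul]
      push_cast
      ring
    · rw [inner_add_right, inner_smul_right, inner_smul_right, real_inner_self_eq_norm_sq]
      have := mul_nonneg (hpos q) (sq_nonneg ‖w q‖)
      linarith

/-- In dimension at most three, test functions are bounded in terms of `(-Δ + U)η` and `η`. -/
theorem exists_forall_norm_le (hd : d ≤ 3) {ε : ℝ} (hε : 0 < ε) :
    ∃ C : ℝ, 0 ≤ C ∧ ∀ U W : EuclideanSpace ℝ (Fin d) → ℝ, (∀ q, 0 ≤ U q) →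
      ∀ x ∈ testTriples U W, ∀ᵐ q, ‖x.1 q‖ ≤ ε * ‖x.2.1‖ + C * ‖x.1‖ := by
  obtain ⟨C, hC0, hC⟩ := exists_forall_le_laplacian hd hε
  refine ⟨C, hC0, fun U W hU x ⟨η, hη, e1, e2, _⟩ => ?_⟩
  have n1 : ‖x.1‖ = √(∫ q, ‖η q‖ ^ 2) := by
    rw [norm_eq_sqrt_integral]
    congr 1
    refine integral_congr_ae ?_
    filter_upwards [e1] with q hq
    rw [hq]
  have n2 : ‖x.2.1‖ = √(∫ q, ‖-(Δ η) q + U q * η q‖ ^ 2) := by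
    rw [norm_eq_sqrt_integral]
    congr 1
    refine integral_congr_ae ?_
    filter_upwards [e2] with q hq
    rw [hq]
  have i1 : Integrable fun q => ‖η q‖ ^ 2 := hη.memLp.integrable_norm_pow (by norm_num)
  have i2 : Integrable fun q => ‖-(Δ η) q + U q * η q‖ ^ 2 := by
    have : MemLp (fun q => -(Δ η) q + U q * η q) 2 := (memLp_congr_ae e2).1 (Lp.memLp _)
    exact this.integrable_norm_pow (by norm_num)
  -- Apply the real bound to `u = √(|η|² + δ²) - δ`. By Kato's inequality and `U ≥ 0`, `(-Δu)₊ ≤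
  -- |(-Δ + U)η|` pointwise, so the potential drops out and the constant is uniform in `U`. The
  -- parameter `δ` is arbitrary.
  have key : ∀ q, ‖η q‖ ≤ ε * ‖x.2.1‖ + C * ‖x.1‖ := by
    intro q
    refine le_of_forall_pos_le_add fun δ hδ => ?_
    refine (norm_le_regNorm_add (ε := δ) (η q)).trans (add_le_add_left ?_ _)
    refine (hC _ (contDiff_regNorm hδ hη.smooth) (hasCompactSupport_regNorm hδ hη.compact) q).trans
      ?_
    rw [n1, n2]
    gcongr ε * √?_ + C * √?_
    · refine integral_mono_of_nonneg (Eventually.of_forall fun y => sq_nonneg _) i2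
        (Eventually.of_forall fun y => ?_)
      refine pow_le_pow_left₀ (le_max_right _ _) (max_le ?_ (norm_nonneg _)) 2
      have h1 := inner_laplacian_le hδ hη.smooth y
      set s := √(‖η y‖ ^ 2 + δ ^ 2) with hs
      have hs0 : 0 < s := Real.sqrt_pos.2 (by positivity)
      have hηs : ‖η y‖ ≤ s := Real.le_sqrt_of_sq_le (by nlinarith [sq_nonneg δ])
      have h2 : inner ℝ (η y) (-(Δ η) y + U y * η y) =
          -inner ℝ (η y) ((Δ η) y) + U y * ‖η y‖ ^ 2 := by
        rw [inner_add_right, inner_neg_right, ← Complex.real_smul, inner_smul_right,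
          real_inner_self_eq_norm_sq]
      have h3 := real_inner_le_norm (η y) (-(Δ η) y + U y * η y)
      have h4 := mul_nonneg (hU y) (sq_nonneg ‖η y‖)
      have h5 := mul_le_mul_of_nonneg_right hηs (norm_nonneg (-(Δ η) y + U y * η y))
      refine le_of_mul_le_mul_left ?_ hs0
      linarith
    · refine integral_mono_of_nonneg (Eventually.of_forall fun y => sq_nonneg _) i1
        (Eventually.of_forall fun y => ?_)
      exact pow_le_pow_left₀ (regNorm_nonneg _) (regNorm_le hδ _) 2
  filter_upwards [e1] with q hq
  rw [hq]
  exact key q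

/-- `-Δ + U + W` is semibounded and essentially self-adjoint on test functions, if `U ≥ 0` is in
`L²_loc` and `W` is bounded, or square integrable and `d ≤ 3`. -/
theorem semiboundedGraph_testTriples_total {U W : EuclideanSpace ℝ (Fin d) → ℝ}
    (hU : LocallyL2 U) (hW : LocallyL2 W) (hpos : ∀ q, 0 ≤ U q)
    (h : (d ≤ 3 ∧ MemLp W 2) ∨ ∃ c : ℝ, ∀ᵐ q, |W q| ≤ c) :
    SemiboundedGraph ((testTriples U W).map totalPart) := by
  refine (semiboundedGraph_testTriples hU hW hpos).perturb ?_ ?_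
  · rintro x ⟨η, hη, a1, -, a3⟩ y ⟨ζ, hζ, b1, -, b3⟩
    rw [inner_eq_integral_of_ae a1 b3, inner_eq_integral_of_ae a3 b1]
    refine integral_congr_ae (Eventually.of_forall fun q => ?_)
    simp only [map_mul, Complex.conj_ofReal]
    ring
  · intro ε hε
    rcases h with ⟨hd, hW2⟩ | ⟨c, hc⟩
    · set N := ‖hW2.toLp W‖ with hN
      have hN0 : 0 ≤ N := norm_nonneg _
      -- `‖Wη‖₂ ≤ ‖W‖₂ ‖η‖_∞`. Dividing `ε` by `N + 1` instead of `N = ‖W‖₂` allows `W = 0`.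
      obtain ⟨C, hC0, hC⟩ := exists_forall_norm_le hd (ε := ε / (N + 1)) (by positivity)
      refine ⟨N * C, fun x hx => ?_⟩
      have h1 := hC U W hpos x hx
      obtain ⟨η, hη, a1, -, a3⟩ := hx
      have h2 : ‖x.2.2‖ ≤ (ε / (N + 1) * ‖x.2.1‖ + C * ‖x.1‖) * N := by
        refine Lp.norm_le_mul_norm_of_ae_le_mul ?_
        filter_upwards [h1, a1, a3, hW2.coeFn_toLp] with q c1 c2 c3 c4
        rw [c3, c4, norm_mul, Complex.norm_real, mul_comm, ← c2]
        gcongr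
      have h3 : ε / (N + 1) * N ≤ ε := by
        rw [div_mul_eq_mul_div, div_le_iff₀ (by positivity)]
        nlinarith
      have := mul_le_mul_of_nonneg_right h3 (norm_nonneg x.2.1)
      nlinarith
    · refine ⟨c, fun x ⟨η, hη, a1, _, a3⟩ => ?_⟩
      have h2 : ‖x.2.2‖ ≤ c * ‖x.1‖ := by
        refine Lp.norm_le_mul_norm_of_ae_le_mul ?_
        filter_upwards [a1, a3, hc] with q c1 c2 c3
        rw [c1, c2, norm_mul, Complex.norm_real]
        gcongr
        exact c3
      have := mul_nonneg hε.le (norm_nonneg x.2.1)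
      linarith

/-- With `adjoint_of_mem_particleGraph` this identifies the maximal distributional operator as the
adjoint of its restriction to test functions. -/
theorem mem_particleGraph_of_adjoint {U W V : EuclideanSpace ℝ (Fin d) → ℝ} (hU : LocallyL2 U)
    (hW : LocallyL2 W) (hV : LocallyL2 V) (hUW : ∀ q, V q = U q + W q) {ψ χ : Particle d}
    (h : ∀ x ∈ testTriples U W, inner ℂ (x.2.1 + x.2.2) ψ = (inner ℂ x.1 χ : ℂ)) :
    (ψ, χ) ∈ particleGraph V := by
  refine ⟨hV.locallyIntegrable_smul ψ, fun η hη hηc => ?_⟩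
  obtain ⟨x, hx, e1, e2, e3⟩ := exists_mem_testTriples hU hW (IsTest.ofReal hη hηc)
  have h1 := h x hx
  have e4 : (x.2.1 + x.2.2 : Particle d) =ᵐ[volume]
      fun q => ((-(Δ η) q + V q * η q : ℝ) : ℂ) := by
    filter_upwards [Lp.coeFn_add x.2.1 x.2.2, e2, e3] with q c1 c2 c3
    rw [c1, Pi.add_apply, c2, c3, laplacian_ofReal hη, hUW]
    push_cast
    ring
  rw [inner_eq_integral_of_ae e4 (ae_eq_refl _), inner_eq_integral_of_ae e1 (ae_eq_refl _)] at h1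
  simpa only [Complex.conj_ofReal, Complex.real_smul] using h1

/-- The distributional definition tests with real functions only; complex ones follow by taking real
and imaginary parts. -/
theorem integral_test_of_mem_particleGraph {V : EuclideanSpace ℝ (Fin d) → ℝ} {ψ χ : Particle d}
    (h : (ψ, χ) ∈ particleGraph V) {ζ : EuclideanSpace ℝ (Fin d) → ℂ} (hζ : IsTest ζ) :
    ∫ q, (-(Δ ζ) q + V q * ζ q) * ψ q = ∫ q, ζ q * χ q := by
  have r1 : ContDiff ℝ ∞ fun q => (ζ q).re := Complex.reCLM.contDiff.comp hζ.smooth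
  have r2 : HasCompactSupport fun q => (ζ q).re := hζ.compact.comp_left Complex.zero_re
  have m1 : ContDiff ℝ ∞ fun q => (ζ q).im := Complex.imCLM.contDiff.comp hζ.smooth
  have m2 : HasCompactSupport fun q => (ζ q).im := hζ.compact.comp_left Complex.zero_im
  have h1 := h.2 _ r1 r2
  have h2 := h.2 _ m1 m2
  have i1 := integrable_test V ψ h.1 _ r1 r2
  have i2 := integrable_test V ψ h.1 _ m1 m2
  have hχ : LocallyIntegrable χ := (Lp.memLp χ).locallyIntegrable (by norm_num)
  have j1 := hχ.integrable_smul_left_of_hasCompactSupport r1.continuous r2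
  have j2 := hχ.integrable_smul_left_of_hasCompactSupport m1.continuous m2
  simp only at h1 h2
  calc ∫ q, (-(Δ ζ) q + V q * ζ q) * ψ q
      = ∫ q, ((-(Δ fun q => (ζ q).re) q + V q * (ζ q).re) • ψ q +
          Complex.I * ((-(Δ fun q => (ζ q).im) q + V q * (ζ q).im) • ψ q)) := by
        refine integral_congr_ae (Eventually.of_forall fun q => ?_)
        simp only [laplacian_re hζ.smooth, laplacian_im hζ.smooth, Complex.real_smul]
        push_cast
        linear_combination ((Complex.re_add_im ((Δ ζ) q)) - V q * Complex.re_add_im (ζ q)) * ψ q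
    _ = ∫ q, ((ζ q).re • χ q + Complex.I * ((ζ q).im • χ q)) := by
        rw [integral_add i1 (i2.const_mul _), integral_add j1 (j2.const_mul _),
          integral_const_mul, integral_const_mul, h1, h2]
    _ = _ := by
        refine integral_congr_ae (Eventually.of_forall fun q => ?_)
        simp only [Complex.real_smul]
        linear_combination Complex.re_add_im (ζ q) * χ q

theorem adjoint_of_mem_particleGraph {U W V : EuclideanSpace ℝ (Fin d) → ℝ}
    (hUW : ∀ q, V q = U q + W q) {ψ χ : Particle d} (h : (ψ, χ) ∈ particleGraph V) :
    ∀ x ∈ testTriples U W, inner ℂ (x.2.1 + x.2.2) ψ = (inner ℂ x.1 χ : ℂ) := by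
  rintro x ⟨η, hη, e1, e2, e3⟩
  have e4 : (x.2.1 + x.2.2 : Particle d) =ᵐ[volume] fun q => -(Δ η) q + V q * η q := by
    filter_upwards [Lp.coeFn_add x.2.1 x.2.2, e2, e3] with q c1 c2 c3
    rw [c1, Pi.add_apply, c2, c3, hUW]
    push_cast
    ring
  rw [inner_eq_integral_of_ae e4 (ae_eq_refl _), inner_eq_integral_of_ae e1 (ae_eq_refl _),
    ← integral_test_of_mem_particleGraph h hη.conj]
  refine integral_congr_ae (Eventually.of_forall fun q => ?_)
  simp only [laplacian_conj hη.smooth, map_add, map_neg, map_mul, Complex.conj_ofReal]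

/-- The Schrödinger operator on its maximal domain is the closure of its restriction to test
functions, which is semibounded and essentially self-adjoint. -/
theorem semiboundedGraph_particleGraph_of_add {U W V : EuclideanSpace ℝ (Fin d) → ℝ}
    (hU : LocallyL2 U) (hW : LocallyL2 W) (hV : LocallyL2 V) (hUW : ∀ q, V q = U q + W q)
    (hs : SemiboundedGraph ((testTriples U W).map totalPart)) :
    SemiboundedGraph (particleGraph V) ∧
      IsClosed (particleGraph V : Set (Particle d × Particle d)) := by
  set G := (testTriples U W).map totalPart with hG
  have hcl := hs.closure
  -- The maximal operator lies in the adjoint of the closure, hence in the closure by essential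
  -- self-adjointness. Conversely the closure is symmetric, so it lies in the adjoint of the
  -- restriction to test functions, which is the maximal operator.
  have e : particleGraph V = G.topologicalClosure := by
    refine le_antisymm (fun x hx => ?_) fun x hx => ?_
    · refine hcl.mem_of_adjoint G.isClosed_topologicalClosure ?_
      intro y hy
      refine closure_minimal (s := (G : Set (Particle d × Particle d)))
        (t := {y | inner ℂ y.2 x.1 = (inner ℂ y.1 x.2 : ℂ)}) ?_
        (isClosed_eq (by fun_prop) (by fun_prop)) hy
      rintro _ ⟨z, hz, rfl⟩
      exact adjoint_of_mem_particleGraph hUW hx z hz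
    · refine mem_particleGraph_of_adjoint hU hW hV hUW fun y hy => ?_
      exact (hcl.symm _ (G.le_topologicalClosure (Submodule.mem_map_of_mem hy)) _ hx).symm
  rw [e]
  exact ⟨hcl, G.isClosed_topologicalClosure⟩

theorem LocallyL2.mono {U V : EuclideanSpace ℝ (Fin d) → ℝ} (hV : LocallyL2 V)
    (hm : AEStronglyMeasurable U) (h : ∀ q, |U q| ≤ |V q|) : LocallyL2 U :=
  fun K hK => (hV K hK).mono hm.restrict (Eventually.of_forall h)

/-- The negative part of `V` is the perturbation. As `V → +∞`, it vanishes outside a compact set and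
is therefore globally square integrable, which is used for `d ≤ 3`; otherwise it is bounded by
assumption. -/
theorem particle_semiboundedGraph {V : EuclideanSpace ℝ (Fin d) → ℝ} (hV : ConditionC V)
    (hVb : d ≤ 3 ∨ ∃ c : ℝ, ∀ᵐ q, c ≤ V q) :
    SemiboundedGraph (particleGraph V) ∧
      IsClosed (particleGraph V : Set (Particle d × Particle d)) := by
  have hVl : LocallyL2 V := hV.1
  have hm := hVl.aestronglyMeasurable
  have hU : LocallyL2 fun q => max (V q) 0 := hVl.mono
    ((continuous_id.max continuous_const).comp_aestronglyMeasurable hm) fun q => by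
      rcases le_total (V q) 0 with h | h <;> simp [h]
  have hW : LocallyL2 fun q => min (V q) 0 := hVl.mono
    ((continuous_id.min continuous_const).comp_aestronglyMeasurable hm) fun q => by
      rcases le_total (V q) 0 with h | h <;> simp [h]
  refine semiboundedGraph_particleGraph_of_add hU hW hVl (fun q => by
    rcases le_total (V q) 0 with h | h <;> simp [h])
    (semiboundedGraph_testTriples_total hU hW (fun q => le_max_right _ _) ?_)
  rcases hVb with hd | ⟨c, hc⟩
  · refine Or.inl ⟨hd, ?_⟩
    obtain ⟨K, hK, hK'⟩ := mem_cocompact.1 (hV.2.eventually_ge_atTop 0)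
    have e : (fun q => min (V q) 0) = K.indicator fun q => min (V q) 0 := by
      funext q
      by_cases hq : q ∈ K
      · rw [Set.indicator_of_mem hq]
      · rw [Set.indicator_of_notMem hq]
        exact min_eq_right (hK' hq)
    rw [e, memLp_indicator_iff_restrict hK.measurableSet]
    exact hW K hK
  · refine Or.inr ⟨|c|, ?_⟩
    filter_upwards [hc] with q hq
    rcases le_total (V q) 0 with h | h
    · rw [min_eq_left h, abs_of_nonpos h]
      linarith [neg_abs_le c]
    · simp [h]

/-- Test functions lie in the domain because `V` is locally square integrable, and they are dense.
-/
theorem particleGraph_domain_dense {V : EuclideanSpace ℝ (Fin d) → ℝ} (hV : LocallyL2 V)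
    {w : Particle d} (h : ∀ x ∈ particleGraph V, (inner ℂ x.1 w : ℂ) = 0) : w = 0 := by
  refine (Lp.eq_zero_iff_ae_eq_zero).2 (ae_eq_zero_of_integral_contDiff_smul_eq_zero
    ((Lp.memLp w).locallyIntegrable (by norm_num)) fun η hη hη' => ?_)
  obtain ⟨x, hx, e1, e2, e3⟩ := exists_mem_testTriples hV locallyL2_zero (IsTest.ofReal hη hη')
  have h1 := h (x.1, x.2.1) (mem_particleGraph_of_adjoint hV locallyL2_zero hV
    (fun q => (add_zero _).symm) fun y hy => ?_)
  · rw [inner_eq_integral_of_ae e1 (ae_eq_refl _)] at h1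
    simpa only [Complex.conj_ofReal, Complex.real_smul] using h1
  · have h0 : y.2.2 = 0 := by
      obtain ⟨ζ, hζ, -, -, c3⟩ := hy
      refine (Lp.eq_zero_iff_ae_eq_zero).2 ?_
      filter_upwards [c3] with q hq
      simp [hq]
    rw [h0, add_zero]
    exact (testTriples_symm hV hy hx).symm

end Particle

/-! ### Adding and removing one boson on the particle sectors -/

section Sectors

theorem measurableEmbedding_split {Y : Type} [MeasureSpace Y] {m : ℕ} (j : Fin (m + 1)) :
    MeasurableEmbedding (fun p : Fin (m + 1) → Y => (p j, fun i => p (j.succAbove i))) :=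
  (MeasurableEquiv.piFinSuccAbove (fun _ : Fin (m + 1) => Y) j).measurableEmbedding

variable {Y : Type} [MeasureSpace Y] [SigmaFinite (volume : Measure Y)] {m : ℕ}

theorem measurePreserving_split (j : Fin (m + 1)) :
    MeasurePreserving (fun p : Fin (m + 1) → Y => (p j, fun i => p (j.succAbove i))) volume
      ((volume : Measure Y).prod (volume : Measure (Fin m → Y))) :=
  measurePreserving_piFinSuccAbove (fun _ : Fin (m + 1) => (volume : Measure Y)) j

theorem integrable_split {F : Y → ℝ} {G : (Fin m → Y) → ℝ} (hF : Integrable F)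
    (hG : Integrable G) (j : Fin (m + 1)) :
    Integrable fun p : Fin (m + 1) → Y => F (p j) * G (fun i => p (j.succAbove i)) :=
  (measurePreserving_split j).integrable_comp_of_integrable (hF.mul_prod hG)

theorem integral_split (F : Y → ℝ) (G : (Fin m → Y) → ℝ) (j : Fin (m + 1)) :
    ∫ p : Fin (m + 1) → Y, F (p j) * G (fun i => p (j.succAbove i)) = (∫ y, F y) * ∫ p, G p := by
  rw [← integral_prod_mul]
  exact (measurePreserving_split j).integral_comp (measurableEmbedding_split j)
    (fun z => F z.1 * G z.2)

theorem integral_cons {E : Type*} [NormedAddCommGroup E] [NormedSpace ℝ E]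
    {f : (Fin (m + 1) → Y) → E} (hf : Integrable f) :
    (∀ᵐ p : Fin m → Y, Integrable fun y => f (Fin.cons y p)) ∧
      Integrable (fun p : Fin m → Y => ∫ y, f (Fin.cons y p)) ∧
      ∫ p, f p = ∫ p : Fin m → Y, ∫ y, f (Fin.cons y p) := by
  have h1 := (measurePreserving_piFinSuccAbove
    (fun _ : Fin (m + 1) => (volume : Measure Y)) 0).symm
  have e : (fun z : Y × (Fin m → Y) => f (Fin.cons z.1 z.2)) =
      f ∘ (MeasurableEquiv.piFinSuccAbove (fun _ : Fin (m + 1) => Y) 0).symm := by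
    funext z
    simp [MeasurableEquiv.piFinSuccAbove, Fin.insertNthEquiv]
  have i1 : Integrable (fun z : Y × (Fin m → Y) => f (Fin.cons z.1 z.2))
      ((volume : Measure Y).prod (volume : Measure (Fin m → Y))) := by
    rw [e]
    exact h1.integrable_comp_of_integrable hf
  refine ⟨i1.prod_left_ae, i1.integral_prod_right, ?_⟩
  rw [← integral_prod_symm _ i1, e]
  exact (h1.integral_comp (MeasurableEquiv.measurableEmbedding _) f).symm

theorem memLp_split {h : Y → ℂ} {v : (Fin m → Y) → ℂ} (hh : MemLp h 2) (hv : MemLp v 2)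
    (j : Fin (m + 1)) :
    MemLp (fun p : Fin (m + 1) → Y => h (p j) * v (fun i => p (j.succAbove i))) 2 := by
  have hq := (measurePreserving_split (Y := Y) j).quasiMeasurePreserving
  have m1 : AEStronglyMeasurable (fun p : Fin (m + 1) → Y => h (p j)) :=
    hh.1.comp_quasiMeasurePreserving (Measure.quasiMeasurePreserving_fst.comp hq)
  have m2 : AEStronglyMeasurable (fun p : Fin (m + 1) → Y => v (fun i => p (j.succAbove i))) :=
    hv.1.comp_quasiMeasurePreserving (Measure.quasiMeasurePreserving_snd.comp hq)
  have m3 : AEStronglyMeasurable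
      (fun p : Fin (m + 1) → Y => h (p j) * v (fun i => p (j.succAbove i))) := m1.mul m2
  rw [memLp_two_iff_integrable_sq_norm m3]
  simp only [norm_mul, mul_pow]
  exact integrable_split (F := fun y => ‖h y‖ ^ 2) (G := fun p => ‖v p‖ ^ 2)
    (hh.integrable_norm_pow (by norm_num)) (hv.integrable_norm_pow (by norm_num)) j

/-- `v ↦ h(pⱼ) v(p without its j-th entry)`. -/
def insertAt {h : Y → ℂ} (hh : MemLp h 2) (j : Fin (m + 1)) :
    Lp ℂ 2 (volume : Measure (Fin m → Y)) →L[ℂ] Lp ℂ 2 (volume : Measure (Fin (m + 1) → Y)) :=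
  LinearMap.mkContinuous
    { toFun := fun v => (memLp_split hh (Lp.memLp v) j).toLp _
      map_add' := fun v v' => by
        rw [← MemLp.toLp_add]
        refine MemLp.toLp_congr _ _ ?_
        filter_upwards [ae_removeNth j (Lp.coeFn_add v v')] with p hp
        simp only [hp, Pi.add_apply, mul_add]
      map_smul' := fun c v => by
        rw [RingHom.id_apply, ← MemLp.toLp_const_smul]
        refine MemLp.toLp_congr _ _ ?_
        filter_upwards [ae_removeNth j (Lp.coeFn_smul c v)] with p hp
        simp only [hp, Pi.smul_apply, smul_eq_mul]
        ring }
    (√(∫ y, ‖h y‖ ^ 2)) fun v => le_of_eq (by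
      rw [norm_eq_sqrt_integral v, ← Real.sqrt_mul (integral_nonneg fun _ => sq_nonneg _),
        ← integral_split (fun y => ‖h y‖ ^ 2) (fun p => ‖v p‖ ^ 2) j, norm_eq_sqrt_integral]
      congr 1
      refine integral_congr_ae ?_
      filter_upwards [(memLp_split hh (Lp.memLp v) j).coeFn_toLp] with p hp
      simp only [LinearMap.coe_mk, AddHom.coe_mk]
      rw [hp, norm_mul, mul_pow])

theorem insertAt_ae {h : Y → ℂ} (hh : MemLp h 2) (j : Fin (m + 1))
    (v : Lp ℂ 2 (volume : Measure (Fin m → Y))) :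
    insertAt hh j v =ᵐ[volume] fun p => h (p j) * v (fun i => p (j.succAbove i)) :=
  (memLp_split hh (Lp.memLp v) j).coeFn_toLp

/-- `u ↦ ∫ conj (h y) u(y, ·) dy`. -/
def contract {h : Y → ℂ} (hh : MemLp h 2) :
    Lp ℂ 2 (volume : Measure (Fin (m + 1) → Y)) →L[ℂ] Lp ℂ 2 (volume : Measure (Fin m → Y)) :=
  ContinuousLinearMap.adjoint (insertAt hh 0)

theorem norm_sq_insertAt {h : Y → ℂ} (hh : MemLp h 2) (j : Fin (m + 1))
    (v : Lp ℂ 2 (volume : Measure (Fin m → Y))) :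
    ‖insertAt hh j v‖ ^ 2 = (∫ y, ‖h y‖ ^ 2) * ‖v‖ ^ 2 := by
  rw [norm_sq_eq_integral, norm_sq_eq_integral,
    ← integral_split (fun y => ‖h y‖ ^ 2) (fun p => ‖v p‖ ^ 2) j]
  refine integral_congr_ae ?_
  filter_upwards [insertAt_ae hh j v] with p hp
  rw [hp, norm_mul, mul_pow]

/-- Defining the contraction as an adjoint makes it bounded at no cost. The integral formula is
recovered by pairing with indicators of sets of finite measure, Fubini, and σ-finiteness. -/
theorem contract_ae {h : Y → ℂ} (hh : MemLp h 2)
    (u : Lp ℂ 2 (volume : Measure (Fin (m + 1) → Y))) :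
    ∀ᵐ p : Fin m → Y, Integrable (fun y => conj (h y) * u (Fin.cons y p)) ∧
      contract hh u p = ∫ y, conj (h y) * u (Fin.cons y p) := by
  have key : ∀ s : Set (Fin m → Y), MeasurableSet s → volume s < ⊤ →
      Integrable (fun p : Fin (m + 1) → Y => s.indicator (fun _ => (1 : ℂ))
        (fun i => p i.succ) * (conj (h (p 0)) * u p)) ∧
      ∫ p in s, contract hh u p = ∫ p : Fin (m + 1) → Y, s.indicator (fun _ => (1 : ℂ))
        (fun i => p i.succ) * (conj (h (p 0)) * u p) := by
    intro s hs hμ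
    have e : insertAt hh 0 (indicatorConstLp 2 hs hμ.ne (1 : ℂ)) =ᵐ[volume]
        fun p => h (p 0) * s.indicator (fun _ => (1 : ℂ)) (fun i => p i.succ) := by
      filter_upwards [insertAt_ae hh 0 (indicatorConstLp 2 hs hμ.ne (1 : ℂ)),
        ae_removeNth 0 (indicatorConstLp_coeFn (p := 2) (hs := hs) (hμs := hμ.ne) (c := (1 : ℂ)))]
        with p h1 h2
      rw [h1, h2]
      simp only [Fin.succAbove_zero]
    have e2 : (fun p : Fin (m + 1) → Y => inner ℂ
        (insertAt hh 0 (indicatorConstLp 2 hs hμ.ne (1 : ℂ)) p) (u p)) =ᵐ[volume]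
        fun p => s.indicator (fun _ => (1 : ℂ)) (fun i => p i.succ) * (conj (h (p 0)) * u p) := by
      filter_upwards [e] with p hp
      rw [hp, RCLike.inner_apply, map_mul]
      by_cases hps : (fun i : Fin m => p i.succ) ∈ s
      · simp [Set.indicator_of_mem hps, mul_comm]
      · simp [Set.indicator_of_notMem hps]
    refine ⟨(L2.integrable_inner _ _).congr e2, ?_⟩
    rw [← L2.inner_indicatorConstLp_one hs hμ.ne, contract,
      ContinuousLinearMap.adjoint_inner_right, L2.inner_def]
    exact integral_congr_ae e2
  have key2 : ∀ s : Set (Fin m → Y), MeasurableSet s → volume s < ⊤ →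
      (∀ᵐ p : Fin m → Y, p ∈ s → Integrable (fun y => conj (h y) * u (Fin.cons y p))) ∧
      IntegrableOn (fun p : Fin m → Y => ∫ y, conj (h y) * u (Fin.cons y p)) s ∧
      ∫ p in s, contract hh u p = ∫ p in s, ∫ y, conj (h y) * u (Fin.cons y p) := by
    intro s hs hμ
    obtain ⟨i1, i2⟩ := key s hs hμ
    obtain ⟨j1, j2, j3⟩ := integral_cons i1
    have e : (fun p : Fin m → Y => ∫ y, s.indicator (fun _ => (1 : ℂ))
        (fun i => (Fin.cons y p : Fin (m + 1) → Y) i.succ) *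
          (conj (h ((Fin.cons y p : Fin (m + 1) → Y) 0)) * u (Fin.cons y p))) =
        s.indicator fun p => ∫ y, conj (h y) * u (Fin.cons y p) := by
      funext p
      simp only [Fin.cons_succ, Fin.cons_zero]
      by_cases hps : p ∈ s
      · simp [Set.indicator_of_mem hps]
      · simp [Set.indicator_of_notMem hps]
    rw [e] at j2 j3
    refine ⟨?_, (integrable_indicator_iff hs).1 j2, ?_⟩
    · filter_upwards [j1] with p hp hps
      simpa [Set.indicator_of_mem hps] using hp
    · rw [i2, j3, integral_indicator hs]
  have a1 : ∀ᵐ p : Fin m → Y, Integrable (fun y => conj (h y) * u (Fin.cons y p)) := by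
    have : ∀ᵐ p : Fin m → Y, ∀ n, p ∈ spanningSets (volume : Measure (Fin m → Y)) n →
        Integrable (fun y => conj (h y) * u (Fin.cons y p)) :=
      ae_all_iff.2 fun n => (key2 _ (measurableSet_spanningSets _ n)
        (measure_spanningSets_lt_top _ n)).1
    filter_upwards [this] with p hp
    exact hp _ (mem_spanningSetsIndex _ p)
  have a2 := ae_eq_of_forall_setIntegral_eq_of_sigmaFinite (μ := (volume : Measure (Fin m → Y)))
    (f := contract hh u) (g := fun p => ∫ y, conj (h y) * u (Fin.cons y p))
    (fun s hs hμ => integrableOn_of_memLp_two hμ.ne ((Lp.memLp (contract hh u)).restrict s))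
    (fun s hs hμ => (key2 s hs hμ).2.1) (fun s hs hμ => (key2 s hs hμ).2.2)
  filter_upwards [a1, a2] with p h1 h2
  exact ⟨h1, h2⟩

/-- The unitary action of permutations on `L²(Yᵐ)`. -/
def permute (σ : Equiv.Perm (Fin m)) :
    Lp ℂ 2 (volume : Measure (Fin m → Y)) →ₗᵢ[ℂ] Lp ℂ 2 (volume : Measure (Fin m → Y)) :=
  Lp.compMeasurePreservingₗᵢ ℂ (fun p : Fin m → Y => p ∘ σ) (measurePreserving_perm Y σ)

theorem permute_ae (σ : Equiv.Perm (Fin m)) (u : Lp ℂ 2 (volume : Measure (Fin m → Y))) :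
    permute σ u =ᵐ[volume] fun p => u (p ∘ σ) :=
  Lp.coeFn_compMeasurePreserving u (measurePreserving_perm Y σ)

theorem mem_sector_iff {u : Lp ℂ 2 (volume : Measure (Fin m → Y))} :
    u ∈ sector Y m ↔ ∀ σ : Equiv.Perm (Fin m), permute σ u = u := Iff.rfl

theorem sector_ae {u : Lp ℂ 2 (volume : Measure (Fin m → Y))} (hu : u ∈ sector Y m)
    (σ : Equiv.Perm (Fin m)) : ∀ᵐ p : Fin m → Y, u (p ∘ σ) = u p := by
  filter_upwards [permute_ae σ u] with p hp
  rw [← hp, mem_sector_iff.1 hu σ]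

/-- A permutation sending `j` to `σ j` induces a permutation `τ` of the remaining `m` labels, which
the symmetric function `v` does not notice. -/
theorem permute_insertAt {h : Y → ℂ} (hh : MemLp h 2) (j : Fin (m + 1))
    (σ : Equiv.Perm (Fin (m + 1))) {v : Lp ℂ 2 (volume : Measure (Fin m → Y))}
    (hv : v ∈ sector Y m) : permute σ (insertAt hh j v) = insertAt hh (σ j) v := by
  set τ : Equiv.Perm (Fin m) := (finSuccAboveEquiv j).trans
    ((σ.subtypeEquiv (p := fun x => x ≠ j) (q := fun x => x ≠ σ j) fun a => by simp).trans
      (finSuccAboveEquiv (σ j)).symm) with hτ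
  have hτ' : ∀ i, (σ j).succAbove (τ i) = σ (j.succAbove i) := by
    intro i
    have h1 := congrArg Subtype.val
      ((finSuccAboveEquiv (σ j)).apply_symm_apply (σ.subtypeEquiv (p := fun x => x ≠ j)
        (q := fun x => x ≠ σ j) (fun a => by simp) (finSuccAboveEquiv j i)))
    exact h1
  refine Lp.ext ?_
  filter_upwards [permute_ae σ (insertAt hh j v), (measurePreserving_perm Y σ).quasiMeasurePreserving.ae
    (insertAt_ae hh j v), insertAt_ae hh (σ j) v, ae_removeNth (σ j) (sector_ae hv τ)]
    with p h1 h2 h3 h4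
  rw [h1, h2, h3, ← h4]
  simp only [Function.comp_def, hτ']

theorem insertAt_eq_permute {h : Y → ℂ} (hh : MemLp h 2) (j : Fin (m + 1))
    {v : Lp ℂ 2 (volume : Measure (Fin m → Y))} (hv : v ∈ sector Y m) :
    insertAt hh j v = permute (Equiv.swap 0 j) (insertAt hh 0 v) := by
  rw [permute_insertAt hh 0 _ hv, Equiv.swap_apply_left]

/-- By symmetry of `u` and `v` every slot is equivalent to slot zero, where the contraction is by
definition the adjoint. -/
theorem inner_insertAt {h : Y → ℂ} (hh : MemLp h 2) (j : Fin (m + 1))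
    {v : Lp ℂ 2 (volume : Measure (Fin m → Y))} (hv : v ∈ sector Y m)
    {u : Lp ℂ 2 (volume : Measure (Fin (m + 1) → Y))} (hu : u ∈ sector Y (m + 1)) :
    (inner ℂ (insertAt hh j v) u : ℂ) = inner ℂ v (contract hh u) := by
  rw [insertAt_eq_permute hh j hv]
  nth_rw 1 [← mem_sector_iff.1 hu (Equiv.swap 0 j)]
  rw [LinearIsometry.inner_map_map, contract, ContinuousLinearMap.adjoint_inner_right]

theorem sum_insertAt_mem {h : Y → ℂ} (hh : MemLp h 2)
    {v : Lp ℂ 2 (volume : Measure (Fin m → Y))} (hv : v ∈ sector Y m) :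
    ∑ j, insertAt hh j v ∈ sector Y (m + 1) := by
  refine mem_sector_iff.2 fun σ => ?_
  rw [map_sum, ← Equiv.sum_comp σ fun j => insertAt hh j v]
  exact Finset.sum_congr rfl fun j _ => permute_insertAt hh j σ hv

theorem contract_mem {h : Y → ℂ} (hh : MemLp h 2)
    {u : Lp ℂ 2 (volume : Measure (Fin (m + 1) → Y))} (hu : u ∈ sector Y (m + 1)) :
    contract hh u ∈ sector Y m := by
  refine mem_sector_iff.2 fun τ => ?_
  refine Lp.ext ?_
  filter_upwards [permute_ae τ (contract hh u), (measurePreserving_perm Y τ).quasiMeasurePreserving.ae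
    (contract_ae hh u), contract_ae hh u,
    -- This is the extension of `τ` to `m + 1` labels that fixes the label zero of the integrated
    -- variable.
    ae_ae_cons (sector_ae hu (Equiv.Perm.decomposeFin.symm (0, τ)))] with p h1 h2 h3 h4
  rw [h1, h2.2, h3.2]
  refine integral_congr_ae ?_
  filter_upwards [h4] with y hy
  rw [← hy]
  congr 2
  funext i
  refine Fin.cases ?_ (fun i => ?_) i
  · simp
  · simp

end Sectors

/-! ### Creation and annihilation operators: closedness and mutual adjointness -/

section FockOperators

variable {Y : Type} [MeasureSpace Y] [SigmaFinite (volume : Measure Y)]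

/-- The `m`-particle component of a Fock vector in `L²(Yᵐ)`. -/
abbrev component (φ : Fock Y) (m : ℕ) : Lp ℂ 2 (volume : Measure (Fin m → Y)) :=
  ((φ m : sector Y m) : Lp ℂ 2 (volume : Measure (Fin m → Y)))

theorem component_mem (φ : Fock Y) (m : ℕ) : component φ m ∈ sector Y m := (φ m).2

theorem hasSum_norm_sq_component (φ : Fock Y) :
    HasSum (fun m => ‖component φ m‖ ^ 2) (‖φ‖ ^ 2) := by
  have h := Complex.hasSum_re (lp.hasSum_inner (𝕜 := ℂ) φ φ)
  simp only [inner_self_eq_norm_sq_to_K, Complex.coe_algebraMap] at h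
  exact_mod_cast h

theorem hasSum_inner_component (φ χ : Fock Y) :
    HasSum (fun m => (inner ℂ (component φ m) (component χ m) : ℂ)) (inner ℂ φ χ) :=
  lp.hasSum_inner (𝕜 := ℂ) φ χ

theorem continuous_component (m : ℕ) : Continuous fun φ : Fock Y => component φ m := by
  have : LipschitzWith 1 fun φ : Fock Y => component φ m := by
    refine LipschitzWith.of_dist_le_mul fun φ χ => ?_
    rw [dist_eq_norm, dist_eq_norm, NNReal.coe_one, one_mul]
    exact lp.norm_apply_le_norm two_ne_zero (φ - χ) m
  exact this.continuous

theorem exists_fock (f : ∀ m, Lp ℂ 2 (volume : Measure (Fin m → Y))) (hf : ∀ m, f m ∈ sector Y m)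
    {b : ℕ → ℝ} {B : ℝ} (hb : HasSum b B) (h : ∀ m, ‖f m‖ ^ 2 ≤ b m) :
    ∃ φ : Fock Y, (∀ m, component φ m = f m) ∧ ‖φ‖ ^ 2 ≤ B := by
  have hs : Summable fun m => ‖f m‖ ^ 2 :=
    Summable.of_nonneg_of_le (fun m => sq_nonneg _) h hb.summable
  have hm : Memℓp (fun m => (⟨f m, hf m⟩ : sector Y m)) 2 := by
    refine memℓp_gen ?_
    refine hs.congr fun m => ?_
    rw [ENNReal.toReal_ofNat, Real.rpow_two]
    rfl
  have e : ∀ m, component (⟨_, hm⟩ : Fock Y) m = f m := fun m => rfl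
  refine ⟨⟨_, hm⟩, e, hasSum_le (fun m => ?_) (hasSum_norm_sq_component _) hb⟩
  rw [e]
  exact h m

theorem mem_annihilationGraph_iff {h : Y → ℂ} (hh : MemLp h 2) {φ χ : Fock Y} :
    (φ, χ) ∈ annihilationGraph h ↔
      ∀ m, component χ m = (√((m : ℝ) + 1) : ℂ) • contract hh (component φ (m + 1)) := by
  refine forall_congr' fun m => ⟨fun H => Lp.ext ?_, fun H => ?_⟩
  · filter_upwards [H, contract_ae hh (component φ (m + 1)),
      Lp.coeFn_smul (√((m : ℝ) + 1) : ℂ) (contract hh (component φ (m + 1)))] with p h1 h2 h3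
    rw [h3, Pi.smul_apply, h2.2]
    exact h1.2
  · filter_upwards [contract_ae hh (component φ (m + 1)),
      Lp.coeFn_smul (√((m : ℝ) + 1) : ℂ) (contract hh (component φ (m + 1)))] with p h2 h3
    refine ⟨h2.1, ?_⟩
    change component χ m p = _
    rw [H, h3, Pi.smul_apply, h2.2]
    rfl

theorem mem_creationGraph_iff {h : Y → ℂ} (hh : MemLp h 2) {φ χ : Fock Y} :
    (φ, χ) ∈ creationGraph h ↔ component χ 0 = 0 ∧
      ∀ m, component χ (m + 1) =
        (√((m : ℝ) + 1) : ℂ)⁻¹ • ∑ j, insertAt hh j (component φ m) := by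
  refine and_congr ?_ (forall_congr' fun m => ?_)
  · rw [Lp.eq_zero_iff_ae_eq_zero]
    rfl
  · have e : ((√((m : ℝ) + 1) : ℂ)⁻¹ • ∑ j, insertAt hh j (component φ m) :
        Lp ℂ 2 (volume : Measure (Fin (m + 1) → Y))) =ᵐ[volume] fun p =>
        (√((m : ℝ) + 1) : ℂ)⁻¹ * ∑ j : Fin (m + 1), h (p j) *
          component φ m (fun i => p (j.succAbove i)) := by
      filter_upwards [Lp.coeFn_smul (√((m : ℝ) + 1) : ℂ)⁻¹ (∑ j, insertAt hh j (component φ m)),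
        Lp.coeFn_finsetSum Finset.univ fun j => insertAt hh j (component φ m),
        ae_all_iff.2 fun j => insertAt_ae hh j (component φ m)] with p h1 h2 h3
      rw [h1, Pi.smul_apply, h2, Finset.sum_apply, smul_eq_mul]
      congr 1
      exact Finset.sum_congr rfl fun j _ => h3 j
    refine ⟨fun H => Lp.ext ?_, fun H => ?_⟩
    · have H' : component χ (m + 1) =ᵐ[volume] _ := H
      exact H'.trans e.symm
    · change component χ (m + 1) =ᵐ[volume] _
      rw [H]
      exact e

theorem isClosed_annihilationGraph {h : Y → ℂ} (hh : MemLp h 2) :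
    IsClosed (annihilationGraph h : Set (Fock Y × Fock Y)) := by
  have e : (annihilationGraph h : Set (Fock Y × Fock Y)) =
      ⋂ m, {x | component x.2 m = (√((m : ℝ) + 1) : ℂ) • contract hh (component x.1 (m + 1))} := by
    ext x
    rw [Set.mem_iInter]
    exact mem_annihilationGraph_iff hh
  rw [e]
  refine isClosed_iInter fun m => isClosed_eq ((continuous_component m).comp continuous_snd) ?_
  have c : Continuous fun x : Fock Y × Fock Y => contract hh (component x.1 (m + 1)) :=
    (contract hh).continuous.comp ((continuous_component (m + 1)).comp continuous_fst)
  exact c.const_smul (√((m : ℝ) + 1) : ℂ)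

theorem isClosed_creationGraph {h : Y → ℂ} (hh : MemLp h 2) :
    IsClosed (creationGraph h : Set (Fock Y × Fock Y)) := by
  have e : (creationGraph h : Set (Fock Y × Fock Y)) =
      {x | component x.2 0 = 0} ∩ ⋂ m, {x | component x.2 (m + 1) =
        (√((m : ℝ) + 1) : ℂ)⁻¹ • ∑ j, insertAt hh j (component x.1 m)} := by
    ext x
    rw [Set.mem_inter_iff, Set.mem_iInter]
    exact mem_creationGraph_iff hh
  rw [e]
  refine (isClosed_eq ((continuous_component 0).comp continuous_snd) continuous_const).inter
    (isClosed_iInter fun m => isClosed_eq ((continuous_component (m + 1)).comp continuous_snd) ?_)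
  have c : Continuous fun x : Fock Y × Fock Y => ∑ j, insertAt hh j (component x.1 m) :=
    continuous_finsetSum _ fun j _ => (insertAt hh j).continuous.comp
      ((continuous_component m).comp continuous_fst)
  exact c.const_smul (√((m : ℝ) + 1) : ℂ)⁻¹

theorem inner_annihilation_creation {h : Y → ℂ} (hh : MemLp h 2) {φ χ η θ : Fock Y}
    (h1 : (φ, χ) ∈ annihilationGraph h) (h2 : (η, θ) ∈ creationGraph h) :
    (inner ℂ χ η : ℂ) = inner ℂ φ θ := by
  rw [mem_annihilationGraph_iff hh] at h1
  rw [mem_creationGraph_iff hh] at h2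
  have s1 := hasSum_inner_component χ η
  have s2 := hasSum_inner_component φ θ
  -- The vacuum component of a created vector is zero, so the sum for creation may be shifted by one
  -- to match that for annihilation. In each sector `m + 1` equal terms with weight `(m+1)^(-1/2)`
  -- make up the factor `√(m+1)`.
  rw [← hasSum_nat_add_iff' 1] at s2
  simp only [Finset.range_one, Finset.sum_singleton, h2.1, inner_zero_right, sub_zero] at s2
  refine s1.unique (s2.congr_fun fun m => ?_)
  rw [h1 m, h2.2 m, inner_smul_right, inner_smul_left, inner_sum]
  have e : ∀ j, (inner ℂ (component φ (m + 1)) (insertAt hh j (component η m)) : ℂ) =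
      inner ℂ (contract hh (component φ (m + 1))) (component η m) := fun j => by
    rw [← inner_conj_symm, inner_insertAt hh j (component_mem η m) (component_mem φ (m + 1)),
      inner_conj_symm]
  simp only [e, Finset.sum_const, Finset.card_univ, Fintype.card_fin, nsmul_eq_mul]
  rw [Complex.conj_ofReal, ← mul_assoc]
  congr 1
  have h0 : (√((m : ℝ) + 1) : ℂ) ≠ 0 := by
    rw [Complex.ofReal_ne_zero]
    positivity
  rw [eq_inv_mul_iff_mul_eq₀ h0, ← Complex.ofReal_mul, Real.mul_self_sqrt (by positivity)]
  push_cast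
  ring

end FockOperators

/-- The graph of a symmetric nonnegative operator with a dense set of vectors on which it is
bounded: those `u 0` for which the iterates `u j = (R - B)ʲ u 0` exist and satisfy
`‖u j‖ ≤ C Rʲ`. -/
structure TruncatableGraph {F : Type*} [NormedAddCommGroup F] [InnerProductSpace ℂ F]
    (B : Submodule ℂ (F × F)) : Prop where
  symm : ∀ x ∈ B, ∀ y ∈ B, (inner ℂ x.1 y.2 : ℂ) = inner ℂ x.2 y.1
  nonneg : ∀ x ∈ B, 0 ≤ (inner ℂ x.1 x.2 : ℂ).re
  dense : ∀ w : F, (∀ R : ℝ, 0 < R → ∀ u : ℕ → F, (∃ C : ℝ, ∀ j, ‖u j‖ ≤ C * R ^ j) →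
    (∀ j, (u j, (R : ℂ) • u j - u (j + 1)) ∈ B) → (inner ℂ (u 0) w : ℂ) = 0) → w = 0

/-! ### Second quantization and energy bounds for creation and annihilation -/

section SecondQuantization

variable {Y : Type} [MeasureSpace Y] [SigmaFinite (volume : Measure Y)] {w : Y → ℝ}

theorem secondQuantization_symm {x y : Fock Y × Fock Y} (hx : x ∈ secondQuantizationGraph w)
    (hy : y ∈ secondQuantizationGraph w) : (inner ℂ x.1 y.2 : ℂ) = inner ℂ x.2 y.1 := by
  refine (hasSum_inner_component x.1 y.2).unique
    ((hasSum_inner_component x.2 y.1).congr_fun fun m => ?_)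
  rw [inner_eq_integral_of_ae (ae_eq_refl _) (hy m), inner_eq_integral_of_ae (hx m) (ae_eq_refl _)]
  refine integral_congr_ae (Eventually.of_forall fun p => ?_)
  simp only [map_mul, Complex.conj_ofReal]
  change conj (component x.1 m p) * (_ * component y.1 m p) =
    _ * conj (component x.1 m p) * component y.1 m p
  ring

theorem energy_eq {φ χ : Fock Y} (h : (φ, χ) ∈ secondQuantizationGraph w) (m : ℕ) :
    Integrable (fun p : Fin m → Y => (∑ j, w (p j)) * ‖component φ m p‖ ^ 2) ∧
      ∫ p : Fin m → Y, (∑ j, w (p j)) * ‖component φ m p‖ ^ 2 =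
        (inner ℂ (component φ m) (component χ m) : ℂ).re := by
  have e : (fun p => (inner ℂ (component φ m p) (component χ m p) : ℂ)) =ᵐ[volume]
      fun p : Fin m → Y => (((∑ j, w (p j)) * ‖component φ m p‖ ^ 2 : ℝ) : ℂ) := by
    filter_upwards [h m] with p hp
    have hp' : component χ m p = ((∑ j, w (p j) : ℝ) : ℂ) * component φ m p := hp
    rw [hp', RCLike.inner_apply]
    push_cast
    rw [← Complex.mul_conj']
    ring
  have i1 : Integrable (fun p : Fin m → Y => (((∑ j, w (p j)) * ‖component φ m p‖ ^ 2 : ℝ) : ℂ)) :=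
    (L2.integrable_inner (𝕜 := ℂ) (component φ m) (component χ m)).congr e
  refine ⟨i1.re.congr (Eventually.of_forall fun p => Complex.ofReal_re _), ?_⟩
  rw [L2.inner_def, integral_congr_ae e, integral_complex_ofReal, Complex.ofReal_re]

theorem hasSum_energy {φ χ : Fock Y} (h : (φ, χ) ∈ secondQuantizationGraph w) :
    HasSum (fun m => ∫ p : Fin m → Y, (∑ j, w (p j)) * ‖component φ m p‖ ^ 2)
      (inner ℂ φ χ : ℂ).re := by
  simp only [(energy_eq h _).2]
  exact Complex.hasSum_re (hasSum_inner_component φ χ)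

theorem secondQuantization_nonneg (hw : ∀ y, 0 ≤ w y) {x : Fock Y × Fock Y}
    (hx : x ∈ secondQuantizationGraph w) : 0 ≤ (inner ℂ x.1 x.2 : ℂ).re :=
  (hasSum_energy (φ := x.1) (χ := x.2) hx).nonneg fun _ => integral_nonneg fun _ =>
    mul_nonneg (Finset.sum_nonneg fun _ _ => hw _) (sq_nonneg _)

/-- Bounded Borel functions of `dΓ(w)`. -/
theorem exists_functionalCalculus (hw : Measurable w) (hw0 : ∀ y, 0 ≤ w y) {g : ℝ → ℂ}
    (hg : Measurable g) {C : ℝ} (hC0 : 0 ≤ C) (hC : ∀ t, 0 ≤ t → ‖g t‖ ≤ C) (φ : Fock Y) :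
    ∃ u : Fock Y, (∀ m, component u m =ᵐ[volume] fun p => g (∑ j, w (p j)) * component φ m p) ∧
      ‖u‖ ≤ C * ‖φ‖ := by
  have hE (m : ℕ) : Measurable fun p : Fin m → Y => ∑ j, w (p j) :=
    Finset.measurable_sum _ fun j _ => hw.comp (measurable_pi_apply j)
  have hb (m : ℕ) (p : Fin m → Y) : ‖g (∑ j, w (p j)) * component φ m p‖ ≤
      C * ‖component φ m p‖ := by
    rw [norm_mul]
    exact mul_le_mul_of_nonneg_right (hC _ (Finset.sum_nonneg fun j _ => hw0 _)) (norm_nonneg _)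
  have hL (m : ℕ) : MemLp (fun p => g (∑ j, w (p j)) * component φ m p) 2 :=
    (Lp.memLp (component φ m)).of_le_mul
      ((hg.comp (hE m)).aestronglyMeasurable.mul (Lp.aestronglyMeasurable _))
      (Eventually.of_forall (hb m))
  have hS (m : ℕ) : (hL m).toLp _ ∈ sector Y m := by
    refine mem_sector_iff.2 fun σ => Lp.ext ?_
    filter_upwards [permute_ae σ ((hL m).toLp _), (hL m).coeFn_toLp,
      (measurePreserving_perm Y σ).quasiMeasurePreserving.ae (hL m).coeFn_toLp,
      sector_ae (component_mem φ m) σ] with p h1 h2 h3 h4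
    rw [h1, h2, h3, h4]
    congr 2
    exact Equiv.sum_comp σ fun j => w (p j)
  have hN (m : ℕ) : ‖(hL m).toLp _‖ ^ 2 ≤ C ^ 2 * ‖component φ m‖ ^ 2 := by
    rw [← mul_pow]
    refine pow_le_pow_left₀ (norm_nonneg _) (Lp.norm_le_mul_norm_of_ae_le_mul ?_) 2
    filter_upwards [(hL m).coeFn_toLp] with p hp
    rw [hp]
    exact hb m p
  obtain ⟨u, hu, hn⟩ := exists_fock (fun m => (hL m).toLp _) hS
    ((hasSum_norm_sq_component φ).mul_left (C ^ 2)) hN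
  refine ⟨u, fun m => by rw [hu]; exact (hL m).coeFn_toLp, ?_⟩
  rw [← mul_pow] at hn
  exact le_of_sq_le_sq hn (by positivity)

/-- The iterates are `(R - dΓ(w))ʲ` applied to the spectral truncation of `φ` to energies at most
`R`; there `0 ≤ R - dΓ(w) ≤ R`. -/
theorem exists_truncation (hw : Measurable w) (hw0 : ∀ y, 0 ≤ w y) {R : ℝ} (hR : 0 < R)
    (φ : Fock Y) : ∃ u : ℕ → Fock Y,
      (∀ m, component (u 0) m =ᵐ[volume] fun p =>
        (if ∑ j, w (p j) ≤ R then 1 else 0) * component φ m p) ∧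
      (∃ C : ℝ, ∀ j, ‖u j‖ ≤ C * R ^ j) ∧
      ∀ j, (u j, (R : ℂ) • u j - u (j + 1)) ∈ secondQuantizationGraph w := by
  have h (j : ℕ) := exists_functionalCalculus hw hw0
    (g := fun t => if t ≤ R then ((R - t : ℝ) : ℂ) ^ j else 0) (C := R ^ j)
    (Measurable.ite measurableSet_Iic (by fun_prop) measurable_const) (by positivity)
    (fun t ht => by
      split_ifs with htR
      · rw [norm_pow, Complex.norm_real]
        refine pow_le_pow_left₀ (norm_nonneg _) ?_ j
        rw [Real.norm_eq_abs, abs_of_nonneg (by linarith)]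
        linarith
      · rw [norm_zero]
        positivity) φ
  choose u hu hn using h
  refine ⟨u, fun m => by simpa using hu 0 m, ⟨‖φ‖, fun j => ?_⟩, fun j m => ?_⟩
  · rw [mul_comm]
    exact hn j
  · have e1 : component ((R : ℂ) • u j - u (j + 1)) m =
        (R : ℂ) • component (u j) m - component (u (j + 1)) m := rfl
    change component ((R : ℂ) • u j - u (j + 1)) m =ᵐ[volume] fun p =>
      ((∑ j, w (p j) : ℝ) : ℂ) * component (u j) m p
    rw [e1]
    filter_upwards [Lp.coeFn_sub ((R : ℂ) • component (u j) m) (component (u (j + 1)) m),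
      Lp.coeFn_smul (R : ℂ) (component (u j) m), hu j m, hu (j + 1) m] with p h1 h2 h3 h4
    rw [h1, Pi.sub_apply, h2, Pi.smul_apply, h3, h4, smul_eq_mul]
    split_ifs
    · push_cast
      ring
    · ring

theorem truncatableGraph_secondQuantization (hw : Measurable w) (hw0 : ∀ y, 0 ≤ w y) :
    TruncatableGraph (secondQuantizationGraph w) := by
  refine ⟨fun x hx y hy => secondQuantization_symm hx hy,
    fun x hx => secondQuantization_nonneg hw0 hx, fun χ hχ => fock_eq_zero fun m => ?_⟩
  -- Testing `χ` with its own truncation gives the squared norm of the truncation, which must vanish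
  -- at every energy cutoff.
  have key (N : ℕ) : ∀ᵐ p : Fin m → Y, ∑ j, w (p j) ≤ (N + 1 : ℝ) → component χ m p = 0 := by
    obtain ⟨u, h0, hC, hB⟩ := exists_truncation hw hw0 (R := N + 1) (by positivity) χ
    have h1 := hχ _ (by positivity) u hC hB
    have h2 := Complex.hasSum_re (hasSum_inner_component (u 0) χ)
    rw [h1, Complex.zero_re] at h2
    have e (m : ℕ) : (inner ℂ (component (u 0) m) (component χ m) : ℂ).re =
        ‖component (u 0) m‖ ^ 2 := by
      rw [norm_sq_eq_integral, inner_eq_integral_of_ae (h0 m) (ae_eq_refl _)]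
      have e' : (fun p : Fin m → Y => conj ((if ∑ j, w (p j) ≤ (N + 1 : ℝ) then 1 else 0) *
          component χ m p) * component χ m p) =ᵐ[volume]
          fun p => ((‖component (u 0) m p‖ ^ 2 : ℝ) : ℂ) := by
        filter_upwards [h0 m] with p hp
        rw [hp]
        split_ifs
        · rw [one_mul, Complex.conj_mul', Complex.ofReal_pow]
        · simp
      rw [integral_congr_ae e', integral_complex_ofReal, Complex.ofReal_re]
    simp only [e] at h2
    have h3 := (hasSum_zero_iff_of_nonneg fun m => sq_nonneg _).1 h2
    have h4 : component (u 0) m = 0 := by simpa using congrFun h3 m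
    filter_upwards [h0 m, (Lp.eq_zero_iff_ae_eq_zero).1 h4] with p h5 h6 h7
    rw [h5, if_pos h7, one_mul] at h6
    exact h6
  filter_upwards [ae_all_iff.2 key] with p hp
  exact hp ⌈∑ j, w (p j)⌉₊ ((Nat.le_ceil _).trans (by linarith))

theorem integral_comp_measurePreserving {α β : Type*} [MeasurableSpace α] [MeasurableSpace β]
    {μ : Measure α} {ν : Measure β} {g : α → β} (hg : MeasurePreserving g μ ν) {f : β → ℝ}
    (hf : AEStronglyMeasurable f ν) : ∫ x, f (g x) ∂μ = ∫ x, f x ∂ν := by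
  rw [← hg.map_eq] at hf ⊢
  exact (integral_map hg.measurable.aemeasurable hf).symm

/-- Each of the `m + 1` bosons carries the same share of the energy, by symmetry of the wave
function. -/
theorem integral_energy_eq {m : ℕ} {u : Lp ℂ 2 (volume : Measure (Fin (m + 1) → Y))}
    (hu : u ∈ sector Y (m + 1)) (hw : Measurable w) (hw0 : ∀ y, 0 ≤ w y)
    (hi : Integrable fun p : Fin (m + 1) → Y => (∑ j, w (p j)) * ‖u p‖ ^ 2) :
    Integrable (fun p : Fin (m + 1) → Y => w (p 0) * ‖u p‖ ^ 2) ∧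
      (m + 1 : ℝ) * ∫ p, w (p 0) * ‖u p‖ ^ 2 =
        ∫ p : Fin (m + 1) → Y, (∑ j, w (p j)) * ‖u p‖ ^ 2 := by
  have hm (j : Fin (m + 1)) :
      AEStronglyMeasurable (fun p : Fin (m + 1) → Y => w (p j) * ‖u p‖ ^ 2) :=
    (hw.comp (measurable_pi_apply j)).aestronglyMeasurable.mul
      ((Lp.aestronglyMeasurable u).norm.pow 2)
  have h1 (j : Fin (m + 1)) :
      Integrable (fun p : Fin (m + 1) → Y => w (p j) * ‖u p‖ ^ 2) := by
    refine hi.mono' (hm j) (Eventually.of_forall fun p => ?_)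
    rw [Real.norm_of_nonneg (mul_nonneg (hw0 _) (sq_nonneg _))]
    exact mul_le_mul_of_nonneg_right (Finset.single_le_sum (f := fun j => w (p j))
      (fun i _ => hw0 _) (Finset.mem_univ j)) (sq_nonneg _)
  refine ⟨h1 0, ?_⟩
  simp only [Finset.sum_mul]
  rw [integral_finsetSum _ fun j _ => h1 j]
  have e (j : Fin (m + 1)) : ∫ p : Fin (m + 1) → Y, w (p j) * ‖u p‖ ^ 2 =
      ∫ p : Fin (m + 1) → Y, w (p 0) * ‖u p‖ ^ 2 := by
    have hσ := measurePreserving_perm Y (Equiv.swap 0 j)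
    rw [← integral_comp_measurePreserving hσ (hm 0)]
    refine integral_congr_ae ?_
    filter_upwards [sector_ae hu (Equiv.swap 0 j)] with p hp
    rw [hp]
    simp
  simp only [e, Finset.sum_const, Finset.card_univ, Fintype.card_fin, nsmul_eq_mul]
  push_cast
  ring

theorem norm_sq_contract_le {m : ℕ} {u : Lp ℂ 2 (volume : Measure (Fin (m + 1) → Y))}
    (hu : u ∈ sector Y (m + 1)) (hw : Measurable w) (hw0 : ∀ y, 0 ≤ w y)
    (hi : Integrable fun p : Fin (m + 1) → Y => (∑ j, w (p j)) * ‖u p‖ ^ 2)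
    {h k : Y → ℂ} (hh : MemLp h 2) (hk : MemLp k 2) (hhk : ∀ y, h y = (√(w y) : ℂ) * k y) :
    (m + 1 : ℝ) * ‖contract hh u‖ ^ 2 ≤
      (∫ y, ‖k y‖ ^ 2) * ∫ p : Fin (m + 1) → Y, (∑ j, w (p j)) * ‖u p‖ ^ 2 := by
  obtain ⟨i0, e0⟩ := integral_energy_eq hu hw hw0 hi
  have hn (p : Fin (m + 1) → Y) : ‖(√(w (p 0)) : ℂ) * u p‖ ^ 2 = w (p 0) * ‖u p‖ ^ 2 := by
    rw [norm_mul, Complex.norm_real, mul_pow, Real.norm_eq_abs, sq_abs, Real.sq_sqrt (hw0 _)]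
  have hm : AEStronglyMeasurable (fun p : Fin (m + 1) → Y => (√(w (p 0)) : ℂ) * u p) := by
    refine AEStronglyMeasurable.mul ?_ (Lp.aestronglyMeasurable u)
    have : Measurable fun p : Fin (m + 1) → Y => (√(w (p 0)) : ℂ) := by fun_prop
    exact this.aestronglyMeasurable
  have hv : MemLp (fun p : Fin (m + 1) → Y => (√(w (p 0)) : ℂ) * u p) 2 := by
    rw [memLp_two_iff_integrable_sq_norm hm]
    simpa only [hn] using i0
  set v := hv.toLp _ with hv'
  have nv : ‖v‖ ^ 2 = ∫ p : Fin (m + 1) → Y, w (p 0) * ‖u p‖ ^ 2 := by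
    rw [norm_sq_eq_integral]
    refine integral_congr_ae ?_
    filter_upwards [hv.coeFn_toLp] with p hp
    rw [hp, hn]
  set c := contract hh u with hc
  -- With `c = contract h u`, move the weight `√w` from `h = √w k` to `u`: `⟨c, c⟩ = ⟨h ⊗ c, u⟩ = ⟨k
  -- ⊗ c, √w u⟩`. Then Cauchy–Schwarz and one cancellation of `‖c‖²` give the bound.
  have h1 : (inner ℂ c c : ℂ) = inner ℂ (insertAt hk 0 c) v := by
    nth_rw 2 [hc]
    rw [contract, ContinuousLinearMap.adjoint_inner_right, inner_eq_integral_of_ae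
      (insertAt_ae hh 0 c) (ae_eq_refl _), inner_eq_integral_of_ae (insertAt_ae hk 0 c)
      hv.coeFn_toLp]
    refine integral_congr_ae (Eventually.of_forall fun p => ?_)
    simp only [hhk, map_mul, Complex.conj_ofReal]
    ring
  have h2 : ‖c‖ ^ 2 ≤ ‖insertAt hk 0 c‖ * ‖v‖ := by
    have h3 := norm_inner_le_norm (𝕜 := ℂ) (insertAt hk 0 c) v
    rw [← h1, inner_self_eq_norm_sq_to_K] at h3
    simpa using h3
  have h4 : (‖c‖ ^ 2) ^ 2 ≤ (∫ y, ‖k y‖ ^ 2) * ‖c‖ ^ 2 * ‖v‖ ^ 2 := by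
    rw [← norm_sq_insertAt hk 0 c, ← mul_pow]
    exact pow_le_pow_left₀ (sq_nonneg _) h2 2
  have hK : 0 ≤ ∫ y, ‖k y‖ ^ 2 := integral_nonneg fun _ => sq_nonneg _
  have h5 : ‖c‖ ^ 2 ≤ (∫ y, ‖k y‖ ^ 2) * ‖v‖ ^ 2 := by
    rcases (sq_nonneg ‖c‖).eq_or_lt with h0 | h0
    · rw [← h0]
      positivity
    · refine le_of_mul_le_mul_right ?_ h0
      linarith
  rw [← e0, ← nv]
  have := mul_le_mul_of_nonneg_left h5 (by positivity : (0 : ℝ) ≤ m + 1)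
  linarith

/-- A direct estimate that needs no commutation relation. Pointwise Cauchy–Schwarz with weights
`√w(pⱼ)` produces the total energy `∑ w(pᵢ)` times `∑ⱼ |k(pⱼ)|² |v|²`. In the `j`-th term the
summand `w(pⱼ)` turns `|k|²` into `|h|²`, and the others form the energy of `v`. -/
theorem norm_sq_sum_insertAt_le {m : ℕ} {v : Lp ℂ 2 (volume : Measure (Fin m → Y))}
    (hw0 : ∀ y, 0 ≤ w y) (hi : Integrable fun p : Fin m → Y => (∑ j, w (p j)) * ‖v p‖ ^ 2)
    {h k : Y → ℂ} (hh : MemLp h 2) (hk : MemLp k 2) (hhk : ∀ y, h y = (√(w y) : ℂ) * k y) :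
    ‖∑ j, insertAt hh j v‖ ^ 2 ≤ (m + 1 : ℝ) * ((∫ y, ‖h y‖ ^ 2) * ‖v‖ ^ 2 +
      (∫ y, ‖k y‖ ^ 2) * ∫ p : Fin m → Y, (∑ j, w (p j)) * ‖v p‖ ^ 2) := by
  have hn (y : Y) : ‖h y‖ ^ 2 = w y * ‖k y‖ ^ 2 := by
    rw [hhk, norm_mul, Complex.norm_real, mul_pow, Real.norm_eq_abs, sq_abs, Real.sq_sqrt (hw0 _)]
  have ih : Integrable fun y => ‖h y‖ ^ 2 := hh.integrable_norm_pow (by norm_num)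
  have ik : Integrable fun y => ‖k y‖ ^ 2 := hk.integrable_norm_pow (by norm_num)
  have iv : Integrable fun p => ‖v p‖ ^ 2 := (Lp.memLp v).integrable_norm_pow (by norm_num)
  have i1 (j : Fin (m + 1)) := integrable_split ih iv j
  have i2 (j : Fin (m + 1)) := integrable_split ik hi j
  have i3 (j : Fin (m + 1)) : Integrable fun p : Fin (m + 1) → Y =>
      ‖h (p j)‖ ^ 2 * ‖v (fun i => p (j.succAbove i))‖ ^ 2 + ‖k (p j)‖ ^ 2 *
        ((∑ i, w (p (j.succAbove i))) * ‖v (fun i => p (j.succAbove i))‖ ^ 2) := (i1 j).add (i2 j)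
  have hint : (m + 1 : ℝ) * ((∫ y, ‖h y‖ ^ 2) * ‖v‖ ^ 2 +
      (∫ y, ‖k y‖ ^ 2) * ∫ p : Fin m → Y, (∑ j, w (p j)) * ‖v p‖ ^ 2) =
      ∫ p : Fin (m + 1) → Y, ∑ j, (‖h (p j)‖ ^ 2 * ‖v (fun i => p (j.succAbove i))‖ ^ 2 +
        ‖k (p j)‖ ^ 2 * ((∑ i, w (p (j.succAbove i))) *
          ‖v (fun i => p (j.succAbove i))‖ ^ 2)) := by
    rw [integral_finsetSum _ fun j _ => i3 j]
    have e (j : Fin (m + 1)) := integral_add (i1 j) (i2 j)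
    simp only [e]
    have e1 (j : Fin (m + 1)) := integral_split (fun y => ‖h y‖ ^ 2) (fun p => ‖v p‖ ^ 2) j
    have e2 (j : Fin (m + 1)) := integral_split (fun y => ‖k y‖ ^ 2)
      (fun p : Fin m → Y => (∑ j, w (p j)) * ‖v p‖ ^ 2) j
    simp only [e1, e2, Finset.sum_const, Finset.card_univ, Fintype.card_fin, nsmul_eq_mul,
      norm_sq_eq_integral v]
    push_cast
    ring
  rw [hint, norm_sq_eq_integral]
  refine integral_mono_of_nonneg (Eventually.of_forall fun p => sq_nonneg _)
    (integrable_finsetSum _ fun j _ => i3 j) ?_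
  filter_upwards [Lp.coeFn_finsetSum Finset.univ fun j => insertAt hh j v,
    ae_all_iff.2 fun j => insertAt_ae hh j v] with p h1 h2
  rw [h1, Finset.sum_apply]
  simp only [h2]
  calc ‖∑ j, h (p j) * v (fun i => p (j.succAbove i))‖ ^ 2
      ≤ (∑ j, √(w (p j)) * (‖k (p j)‖ * ‖v (fun i => p (j.succAbove i))‖)) ^ 2 := by
        refine pow_le_pow_left₀ (norm_nonneg _) ((norm_sum_le _ _).trans_eq ?_) 2
        refine Finset.sum_congr rfl fun j _ => ?_
        rw [norm_mul, hhk, norm_mul, Complex.norm_real, Real.norm_of_nonneg (Real.sqrt_nonneg _),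
          mul_assoc]
    _ ≤ (∑ j, √(w (p j)) ^ 2) * ∑ j, (‖k (p j)‖ * ‖v (fun i => p (j.succAbove i))‖) ^ 2 :=
        Finset.sum_mul_sq_le_sq_mul_sq _ _ _
    _ = _ := by
        rw [Finset.mul_sum]
        refine Finset.sum_congr rfl fun j _ => ?_
        simp only [Real.sq_sqrt (hw0 _)]
        rw [Fin.sum_univ_succAbove (fun i => w (p i)) j, hn]
        ring

theorem exists_annihilation (hw : Measurable w) (hw0 : ∀ y, 0 ≤ w y) {φ χ : Fock Y}
    (H : (φ, χ) ∈ secondQuantizationGraph w)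
    {h k : Y → ℂ} (hh : MemLp h 2) (hk : MemLp k 2) (hhk : ∀ y, h y = (√(w y) : ℂ) * k y) :
    ∃ θ, (φ, θ) ∈ annihilationGraph h ∧
      ‖θ‖ ^ 2 ≤ (∫ y, ‖k y‖ ^ 2) * (inner ℂ φ χ : ℂ).re := by
  have hs := hasSum_energy H
  -- The vacuum carries no energy, so dropping the zeroth term leaves the sum unchanged.
  rw [← hasSum_nat_add_iff' 1] at hs
  simp only [Finset.range_one, Finset.sum_singleton, Finset.univ_eq_empty, Finset.sum_empty,
    zero_mul, integral_zero, sub_zero] at hs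
  obtain ⟨θ, h1, h2⟩ := exists_fock
    (fun m => (√((m : ℝ) + 1) : ℂ) • contract hh (component φ (m + 1)))
    (fun m => Submodule.smul_mem _ _ (contract_mem hh (component_mem φ (m + 1))))
    (hs.mul_left (∫ y, ‖k y‖ ^ 2)) fun m => by
      rw [norm_smul, mul_pow, Complex.norm_real, Real.norm_eq_abs, sq_abs,
        Real.sq_sqrt (by positivity)]
      exact norm_sq_contract_le (component_mem φ (m + 1)) hw hw0 (energy_eq H (m + 1)).1 hh hk hhk
  exact ⟨θ, (mem_annihilationGraph_iff hh).2 h1, h2⟩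

theorem exists_creation (hw0 : ∀ y, 0 ≤ w y) {φ χ : Fock Y}
    (H : (φ, χ) ∈ secondQuantizationGraph w)
    {h k : Y → ℂ} (hh : MemLp h 2) (hk : MemLp k 2) (hhk : ∀ y, h y = (√(w y) : ℂ) * k y) :
    ∃ θ, (φ, θ) ∈ creationGraph h ∧
      ‖θ‖ ^ 2 ≤ (∫ y, ‖h y‖ ^ 2) * ‖φ‖ ^ 2 + (∫ y, ‖k y‖ ^ 2) * (inner ℂ φ χ : ℂ).re := by
  have hs := ((hasSum_norm_sq_component φ).mul_left (∫ y, ‖h y‖ ^ 2)).add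
    ((hasSum_energy H).mul_left (∫ y, ‖k y‖ ^ 2))
  let f : ∀ m, Lp ℂ 2 (volume : Measure (Fin m → Y)) := fun m => match m with
    | 0 => 0
    | m + 1 => (√((m : ℝ) + 1) : ℂ)⁻¹ • ∑ j, insertAt hh j (component φ m)
  let b : ℕ → ℝ := fun m => match m with
    | 0 => 0
    | m + 1 => (∫ y, ‖h y‖ ^ 2) * ‖component φ m‖ ^ 2 +
      (∫ y, ‖k y‖ ^ 2) * ∫ p : Fin m → Y, (∑ j, w (p j)) * ‖component φ m p‖ ^ 2
  have hb : HasSum b ((∫ y, ‖h y‖ ^ 2) * ‖φ‖ ^ 2 + (∫ y, ‖k y‖ ^ 2) * (inner ℂ φ χ : ℂ).re) := by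
    rw [← hasSum_nat_add_iff' 1]
    simpa [b] using hs
  obtain ⟨θ, h1, h2⟩ := exists_fock f (fun m => by
    cases m with
    | zero => exact Submodule.zero_mem _
    | succ m => exact Submodule.smul_mem _ _ (sum_insertAt_mem hh (component_mem φ m))) hb
    (fun m => by
      cases m with
      | zero => simp [f, b]
      | succ m =>
        simp only [f, b]
        rw [norm_smul, mul_pow, norm_inv, Complex.norm_real, inv_pow, Real.norm_eq_abs, sq_abs,
          Real.sq_sqrt (by positivity), inv_mul_le_iff₀ (by positivity)]
        exact norm_sq_sum_insertAt_le hw0 (energy_eq H m).1 hh hk hhk)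
  exact ⟨θ, (mem_creationGraph_iff hh).2 ⟨h1 0, fun m => h1 (m + 1)⟩, h2⟩

theorem sub_mem_annihilationGraph {h h' : Y → ℂ} {φ χ χ' : Fock Y}
    (H : (φ, χ) ∈ annihilationGraph h) (H' : (φ, χ') ∈ annihilationGraph h') :
    (φ, χ - χ') ∈ annihilationGraph (h - h') := fun m => by
  have e : component (χ - χ') m = component χ m - component χ' m := rfl
  filter_upwards [H m, H' m, Lp.coeFn_sub (component χ m) (component χ' m)] with p ⟨i1, e1⟩ ⟨i2, e2⟩ h3
  have e' : (fun y => conj ((h - h') y) * wave φ (m + 1) (Fin.cons y p)) = fun y =>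
      conj (h y) * wave φ (m + 1) (Fin.cons y p) - conj (h' y) * wave φ (m + 1) (Fin.cons y p) := by
    funext y
    rw [Pi.sub_apply, map_sub, sub_mul]
  simp only [e']
  refine ⟨i1.sub i2, ?_⟩
  change component (χ - χ') m p = _
  rw [e, h3, Pi.sub_apply, integral_sub i1 i2, mul_sub]
  exact congrArg₂ _ e1 e2

theorem sub_mem_creationGraph {h h' : Y → ℂ} {φ χ χ' : Fock Y}
    (H : (φ, χ) ∈ creationGraph h) (H' : (φ, χ') ∈ creationGraph h') :
    (φ, χ - χ') ∈ creationGraph (h - h') := by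
  have e (m : ℕ) : component (χ - χ') m = component χ m - component χ' m := rfl
  refine ⟨?_, fun m => ?_⟩
  · filter_upwards [H.1, H'.1, Lp.coeFn_sub (component χ 0) (component χ' 0)] with p h1 h2 h3
    change component (χ - χ') 0 p = 0
    rw [e, h3, Pi.sub_apply]
    exact (congrArg₂ (· - ·) h1 h2).trans (sub_zero 0)
  · filter_upwards [H.2 m, H'.2 m, Lp.coeFn_sub (component χ (m + 1)) (component χ' (m + 1))]
      with p h1 h2 h3
    change component (χ - χ') (m + 1) p = _
    rw [e, h3, Pi.sub_apply]
    refine (congrArg₂ (· - ·) h1 h2).trans ?_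
    simp only [Pi.sub_apply, sub_mul, Finset.sum_sub_distrib, mul_sub]

end SecondQuantization

theorem re_inner_self_eq_norm_sq {E : Type*} [NormedAddCommGroup E] [InnerProductSpace ℂ E] (x : E) :
    (inner ℂ x x : ℂ).re = ‖x‖ ^ 2 := inner_self_eq_norm_sq (𝕜 := ℂ) x

/-! ### Simple tensors and slices in `L²(ν; F)` -/

section Tensor

variable {α : Type*} {mα : MeasurableSpace α} {ν : Measure α} {F : Type*} [NormedAddCommGroup F]
  [InnerProductSpace ℂ F]

/-- The simple tensor `q ↦ f(q) φ`. -/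
def tmul (f : Lp ℂ 2 ν) (φ : F) : Lp F 2 ν := (ContinuousLinearMap.toSpanSingleton ℂ φ).compLp f

theorem tmul_ae (f : Lp ℂ 2 ν) (φ : F) : tmul f φ =ᵐ[ν] fun q => f q • φ :=
  ContinuousLinearMap.coeFn_compLp _ f

theorem tmul_smul_left (c : ℂ) (f : Lp ℂ 2 ν) (φ : F) : tmul (c • f) φ = c • tmul f φ :=
  ((ContinuousLinearMap.toSpanSingleton ℂ φ).compLpₗ 2 ν).map_smul c f

theorem tmul_sub_left (f g : Lp ℂ 2 ν) (φ : F) : tmul (f - g) φ = tmul f φ - tmul g φ :=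
  ((ContinuousLinearMap.toSpanSingleton ℂ φ).compLpₗ 2 ν).map_sub f g

theorem tmul_add_right (f : Lp ℂ 2 ν) (φ χ : F) : tmul f (φ + χ) = tmul f φ + tmul f χ := by
  refine Lp.ext ?_
  filter_upwards [tmul_ae f (φ + χ), tmul_ae f φ, tmul_ae f χ, Lp.coeFn_add (tmul f φ) (tmul f χ)]
    with q h1 h2 h3 h4
  rw [h1, h4, Pi.add_apply, h2, h3, smul_add]

theorem tmul_smul_right (c : ℂ) (f : Lp ℂ 2 ν) (φ : F) : tmul f (c • φ) = c • tmul f φ := by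
  refine Lp.ext ?_
  filter_upwards [tmul_ae f (c • φ), tmul_ae f φ, Lp.coeFn_smul c (tmul f φ)] with q h1 h2 h3
  rw [h1, h3, Pi.smul_apply, h2, smul_comm]

theorem tmul_sub_right (f : Lp ℂ 2 ν) (φ χ : F) : tmul f (φ - χ) = tmul f φ - tmul f χ := by
  rw [sub_eq_add_neg, ← neg_one_smul ℂ χ, tmul_add_right, tmul_smul_right, neg_one_smul,
    ← sub_eq_add_neg]

theorem inner_tmul (f g : Lp ℂ 2 ν) (φ χ : F) :
    (inner ℂ (tmul f φ) (tmul g χ) : ℂ) = inner ℂ f g * inner ℂ φ χ := by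
  rw [L2.inner_def, L2.inner_def, ← integral_mul_const]
  refine integral_congr_ae ?_
  filter_upwards [tmul_ae f φ, tmul_ae g χ] with q h1 h2
  rw [h1, h2, inner_smul_left, inner_smul_right, RCLike.inner_apply]
  ring

theorem norm_tmul (f : Lp ℂ 2 ν) (φ : F) : ‖tmul f φ‖ = ‖f‖ * ‖φ‖ := by
  have h : ‖tmul f φ‖ ^ 2 = (‖f‖ * ‖φ‖) ^ 2 := by
    have := inner_tmul f f φ φ
    simp only [inner_self_eq_norm_sq_to_K] at this
    rw [mul_pow]
    exact_mod_cast this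
  exact (sq_eq_sq₀ (norm_nonneg _) (by positivity)).1 h

/-- `φ ↦ f ⊗ φ`. -/
def tmulRight (f : Lp ℂ 2 ν) : F →L[ℂ] Lp F 2 ν :=
  LinearMap.mkContinuous
    { toFun := tmul f
      map_add' := tmul_add_right f
      map_smul' := fun c φ => tmul_smul_right c f φ } ‖f‖ fun φ => (norm_tmul f φ).le

theorem tmulRight_apply (f : Lp ℂ 2 ν) (φ : F) : tmulRight f φ = tmul f φ := rfl

/-- The slice `q ↦ ⟨χ, Ψ(q)⟩`. -/
def slice (χ : F) : Lp F 2 ν →L[ℂ] Lp ℂ 2 ν := (innerSL ℂ χ).compLpL 2 ν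

theorem slice_ae (χ : F) (Ψ : Lp F 2 ν) : slice χ Ψ =ᵐ[ν] fun q => (inner ℂ χ (Ψ q) : ℂ) :=
  ContinuousLinearMap.coeFn_compLp _ Ψ

theorem slice_tmul (χ : F) (f : Lp ℂ 2 ν) (φ : F) :
    slice χ (tmul f φ) = (inner ℂ χ φ : ℂ) • f := by
  refine Lp.ext ?_
  filter_upwards [slice_ae χ (tmul f φ), tmul_ae f φ, Lp.coeFn_smul (inner ℂ χ φ : ℂ) f]
    with q h1 h2 h3
  rw [h1, h2, h3, inner_smul_right, Pi.smul_apply, smul_eq_mul, mul_comm]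

theorem inner_tmul_left (f : Lp ℂ 2 ν) (φ : F) (Ψ : Lp F 2 ν) :
    (inner ℂ (tmul f φ) Ψ : ℂ) = inner ℂ f (slice φ Ψ) := by
  rw [L2.inner_def, L2.inner_def]
  refine integral_congr_ae ?_
  filter_upwards [tmul_ae f φ, slice_ae φ Ψ] with q h1 h2
  rw [h1, h2, inner_smul_left, RCLike.inner_apply, mul_comm]

/-- Simple tensors are total, since indicators of sets of finite measure times constant vectors
generate `L²`. -/
theorem eq_zero_of_inner_tmul {Ψ : Lp F 2 ν} (h : ∀ f φ, (inner ℂ (tmul f φ) Ψ : ℂ) = 0) :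
    Ψ = 0 := by
  have key : ∀ Φ : Lp F 2 ν, (inner ℂ Φ Ψ : ℂ) = 0 := by
    intro Φ
    refine Lp.induction (p := 2) (by norm_num) (motive := fun Φ => (inner ℂ Φ Ψ : ℂ) = 0)
      ?_ ?_ ?_ Φ
    · intro c s hs hμ
      rw [← h (indicatorConstLp 2 hs hμ.ne (1 : ℂ)) c]
      congr 1
      refine Lp.ext ?_
      rw [Lp.simpleFunc.coe_indicatorConst]
      filter_upwards [indicatorConstLp_coeFn (p := 2) (hs := hs) (hμs := hμ.ne) (c := c),
        indicatorConstLp_coeFn (p := 2) (hs := hs) (hμs := hμ.ne) (c := (1 : ℂ)),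
        tmul_ae (indicatorConstLp 2 hs hμ.ne (1 : ℂ)) c] with q h1 h2 h3
      rw [h1, h3, h2]
      by_cases hq : q ∈ s
      · simp [Set.indicator_of_mem hq]
      · simp [Set.indicator_of_notMem hq]
    · intro f g hf hg _ h1 h2
      rw [inner_add_left, h1, h2, add_zero]
    · exact isClosed_eq (by fun_prop) continuous_const
  exact inner_self_eq_zero.1 (key Ψ)

/-- Parseval's identity over the second factor, for elements of the algebraic tensor product. -/
theorem hasSum_inner_slice {ι : Type*} (b : HilbertBasis ι ℂ F) {Ψ Φ : Lp F 2 ν}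
    (hΨ : Ψ ∈ Submodule.span ℂ (Set.range fun x : Lp ℂ 2 ν × F => tmul x.1 x.2))
    (hΦ : Φ ∈ Submodule.span ℂ (Set.range fun x : Lp ℂ 2 ν × F => tmul x.1 x.2)) :
    HasSum (fun i => (inner ℂ (slice (b i) Ψ) (slice (b i) Φ) : ℂ)) (inner ℂ Ψ Φ) := by
  induction hΨ using Submodule.span_induction with
  | mem Ψ h =>
    obtain ⟨⟨f, φ⟩, rfl⟩ := h
    induction hΦ using Submodule.span_induction with
    | mem Φ h =>
      obtain ⟨⟨g, χ⟩, rfl⟩ := h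
      simp only [slice_tmul, inner_tmul, inner_smul_left, inner_smul_right, inner_conj_symm]
      refine ((b.hasSum_inner_mul_inner φ χ).mul_left (inner ℂ f g : ℂ)).congr_fun fun i => ?_
      ring
    | zero => simp
    | add Φ Φ' _ _ h1 h2 => simpa only [map_add, inner_add_right] using h1.add h2
    | smul c Φ _ h1 => simpa only [map_smul, inner_smul_right] using h1.mul_left c
  | zero => simp
  | add Φ Φ' _ _ h1 h2 => simpa only [map_add, inner_add_left] using h1.add h2
  | smul c Φ _ h1 => simpa only [map_smul, inner_smul_left] using h1.mul_left (conj c)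

end Tensor

/-! ### The operator `A ⊗ 1 + 1 ⊗ B` -/

section Free

variable {α : Type*} {mα : MeasurableSpace α} {ν : Measure α} {F : Type*} [NormedAddCommGroup F]
  [InnerProductSpace ℂ F] {A : Submodule ℂ (Lp ℂ 2 ν × Lp ℂ 2 ν)} {B : Submodule ℂ (F × F)}

/-- The span of the triples `(f ⊗ φ, Af ⊗ φ, f ⊗ Bφ)`. -/
def freeTriples (A : Submodule ℂ (Lp ℂ 2 ν × Lp ℂ 2 ν)) (B : Submodule ℂ (F × F)) :
    Submodule ℂ (Lp F 2 ν × Lp F 2 ν × Lp F 2 ν) :=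
  Submodule.span ℂ (Set.range fun x : A × B =>
    (tmul x.1.1.1 x.2.1.1, tmul x.1.1.2 x.2.1.1, tmul x.1.1.1 x.2.1.2))

theorem mem_freeTriples {x : Lp ℂ 2 ν × Lp ℂ 2 ν} {y : F × F} (hx : x ∈ A) (hy : y ∈ B) :
    (tmul x.1 y.1, tmul x.2 y.1, tmul x.1 y.2) ∈ freeTriples A B :=
  Submodule.subset_span ⟨(⟨x, hx⟩, ⟨y, hy⟩), rfl⟩

/-- A property of elements of `freeTriples A B` that is stable under linear combinations holds if
it holds for the generators. -/
theorem freeTriples_induction {P : Lp F 2 ν × Lp F 2 ν × Lp F 2 ν → Prop}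
    (mem : ∀ x ∈ A, ∀ y ∈ B, P (tmul x.1 y.1, tmul x.2 y.1, tmul x.1 y.2)) (zero : P 0)
    (add : ∀ s t, P s → P t → P (s + t)) (smul : ∀ (c : ℂ) t, P t → P (c • t))
    {t : Lp F 2 ν × Lp F 2 ν × Lp F 2 ν} (ht : t ∈ freeTriples A B) : P t := by
  induction ht using Submodule.span_induction with
  | mem t h =>
    obtain ⟨⟨x, y⟩, rfl⟩ := h
    exact mem _ x.2 _ y.2
  | zero => exact zero
  | add s t _ _ h1 h2 => exact add s t h1 h2
  | smul c t _ h => exact smul c t h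

theorem freeTriples_symm (hA : ∀ x ∈ A, ∀ y ∈ A, (inner ℂ x.1 y.2 : ℂ) = inner ℂ x.2 y.1)
    (hB : ∀ x ∈ B, ∀ y ∈ B, (inner ℂ x.1 y.2 : ℂ) = inner ℂ x.2 y.1)
    {s t : Lp F 2 ν × Lp F 2 ν × Lp F 2 ν} (hs : s ∈ freeTriples A B) (ht : t ∈ freeTriples A B) :
    (inner ℂ s.1 t.2.1 : ℂ) = inner ℂ s.2.1 t.1 ∧
      (inner ℂ s.1 t.2.2 : ℂ) = inner ℂ s.2.2 t.1 := by
  refine freeTriples_induction (P := fun s => (inner ℂ s.1 t.2.1 : ℂ) = inner ℂ s.2.1 t.1 ∧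
      (inner ℂ s.1 t.2.2 : ℂ) = inner ℂ s.2.2 t.1) (fun x hx y hy => ?_) (by simp)
    (fun a b ha hb => ?_) (fun c a ha => ?_) hs
  · refine freeTriples_induction (P := fun t =>
      (inner ℂ (tmul x.1 y.1) t.2.1 : ℂ) = inner ℂ (tmul x.2 y.1) t.1 ∧
      (inner ℂ (tmul x.1 y.1) t.2.2 : ℂ) = inner ℂ (tmul x.1 y.2) t.1)
      (fun x' hx' y' hy' => ?_) (by simp) (fun a b ha hb => ?_) (fun c a ha => ?_) ht
    · simp only [inner_tmul, hA x hx x' hx', hB y hy y' hy', and_self]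
    · simp only [Prod.fst_add, Prod.snd_add, inner_add_right, ha.1, hb.1, ha.2, hb.2, and_self]
    · simp only [Prod.smul_fst, Prod.smul_snd, inner_smul_right, ha.1, ha.2, and_self]
  · simp only [Prod.fst_add, Prod.snd_add, inner_add_left, ha.1, hb.1, ha.2, hb.2, and_self]
  · simp only [Prod.smul_fst, Prod.smul_snd, inner_smul_left, ha.1, ha.2, and_self]

theorem freeTriples_fiber {t : Lp F 2 ν × Lp F 2 ν × Lp F 2 ν} (ht : t ∈ freeTriples A B) :
    ∀ᵐ q ∂ν, (t.1 q, t.2.2 q) ∈ B := by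
  refine freeTriples_induction (P := fun t => ∀ᵐ q ∂ν, (t.1 q, t.2.2 q) ∈ B)
    (fun x _ y hy => ?_) ?_ (fun a b ha hb => ?_) (fun c a ha => ?_) ht
  · filter_upwards [tmul_ae x.1 y.1, tmul_ae x.1 y.2] with q h1 h2
    simp only [h1, h2]
    exact B.smul_mem (x.1 q) hy
  · filter_upwards [Lp.coeFn_zero F 2 ν] with q h1
    simp only [Prod.fst_zero, Prod.snd_zero, h1]
    exact B.zero_mem
  · filter_upwards [ha, hb, Lp.coeFn_add a.1 b.1, Lp.coeFn_add a.2.2 b.2.2] with q h1 h2 h3 h4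
    simp only [Prod.fst_add, Prod.snd_add, h3, h4, Pi.add_apply]
    exact B.add_mem h1 h2
  · filter_upwards [ha, Lp.coeFn_smul c a.1, Lp.coeFn_smul c a.2.2] with q h1 h3 h4
    simp only [Prod.smul_fst, Prod.smul_snd, h3, h4, Pi.smul_apply]
    exact B.smul_mem c h1

theorem freeTriples_slice {t : Lp F 2 ν × Lp F 2 ν × Lp F 2 ν} (ht : t ∈ freeTriples A B)
    (χ : F) : (slice χ t.1, slice χ t.2.1) ∈ A := by
  refine freeTriples_induction (P := fun t => (slice χ t.1, slice χ t.2.1) ∈ A)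
    (fun x hx y _ => ?_) ?_ (fun a b ha hb => ?_) (fun c a ha => ?_) ht
  · simp only [slice_tmul]
    exact A.smul_mem (inner ℂ χ y.1) hx
  · simp only [Prod.fst_zero, Prod.snd_zero, map_zero]
    exact A.zero_mem
  · simp only [Prod.fst_add, Prod.snd_add, map_add]
    exact A.add_mem ha hb
  · simp only [Prod.smul_fst, Prod.smul_snd, map_smul]
    exact A.smul_mem c ha

theorem freeTriples_mem_span {t : Lp F 2 ν × Lp F 2 ν × Lp F 2 ν} (ht : t ∈ freeTriples A B) :
    t.1 ∈ Submodule.span ℂ (Set.range fun x : Lp ℂ 2 ν × F => tmul x.1 x.2) ∧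
      t.2.1 ∈ Submodule.span ℂ (Set.range fun x : Lp ℂ 2 ν × F => tmul x.1 x.2) := by
  refine freeTriples_induction (P := fun t =>
    t.1 ∈ Submodule.span ℂ (Set.range fun x : Lp ℂ 2 ν × F => tmul x.1 x.2) ∧
      t.2.1 ∈ Submodule.span ℂ (Set.range fun x : Lp ℂ 2 ν × F => tmul x.1 x.2))
    (fun x _ y _ => ?_) ?_ (fun a b ha hb => ?_) (fun c a ha => ?_) ht
  · exact ⟨Submodule.subset_span ⟨(x.1, y.1), rfl⟩, Submodule.subset_span ⟨(x.2, y.1), rfl⟩⟩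
  · exact ⟨Submodule.zero_mem _, Submodule.zero_mem _⟩
  · exact ⟨Submodule.add_mem _ ha.1 hb.1, Submodule.add_mem _ ha.2 hb.2⟩
  · exact ⟨Submodule.smul_mem _ _ ha.1, Submodule.smul_mem _ _ ha.2⟩

theorem freeTriples_nonneg (hB : ∀ x ∈ B, 0 ≤ (inner ℂ x.1 x.2 : ℂ).re)
    {t : Lp F 2 ν × Lp F 2 ν × Lp F 2 ν} (ht : t ∈ freeTriples A B) :
    0 ≤ (inner ℂ t.1 t.2.2 : ℂ).re := by
  rw [L2.inner_def]
  refine (integral_nonneg_of_ae (f := fun q => (inner ℂ (t.1 q) (t.2.2 q) : ℂ).re) ?_).trans_eq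
    (integral_re (𝕜 := ℂ) (L2.integrable_inner t.1 t.2.2))
  filter_upwards [freeTriples_fiber ht] with q hq
  exact hB _ hq

/-- `A` acts on each slice `q ↦ ⟨bᵢ, Ψ(q)⟩` separately, so its lower bound is summed over an
orthonormal basis of the second factor. For the second operator, in `freeTriples_nonneg`, positivity
is instead integrated pointwise in `q`. -/
theorem freeTriples_lower [CompleteSpace F] {c : ℝ}
    (hA : ∀ x ∈ A, c * ‖x.1‖ ^ 2 ≤ (inner ℂ x.1 x.2 : ℂ).re)
    {t : Lp F 2 ν × Lp F 2 ν × Lp F 2 ν} (ht : t ∈ freeTriples A B) :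
    c * ‖t.1‖ ^ 2 ≤ (inner ℂ t.1 t.2.1 : ℂ).re := by
  obtain ⟨w, b, -⟩ := exists_hilbertBasis ℂ F
  obtain ⟨m1, m2⟩ := freeTriples_mem_span ht
  have h1 := Complex.hasSum_re (hasSum_inner_slice b m1 m2)
  have h2 := (Complex.hasSum_re (hasSum_inner_slice b m1 m1)).mul_left c
  simp only [re_inner_self_eq_norm_sq] at h2
  have h3 (i : w) : c * ‖slice (b i) t.1‖ ^ 2 ≤
      (inner ℂ (slice (b i) t.1) (slice (b i) t.2.1) : ℂ).re :=
    hA (slice (b i) t.1, slice (b i) t.2.1) (freeTriples_slice ht (b i))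
  exact hasSum_le h3 h2 h1

theorem TruncatableGraph.domain_dense {B : Submodule ℂ (F × F)} (hB : TruncatableGraph B) {w : F}
    (h : ∀ y ∈ B, (inner ℂ y.1 w : ℂ) = 0) : w = 0 :=
  hB.dense w fun _ _ _ _ hu => h _ (hu 0)

/-- The two factors are removed in turn: for fixed `y` in the domain of `B` the slice of `w` is
orthogonal to the domain of `A`, hence zero; then the density of the domain of `B` is used. -/
theorem freeTriples_domain_dense [CompleteSpace F]
    (hA : ∀ g : Lp ℂ 2 ν, (∀ x ∈ A, (inner ℂ x.1 g : ℂ) = 0) → g = 0)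
    (hB : TruncatableGraph B) {w : Lp F 2 ν}
    (h : ∀ t ∈ freeTriples A B, (inner ℂ t.1 w : ℂ) = 0) : w = 0 := by
  refine eq_zero_of_inner_tmul fun f φ => ?_
  have h1 : ContinuousLinearMap.adjoint (tmulRight f) w = 0 := by
    refine hB.domain_dense fun y hy => ?_
    rw [ContinuousLinearMap.adjoint_inner_right, tmulRight_apply, inner_tmul_left]
    rw [hA (slice y.1 w) fun x hx => ?_, inner_zero_right]
    rw [← inner_tmul_left]
    exact h _ (mem_freeTriples hx hy)
  rw [← tmulRight_apply, ← ContinuousLinearMap.adjoint_inner_right, h1, inner_zero_right]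

/-- A Neumann series for `(A + μ + R) - (R - B)`. Put `gⱼ = (A + μ + R)⁻ʲ f` and `uⱼ = (R - B)ʲ u₀`.
The operator maps `gⱼ₊₁ ⊗ uⱼ` to `gⱼ ⊗ uⱼ - gⱼ₊₁ ⊗ uⱼ₊₁`, so for `w` orthogonal to the range `⟨gⱼ ⊗
uⱼ, w⟩` does not depend on `j`. It decays like `(R / (μ + R + c))ʲ` and is therefore zero. -/
theorem freeTriples_dense [CompleteSpace F] (hA : SemiboundedGraph A)
    (hAc : IsClosed (A : Set (Lp ℂ 2 ν × Lp ℂ 2 ν))) (hB : TruncatableGraph B) :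
    ∃ μ₀ : ℝ, ∀ μ ≥ μ₀, ∀ w : Lp F 2 ν,
      (∀ t ∈ freeTriples A B, (inner ℂ (t.2.1 + t.2.2 + (μ : ℂ) • t.1) w : ℂ) = 0) → w = 0 := by
  obtain ⟨c, hc⟩ := hA.lower
  obtain ⟨μ₁, hμ₁⟩ := hA.surjective hAc
  -- `μ ≥ μ₁` makes `A + μ + R` onto for every `R > 0`; `μ ≥ 1 - c` keeps the ratio `R / (μ + R +
  -- c)` below one.
  refine ⟨max μ₁ (1 - c), fun μ hμ w hw => eq_zero_of_inner_tmul fun f φ => ?_⟩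
  have hμ1 : μ₁ ≤ μ := (le_max_left _ _).trans hμ
  have hμ2 : 1 ≤ μ + c := by linarith [(le_max_right μ₁ (1 - c)).trans hμ]
  have h1 : ContinuousLinearMap.adjoint (tmulRight f) w = 0 := by
    refine hB.dense _ fun R hR u ⟨C, hC⟩ hu => ?_
    rw [ContinuousLinearMap.adjoint_inner_right, tmulRight_apply]
    have hs := hμ₁ (μ + R) (by linarith)
    choose r hr hr' using hs
    let g : ℕ → Lp ℂ 2 ν := fun j => (fun f => (r f).1)^[j] f
    have g0 : g 0 = f := rfl
    have gs (j : ℕ) : g (j + 1) = (r (g j)).1 := Function.iterate_succ_apply' _ _ _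
    have hν : 0 < μ + R + c := by linarith
    have hg (j : ℕ) : ‖g j‖ ≤ ‖f‖ * (1 / (μ + R + c)) ^ j := by
      induction j with
      | zero => simp [g0]
      | succ j ih =>
        have h2 := norm_le_norm_shift (μ := μ + R) (hc _ (hr (g j)))
        rw [hr', ← gs] at h2
        rw [pow_succ, ← mul_assoc, mul_one_div, le_div_iff₀ hν]
        linarith
    have hstep (j : ℕ) : (inner ℂ (tmul (g j) (u j)) w : ℂ) =
        inner ℂ (tmul (g (j + 1)) (u (j + 1))) w := by
      have h2 := hw _ (mem_freeTriples (hr (g j)) (hu j))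
      rw [← sub_eq_zero, ← inner_sub_left, ← h2]
      congr 1
      have h3 : (r (g j)).2 = g j - ((μ + R : ℝ) : ℂ) • g (j + 1) := by
        rw [gs, eq_sub_iff_add_eq, hr']
      simp only [← gs, h3, tmul_sub_left, tmul_sub_right, tmul_smul_left, tmul_smul_right]
      push_cast
      module
    have hall (j : ℕ) : (inner ℂ (tmul f (u 0)) w : ℂ) = inner ℂ (tmul (g j) (u j)) w := by
      induction j with
      | zero => rfl
      | succ j ih => rw [ih, hstep]
    have hbound (j : ℕ) : ‖(inner ℂ (tmul f (u 0)) w : ℂ)‖ ≤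
        ‖f‖ * C * ‖w‖ * (R / (μ + R + c)) ^ j := by
      rw [hall j]
      refine (norm_inner_le_norm _ _).trans ?_
      rw [norm_tmul]
      calc ‖g j‖ * ‖u j‖ * ‖w‖ ≤ (‖f‖ * (1 / (μ + R + c)) ^ j) * (C * R ^ j) * ‖w‖ := by
            gcongr
            · exact hg j
            · exact hC j
        _ = _ := by
            rw [div_pow, div_pow, one_pow]
            ring
    have hlim : Tendsto (fun j : ℕ => ‖f‖ * C * ‖w‖ * (R / (μ + R + c)) ^ j) atTop (𝓝 0) := by
      have := (tendsto_pow_atTop_nhds_zero_of_lt_one (by positivity : 0 ≤ R / (μ + R + c))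
        ((div_lt_one hν).2 (by linarith))).const_mul (‖f‖ * C * ‖w‖)
      rwa [mul_zero] at this
    exact norm_le_zero_iff.1 (ge_of_tendsto' hlim hbound)
  rw [← tmulRight_apply, ← ContinuousLinearMap.adjoint_inner_right, h1, inner_zero_right]

theorem semiboundedGraph_freeTriples [CompleteSpace F] (hA : SemiboundedGraph A)
    (hAc : IsClosed (A : Set (Lp ℂ 2 ν × Lp ℂ 2 ν))) (hB : TruncatableGraph B) :
    SemiboundedGraph ((freeTriples A B).map totalPart) := by
  obtain ⟨c, hc⟩ := hA.lower
  obtain ⟨μ₀, hμ₀⟩ := freeTriples_dense hA hAc hB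
  refine ⟨?_, ⟨c, ?_⟩, ⟨μ₀, fun μ hμ w hw => hμ₀ μ hμ w fun t ht => ?_⟩⟩
  · rintro _ ⟨s, hs, rfl⟩ _ ⟨t, ht, rfl⟩
    obtain ⟨h1, h2⟩ := freeTriples_symm hA.symm hB.symm hs ht
    simp only [totalPart_apply, inner_add_left, inner_add_right, h1, h2]
  · rintro _ ⟨t, ht, rfl⟩
    simp only [totalPart_apply, inner_add_right, Complex.add_re]
    linarith [freeTriples_nonneg hB.nonneg ht, freeTriples_lower hc ht]
  · exact hw _ (Submodule.mem_map_of_mem ht)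

end Free

/-! ### The Kato–Rellich theorem for partially defined operators -/

section KatoRellich

variable {E : Type*} [NormedAddCommGroup E] [InnerProductSpace ℂ E] {T W : E →ₗ.[ℂ] E}

/-- The triples `(ψ, Tψ, Wψ)` with `ψ ∈ S`. -/
def perturbTriples (T W : E →ₗ.[ℂ] E) (S : Submodule ℂ E) : Submodule ℂ (E × E × E) where
  carrier := {t | t.1 ∈ S ∧ (t.1, t.2.1) ∈ T.graph ∧ (t.1, t.2.2) ∈ W.graph}
  zero_mem' := ⟨S.zero_mem, T.graph.zero_mem, W.graph.zero_mem⟩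
  add_mem' := fun ⟨a, b, c⟩ ⟨a', b', c'⟩ =>
    ⟨S.add_mem a a', T.graph.add_mem b b', W.graph.add_mem c c'⟩
  smul_mem' := fun r _ ⟨a, b, c⟩ => ⟨S.smul_mem r a, T.graph.smul_mem r b, W.graph.smul_mem r c⟩

theorem mem_domRestrict_graph_iff {S : Submodule ℂ E} {x : E × E} :
    x ∈ (T.domRestrict S).graph ↔ x.1 ∈ S ∧ x ∈ T.graph := by
  constructor
  · intro hx
    obtain ⟨y, rfl⟩ := (LinearPMap.mem_graph_iff' _).1 hx
    exact ⟨y.2.1, T.mem_graph ⟨y, y.2.2⟩⟩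
  · rintro ⟨hS, hx⟩
    obtain ⟨y, rfl⟩ := (LinearPMap.mem_graph_iff' _).1 hx
    exact (T.domRestrict S).mem_graph ⟨y, hS, y.2⟩

theorem mem_add_graph_iff {x : E × E} :
    x ∈ (T + W).graph ↔ ∃ a b, (x.1, a) ∈ T.graph ∧ (x.1, b) ∈ W.graph ∧ a + b = x.2 := by
  constructor
  · intro hx
    obtain ⟨y, rfl⟩ := (LinearPMap.mem_graph_iff' _).1 hx
    exact ⟨_, _, T.mem_graph ⟨y, y.2.1⟩, W.mem_graph ⟨y, y.2.2⟩, rfl⟩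
  · rintro ⟨a, b, ha, hb, hab⟩
    have da := LinearPMap.mem_domain_of_mem_graph ha
    have db := LinearPMap.mem_domain_of_mem_graph hb
    have ea : T ⟨x.1, da⟩ = a := T.mem_graph_snd_inj (T.mem_graph ⟨x.1, da⟩) ha rfl
    have eb : W ⟨x.1, db⟩ = b := W.mem_graph_snd_inj (W.mem_graph ⟨x.1, db⟩) hb rfl
    refine (LinearPMap.mem_graph_iff _).2 ⟨⟨x.1, da, db⟩, rfl, ?_⟩
    rw [← hab, ← ea, ← eb]
    rfl

theorem perturbTriples_map_firstPart {S : Submodule ℂ E} (hW : T.domain ≤ W.domain) :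
    (perturbTriples T W S).map firstPart = (T.domRestrict S).graph := by
  ext x
  rw [mem_domRestrict_graph_iff]
  constructor
  · rintro ⟨t, ⟨h1, h2, -⟩, rfl⟩
    exact ⟨h1, h2⟩
  · rintro ⟨h1, h2⟩
    have h3 := W.mem_graph ⟨x.1, hW (LinearPMap.mem_domain_of_mem_graph h2)⟩
    exact ⟨(x.1, x.2, W ⟨x.1, _⟩), ⟨h1, h2, h3⟩, rfl⟩

theorem perturbTriples_map_totalPart {S : Submodule ℂ E} :
    (perturbTriples T W S).map totalPart = ((T + W).domRestrict S).graph := by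
  ext x
  rw [mem_domRestrict_graph_iff, mem_add_graph_iff]
  constructor
  · rintro ⟨t, ⟨h1, h2, h3⟩, rfl⟩
    exact ⟨h1, _, _, h2, h3, rfl⟩
  · rintro ⟨h1, a, b, ha, hb, hab⟩
    exact ⟨(x.1, a, b), ⟨h1, ha, hb⟩, Prod.ext rfl hab⟩

theorem domRestrict_top : T.domRestrict ⊤ = T := by
  refine LinearPMap.eq_of_eq_graph ?_
  ext x
  rw [mem_domRestrict_graph_iff]
  exact and_iff_right trivial

/-- A subgraph with semibounded closure is semibounded. -/
theorem SemiboundedGraph.of_closure {G : Submodule ℂ (E × E)}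
    (h : SemiboundedGraph G.topologicalClosure) : SemiboundedGraph G := by
  have hle := G.le_topologicalClosure
  obtain ⟨c, hc⟩ := h.lower
  obtain ⟨μ₀, hμ₀⟩ := h.dense
  refine ⟨fun x hx y hy => h.symm x (hle hx) y (hle hy), ⟨c, fun x hx => hc x (hle hx)⟩,
    ⟨μ₀, fun μ hμ w hw => hμ₀ μ hμ w fun x hx => ?_⟩⟩
  exact closure_minimal (s := (G : Set (E × E)))
    (t := {x | (inner ℂ (x.2 + (μ : ℂ) • x.1) w : ℂ) = 0}) (fun y hy => hw y hy)
    (isClosed_eq (by fun_prop) continuous_const) hx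

/-- If the closure of `G` is the graph of a densely defined operator then the domain of `G` is
dense. -/
theorem dense_fst_of_closure {G : Submodule ℂ (E × E)}
    (hd : Dense (T.domain : Set E)) (h : G.topologicalClosure = T.graph) :
    Dense ((G.map (LinearMap.fst ℂ E E) : Submodule ℂ E) : Set E) := by
  have h1 : (T.domain : Set E) ⊆ closure (G.map (LinearMap.fst ℂ E E) : Submodule ℂ E) := by
    intro x hx
    have h2 : ((x, T ⟨x, hx⟩) : E × E) ∈ G.topologicalClosure := by
      rw [h]
      exact T.mem_graph ⟨x, hx⟩
    have h3 := image_closure_subset_closure_image (f := Prod.fst) (s := (G : Set (E × E)))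
      continuous_fst (Set.mem_image_of_mem Prod.fst h2)
    exact h3
  exact (dense_closure.1 (hd.mono h1))

variable [CompleteSpace E]

/-- Relative bound `1/2` makes the graph norms of `T` and `T + W` equivalent, so `(ψ, Tψ) ↦ (ψ, Tψ +
Wψ)` is bi-Lipschitz on a complete space and its image, the graph of `T + W`, is closed. -/
theorem isClosed_add (hTc : T.IsClosed) (hW : T.domain ≤ W.domain) {C : ℝ}
    (hrel : ∀ x ∈ T.graph, ∀ y ∈ W.graph, x.1 = y.1 → ‖y.2‖ ≤ 1 / 2 * ‖x.2‖ + C * ‖x.1‖) :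
    (T + W).IsClosed := by
  have hcs : CompleteSpace T.graph := _root_.IsClosed.completeSpace_coe (hs := hTc)
  have hdom (x : T.graph) : x.1.1 ∈ W.domain := hW (LinearPMap.mem_domain_of_mem_graph x.2)
  have hb (x : T.graph) : ‖W ⟨x.1.1, hdom x⟩‖ ≤ 1 / 2 * ‖x.1.2‖ + |C| * ‖x.1.1‖ :=
    (hrel x.1 x.2 _ (W.mem_graph ⟨x.1.1, hdom x⟩) rfl).trans
      (by gcongr; exact le_abs_self C)
  let f : T.graph →ₗ[ℂ] E × E :=
    { toFun := fun x => (x.1.1, x.1.2 + W ⟨x.1.1, hdom x⟩)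
      map_add' := fun x y => by
        have e : W ⟨(x + y).1.1, hdom (x + y)⟩ = W ⟨x.1.1, hdom x⟩ + W ⟨y.1.1, hdom y⟩ :=
          W.map_add ⟨x.1.1, hdom x⟩ ⟨y.1.1, hdom y⟩
        rw [e, Prod.mk_add_mk]
        refine Prod.ext rfl ?_
        change x.1.2 + y.1.2 + _ = _
        exact add_add_add_comm _ _ _ _
      map_smul' := fun c x => by
        have e : W ⟨(c • x).1.1, hdom (c • x)⟩ = c • W ⟨x.1.1, hdom x⟩ :=
          W.map_smul c ⟨x.1.1, hdom x⟩
        rw [e, RingHom.id_apply, Prod.smul_mk, smul_add]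
        rfl }
  have hf1 (x : T.graph) : ‖x.1.1‖ ≤ ‖f x‖ := norm_fst_le (f x)
  have hf2 (x : T.graph) : ‖x.1.2 + W ⟨x.1.1, hdom x⟩‖ ≤ ‖f x‖ := norm_snd_le (f x)
  have ha : AntilipschitzWith (Real.toNNReal (2 + 2 * |C|)) f := by
    refine AddMonoidHomClass.antilipschitz_of_bound f fun x => ?_
    rw [Real.coe_toNNReal _ (by positivity)]
    have h1 : ‖x.1.2‖ ≤ ‖x.1.2 + W ⟨x.1.1, hdom x⟩‖ + ‖W ⟨x.1.1, hdom x⟩‖ := by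
      have := norm_sub_le (x.1.2 + W ⟨x.1.1, hdom x⟩) (W ⟨x.1.1, hdom x⟩)
      rwa [add_sub_cancel_right] at this
    have h2 := hb x
    have h3 := mul_le_mul_of_nonneg_left (hf1 x) (abs_nonneg C)
    have h4 := mul_nonneg (abs_nonneg C) (norm_nonneg (f x))
    have h5 := norm_nonneg (f x)
    refine max_le ?_ ?_
    · change ‖x.1.1‖ ≤ _
      linarith [hf1 x]
    · change ‖x.1.2‖ ≤ _
      linarith [hf2 x]
  have hu : UniformContinuous f := by
    have : LipschitzWith (Real.toNNReal (2 + |C|)) f := by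
      refine AddMonoidHomClass.lipschitz_of_bound f (2 + |C|) fun x => ?_
      have h1 : ‖x.1.1‖ ≤ ‖x‖ := norm_fst_le x.1
      have h2 : ‖x.1.2‖ ≤ ‖x‖ := norm_snd_le x.1
      have h3 := mul_le_mul_of_nonneg_left h1 (abs_nonneg C)
      have h4 := mul_nonneg (abs_nonneg C) (norm_nonneg x)
      have h5 := norm_nonneg x
      refine max_le ?_ ?_
      · change ‖x.1.1‖ ≤ _
        linarith
      · refine (norm_add_le _ _).trans ?_
        linarith [hb x]
    exact this.uniformContinuous
  have e : ((T + W).graph : Set (E × E)) = Set.range f := by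
    ext x
    rw [SetLike.mem_coe, mem_add_graph_iff, Set.mem_range]
    constructor
    · rintro ⟨a, b, h1, h2, h3⟩
      refine ⟨⟨(x.1, a), h1⟩, Prod.ext rfl ?_⟩
      rw [← h3]
      exact congrArg (a + ·) (W.mem_graph_snd_inj (W.mem_graph ⟨x.1, _⟩) h2 rfl)
    · rintro ⟨y, rfl⟩
      exact ⟨_, _, y.2, W.mem_graph ⟨y.1.1, hdom y⟩, rfl⟩
  rw [LinearPMap.IsClosed, e]
  exact ha.isClosed_range hu

/-- The Kato–Rellich theorem. -/
theorem kato_rellich (hT : SemiboundedGraph T.graph) (hTc : T.IsClosed)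
    (hd : Dense (T.domain : Set E)) (hW : T.domain ≤ W.domain)
    (hsymm : ∀ x ∈ W.graph, ∀ y ∈ W.graph, x.1 ∈ T.domain → y.1 ∈ T.domain →
      (inner ℂ x.1 y.2 : ℂ) = inner ℂ x.2 y.1)
    (hrel : ∀ ε > 0, ∃ C : ℝ, ∀ x ∈ T.graph, ∀ y ∈ W.graph, x.1 = y.1 →
      ‖y.2‖ ≤ ε * ‖x.2‖ + C * ‖x.1‖) :
    (T + W).domain = T.domain ∧ IsSelfAdjoint (T + W) ∧
      (∀ S : Submodule ℂ E, T.HasCore S → EssentiallySelfAdjoint ((T + W).domRestrict S)) ∧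
      BoundedFromBelow (T + W) := by
  have hdom : (T + W).domain = T.domain := inf_eq_left.2 hW
  -- Stated for restrictions to arbitrary `S`, so that the full domain (`S = ⊤`) and all cores are
  -- treated at once.
  have key (S : Submodule ℂ E) (hS : SemiboundedGraph (T.domRestrict S).graph) :
      SemiboundedGraph ((T + W).domRestrict S).graph := by
    rw [← perturbTriples_map_firstPart hW] at hS
    rw [← perturbTriples_map_totalPart]
    refine hS.perturb ?_ fun ε hε => ?_
    · rintro x ⟨-, h1, h2⟩ y ⟨-, h3, h4⟩
      exact hsymm _ h2 _ h4 (LinearPMap.mem_domain_of_mem_graph h1)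
        (LinearPMap.mem_domain_of_mem_graph h3)
    · obtain ⟨C, hC⟩ := hrel ε hε
      exact ⟨C, fun x ⟨_, h1, h2⟩ => hC _ h1 (x.1, x.2.2) h2 rfl⟩
  have htop : SemiboundedGraph (T + W).graph := by
    have := key ⊤ (by rwa [domRestrict_top])
    rwa [domRestrict_top] at this
  refine ⟨hdom, ?_, fun S hS => ?_, ?_⟩
  · obtain ⟨C, hC⟩ := hrel (1 / 2) (by norm_num)
    refine isSelfAdjoint_of_semiboundedGraph ?_ (isClosed_add hTc hW hC) htop
    rw [hdom]
    exact hd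
  · have hcl : (T.domRestrict S).IsClosable :=
      hTc.isClosable.leIsClosable LinearPMap.domRestrict_le
    -- On a core the closure of the restricted graph is the graph of `T`; semiboundedness and
    -- density of the domain descend from it to the restriction.
    have hg : (T.domRestrict S).graph.topologicalClosure = T.graph := by
      rw [hcl.graph_closure_eq_closure_graph, hS.closure_eq]
    refine essentiallySelfAdjoint_of_semiboundedGraph ?_ (key S (.of_closure (by rwa [hg])))
    have h1 := dense_fst_of_closure hd hg
    rw [LinearPMap.graph_map_fst_eq_domain] at h1
    refine h1.mono ?_
    rintro x ⟨hx, hx'⟩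
    exact ⟨hx, hx', hW hx'⟩
  · obtain ⟨c, hc⟩ := htop.lower
    exact ⟨c, fun ψ => hc _ ((T + W).mem_graph ψ)⟩

end KatoRellich

/-! ### Direct integrals of closed operators -/

section Fibers

theorem exists_subseq_tendsto_ae {α : Type*} {mα : MeasurableSpace α}
    {ν : Measure α} {F : Type*} [NormedAddCommGroup F] {u : ℕ → Lp F 2 ν} {v : Lp F 2 ν}
    (h : Tendsto u atTop (𝓝 v)) : ∃ ns : ℕ → ℕ, StrictMono ns ∧
      ∀ᵐ x ∂ν, Tendsto (fun i => u (ns i) x) atTop (𝓝 (v x)) :=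
  (tendstoInMeasure_of_tendsto_Lp h).exists_seq_tendsto_ae

variable {α : Type*} {mα : MeasurableSpace α} {ν : Measure α} {F : Type*} [NormedAddCommGroup F]
  [InnerProductSpace ℂ F]

/-- The direct integral of a family of graphs. -/
def fiberGraph (ν : Measure α) (G : α → Submodule ℂ (F × F)) :
    Submodule ℂ (Lp F 2 ν × Lp F 2 ν) where
  carrier := {x | ∀ᵐ q ∂ν, (x.1 q, x.2 q) ∈ G q}
  zero_mem' := by
    filter_upwards [Lp.coeFn_zero F 2 ν] with q hq
    simp only [Prod.fst_zero, Prod.snd_zero, hq, Pi.zero_apply]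
    exact (G q).zero_mem
  add_mem' := by
    rintro ⟨Ψ, Φ⟩ ⟨Ψ', Φ'⟩ h1 h2
    filter_upwards [h1, h2, Lp.coeFn_add Ψ Ψ', Lp.coeFn_add Φ Φ'] with q m1 m2 e e'
    simp only [Prod.mk_add_mk, e, e', Pi.add_apply]
    exact (G q).add_mem m1 m2
  smul_mem' := by
    rintro c ⟨Ψ, Φ⟩ h1
    filter_upwards [h1, Lp.coeFn_smul c Ψ, Lp.coeFn_smul c Φ] with q m1 e e'
    simp only [Prod.smul_mk, e, e', Pi.smul_apply]
    exact (G q).smul_mem c m1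

/-- An `L²` convergent sequence has an almost everywhere convergent subsequence. Two extractions
handle both components, and the fibers are closed. -/
theorem isClosed_fiberGraph {G : α → Submodule ℂ (F × F)}
    (hG : ∀ q, IsClosed (G q : Set (F × F))) :
    IsClosed (fiberGraph ν G : Set (Lp F 2 ν × Lp F 2 ν)) := by
  refine IsSeqClosed.isClosed fun u x hu hx => ?_
  obtain ⟨ns, hns, h1⟩ := exists_subseq_tendsto_ae ((continuous_fst.tendsto x).comp hx)
  obtain ⟨ms, hms, h2⟩ := exists_subseq_tendsto_ae
    (((continuous_snd.tendsto x).comp hx).comp hns.tendsto_atTop)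
  have h3 : ∀ᵐ q ∂ν, ∀ i, ((u i).1 q, (u i).2 q) ∈ G q := ae_all_iff.2 hu
  filter_upwards [h1, h2, h3] with q e1 e2 e3
  exact (hG q).mem_of_tendsto ((e1.comp hms.tendsto_atTop).prodMk_nhds e2)
    (Eventually.of_forall fun i => e3 _)

theorem fiberGraph_single_valued {G : α → Submodule ℂ (F × F)}
    (hG : ∀ q, ∀ x ∈ G q, x.1 = 0 → x.2 = 0) {x : Lp F 2 ν × Lp F 2 ν}
    (hx : x ∈ fiberGraph ν G) (h0 : x.1 = 0) : x.2 = 0 := by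
  refine (Lp.eq_zero_iff_ae_eq_zero).2 ?_
  filter_upwards [hx, (Lp.eq_zero_iff_ae_eq_zero).1 h0] with q h1 h2
  exact hG q _ h1 h2

end Fibers

/-! ### From form bounds to operator bounds, and extension to closures -/

section Extension

variable {E : Type*} [NormedAddCommGroup E] [InnerProductSpace ℂ E]

/-- A form bound implies an infinitesimal operator bound. -/
theorem norm_le_of_form_bound {a b : ℝ} (ha : 0 ≤ a) {ε : ℝ} (hε : 0 < ε) :
    ∃ C : ℝ, ∀ x y z : E, ‖z‖ ^ 2 ≤ a * (inner ℂ x y : ℂ).re + b * ‖x‖ ^ 2 →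
      ‖z‖ ≤ ε * ‖y‖ + C * ‖x‖ := by
  -- Chosen so that in the square of `ε‖y‖ + C‖x‖` the cross term with `a/(2ε)` is `a ‖x‖ ‖y‖` and
  -- the square of `√|b| ‖x‖` is `|b| ‖x‖²`; the remaining terms are nonnegative.
  refine ⟨a / (2 * ε) + √|b|, fun x y z h => ?_⟩
  refine le_of_sq_le_sq (h.trans ?_) (by positivity)
  have h1 : (inner ℂ x y : ℂ).re ≤ ‖x‖ * ‖y‖ :=
    (Complex.re_le_norm _).trans (norm_inner_le_norm _ _)
  have h2 := mul_le_mul_of_nonneg_left h1 ha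
  have h3 : √|b| ^ 2 = |b| := Real.sq_sqrt (abs_nonneg b)
  have h4 : b * ‖x‖ ^ 2 ≤ |b| * ‖x‖ ^ 2 := by gcongr; exact le_abs_self b
  set s := √|b| with hs
  have hs0 : 0 ≤ s := Real.sqrt_nonneg _
  set r := a / (2 * ε) with hr
  have hr0 : 0 ≤ r := by positivity
  have hra : a = 2 * ε * r := by rw [hr]; field_simp
  have n1 := norm_nonneg x
  have n2 := norm_nonneg y
  have e : (ε * ‖y‖ + (r + s) * ‖x‖) ^ 2 = (ε * ‖y‖) ^ 2 + 2 * ε * r * (‖x‖ * ‖y‖) +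
      2 * (ε * s * (‖x‖ * ‖y‖)) + (r ^ 2 + 2 * (r * s)) * ‖x‖ ^ 2 + s ^ 2 * ‖x‖ ^ 2 := by ring
  rw [e, h3, ← hra]
  have p1 : 0 ≤ ε * s * (‖x‖ * ‖y‖) := by positivity
  have p2 : 0 ≤ (r ^ 2 + 2 * (r * s)) * ‖x‖ ^ 2 := by positivity
  have p3 := sq_nonneg (ε * ‖y‖)
  linarith

variable [CompleteSpace E]

/-- A form bound for a closed operator relative to a graph extends to the closure of the graph. -/
theorem extend_form_bound {G R : Submodule ℂ (E × E)} (hR : IsClosed (R : Set (E × E)))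
    (hRs : ∀ x ∈ R, x.1 = 0 → x.2 = 0) {a b : ℝ}
    (h : ∀ x ∈ G, ∃ y, (x.1, y) ∈ R ∧ ‖y‖ ^ 2 ≤ a * (inner ℂ x.1 x.2 : ℂ).re + b * ‖x.1‖ ^ 2)
    {x : E × E} (hx : x ∈ G.topologicalClosure) :
    ∃ y, (x.1, y) ∈ R ∧ ‖y‖ ^ 2 ≤ a * (inner ℂ x.1 x.2 : ℂ).re + b * ‖x.1‖ ^ 2 := by
  choose! Y hY hY' using h
  -- The chosen values are unique because `R` is single-valued, so `Y` respects differences. The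
  -- form bound then makes it Lipschitz in the graph norm, and Cauchy sequences pass through it.
  have hsub : ∀ x ∈ G, ∀ x' ∈ G, Y x - Y x' = Y (x - x') := by
    intro x hx x' hx'
    have h1 := R.sub_mem (R.sub_mem (hY x hx) (hY x' hx')) (hY (x - x') (G.sub_mem hx hx'))
    exact sub_eq_zero.1 (hRs _ h1 (sub_self _))
  have hbound : ∀ x ∈ G, ‖Y x‖ ≤ (|a| + |b|) ^ (1 / 2 : ℝ) * ‖x‖ := by
    intro x hx
    have h1 : (inner ℂ x.1 x.2 : ℂ).re ≤ ‖x‖ ^ 2 ∧ -(inner ℂ x.1 x.2 : ℂ).re ≤ ‖x‖ ^ 2 := by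
      have h2 : |(inner ℂ x.1 x.2 : ℂ).re| ≤ ‖x‖ ^ 2 := by
        refine (Complex.abs_re_le_norm _).trans ((norm_inner_le_norm _ _).trans ?_)
        rw [sq]
        exact mul_le_mul (norm_fst_le x) (norm_snd_le x) (norm_nonneg _) (norm_nonneg _)
      exact ⟨(le_abs_self _).trans h2, (neg_le_abs _).trans h2⟩
    have h3 : a * (inner ℂ x.1 x.2 : ℂ).re ≤ |a| * ‖x‖ ^ 2 := by
      rcases abs_cases a with ⟨e, h0⟩ | ⟨e, h0⟩ <;> rw [e] <;> nlinarith
    have h4 : b * ‖x.1‖ ^ 2 ≤ |b| * ‖x‖ ^ 2 := by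
      have := norm_fst_le x
      calc b * ‖x.1‖ ^ 2 ≤ |b| * ‖x.1‖ ^ 2 := by gcongr; exact le_abs_self b
        _ ≤ _ := by gcongr
    refine le_of_sq_le_sq ?_ (by positivity)
    rw [mul_pow, ← Real.sqrt_eq_rpow, Real.sq_sqrt (by positivity)]
    linarith [hY' x hx]
  obtain ⟨u, hu, hux⟩ := mem_closure_iff_seq_limit.1 hx
  have hc : CauchySeq fun n => Y (u n) := by
    have h1 : LipschitzWith (Real.toNNReal ((|a| + |b|) ^ (1 / 2 : ℝ))) fun x : G => Y x := by
      refine LipschitzWith.of_dist_le_mul fun x x' => ?_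
      rw [dist_eq_norm, hsub _ x.2 _ x'.2, Real.coe_toNNReal _ (by positivity), Subtype.dist_eq,
        dist_eq_norm]
      exact hbound _ (G.sub_mem x.2 x'.2)
    have h2 : CauchySeq fun n => (⟨u n, hu n⟩ : G) := by
      have h3 := hux.cauchySeq
      rw [Metric.cauchySeq_iff] at h3 ⊢
      exact h3
    exact h1.uniformContinuous.comp_cauchySeq h2
  obtain ⟨y, hy⟩ := cauchySeq_tendsto_of_complete hc
  have t1 := (continuous_fst.tendsto x).comp hux
  refine ⟨y, hR.mem_of_tendsto (t1.prodMk_nhds hy) (Eventually.of_forall fun n => hY _ (hu n)), ?_⟩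
  refine le_of_tendsto_of_tendsto' (hy.norm.pow 2) ?_ fun n => hY' _ (hu n)
  have hcont : Continuous fun x : E × E => a * (inner ℂ x.1 x.2 : ℂ).re + b * ‖x.1‖ ^ 2 := by
    fun_prop
  exact (hcont.tendsto x).comp hux

end Extension

/-! ### Form-bounded families of fiber operators -/

section FormBounded

variable {α : Type*} {mα : MeasurableSpace α} [TopologicalSpace α] {F : Type*}
  [NormedAddCommGroup F] [InnerProductSpace ℂ F]

/-- A family of operators with graphs `G q`, bounded relative to the form of the operator with
graph `B` and continuous in `q` in the strong sense. -/
structure FormBoundedFamily (G : α → Submodule ℂ (F × F)) (B : Submodule ℂ (F × F)) (a b : ℝ) :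
    Prop where
  closed : ∀ q, IsClosed (G q : Set (F × F))
  single_valued : ∀ q, ∀ x ∈ G q, x.1 = 0 → x.2 = 0
  bound : ∀ q, ∀ x ∈ B, ∃ θ, (x.1, θ) ∈ G q ∧
    ‖θ‖ ^ 2 ≤ a * (inner ℂ x.1 x.2 : ℂ).re + b * ‖x.1‖ ^ 2
  continuous : ∀ x ∈ B, ∀ θ : α → F, (∀ q, (x.1, θ q) ∈ G q) → Continuous θ

variable {ν : Measure α}
  {A : Submodule ℂ (Lp ℂ 2 ν × Lp ℂ 2 ν)} {B : Submodule ℂ (F × F)}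
  {G : α → Submodule ℂ (F × F)} {a b : ℝ}

theorem FormBoundedFamily.norm_sq_le (h : FormBoundedFamily G B a b)
    {t : Lp F 2 ν × Lp F 2 ν × Lp F 2 ν} (ht : t ∈ freeTriples A B) {y : Lp F 2 ν}
    (hy : (t.1, y) ∈ fiberGraph ν G) :
    ‖y‖ ^ 2 ≤ a * (inner ℂ t.1 t.2.2 : ℂ).re + b * ‖t.1‖ ^ 2 := by
  have i1 : Integrable (fun q => (inner ℂ (t.1 q) (t.2.2 q) : ℂ).re) ν :=
    (L2.integrable_inner (𝕜 := ℂ) t.1 t.2.2).re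
  have i2 : Integrable (fun q => ‖t.1 q‖ ^ 2) ν := (Lp.memLp t.1).integrable_norm_pow (by norm_num)
  have e1 : (inner ℂ t.1 t.2.2 : ℂ).re = ∫ q, (inner ℂ (t.1 q) (t.2.2 q) : ℂ).re ∂ν := by
    rw [L2.inner_def]
    exact (integral_re (𝕜 := ℂ) (L2.integrable_inner t.1 t.2.2)).symm
  rw [norm_sq_eq_integral, norm_sq_eq_integral, e1, ← integral_const_mul, ← integral_const_mul,
    ← integral_add (i1.const_mul a) (i2.const_mul b)]
  refine integral_mono_of_nonneg (Eventually.of_forall fun q => sq_nonneg _)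
    ((i1.const_mul a).add (i2.const_mul b)) ?_
  filter_upwards [freeTriples_fiber ht, hy] with q m1 m2
  obtain ⟨θ, h1, h2⟩ := h.bound q _ m1
  have e : y q - θ = 0 := h.single_valued q _ ((G q).sub_mem m2 h1) (sub_self _)
  rw [sub_eq_zero.1 e]
  exact h2

variable [OpensMeasurableSpace α] [SecondCountableTopology α]

/-- On a simple tensor the image is `q ↦ x(q) θ(q)`. Continuity of `θ` supplies its measurability,
and the uniform form bound its square integrability. -/
theorem FormBoundedFamily.exists_mem_fiberGraph (h : FormBoundedFamily G B a b)
    {t : Lp F 2 ν × Lp F 2 ν × Lp F 2 ν} (ht : t ∈ freeTriples A B) :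
    ∃ y, (t.1, y) ∈ fiberGraph ν G := by
  have key (x : Lp ℂ 2 ν × Lp ℂ 2 ν) (y : F × F) (hy : y ∈ B) :
      ∃ z, (tmul x.1 y.1, z) ∈ fiberGraph ν G := by
    choose θ h1 h2 using fun q => h.bound q y hy
    have hc := h.continuous y hy θ h1
    have hL : MemLp (fun q => x.1 q • θ q) 2 ν := by
      refine (Lp.memLp x.1).of_le_mul
        (c := √(a * (inner ℂ y.1 y.2 : ℂ).re + b * ‖y.1‖ ^ 2)) ?_ (Eventually.of_forall fun q => ?_)
      · exact (Lp.aestronglyMeasurable _).smul hc.aestronglyMeasurable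
      · rw [norm_smul, mul_comm]
        exact mul_le_mul_of_nonneg_right (Real.le_sqrt_of_sq_le (h2 q)) (norm_nonneg _)
    refine ⟨hL.toLp _, ?_⟩
    filter_upwards [hL.coeFn_toLp, tmul_ae x.1 y.1] with q e1 e2
    simp only [e1, e2]
    exact (G q).smul_mem (x.1 q) (h1 q)
  refine freeTriples_induction (A := A) (B := B) (P := fun t => ∃ y, (t.1, y) ∈ fiberGraph ν G)
    (fun x _ y hy => key x y hy) ?_ ?_ ?_ ht
  · refine ⟨0, ?_⟩
    rw [Prod.fst_zero, Prod.mk_zero_zero]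
    exact Submodule.zero_mem _
  · intro s t hs ht
    obtain ⟨y, hy⟩ := hs
    obtain ⟨z, hz⟩ := ht
    refine ⟨y + z, ?_⟩
    rw [Prod.fst_add, ← Prod.mk_add_mk]
    exact Submodule.add_mem _ hy hz
  · intro c t ht
    obtain ⟨y, hy⟩ := ht
    refine ⟨c • y, ?_⟩
    rw [Prod.smul_fst, ← Prod.smul_mk]
    exact Submodule.smul_mem _ c hy

/-- The direct integral of a form-bounded family is bounded relative to the form of the closure of
`A ⊗ 1 + 1 ⊗ B`. -/
theorem FormBoundedFamily.exists_of_mem_closure [CompleteSpace F] (h : FormBoundedFamily G B a b)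
    (ha : 0 ≤ a) {c : ℝ} (hA : ∀ x ∈ A, c * ‖x.1‖ ^ 2 ≤ (inner ℂ x.1 x.2 : ℂ).re)
    {x : Lp F 2 ν × Lp F 2 ν}
    (hx : x ∈ ((freeTriples A B).map totalPart).topologicalClosure) :
    ∃ y, (x.1, y) ∈ fiberGraph ν G ∧
      ‖y‖ ^ 2 ≤ a * (inner ℂ x.1 x.2 : ℂ).re + (b - a * c) * ‖x.1‖ ^ 2 := by
  have h1 : IsClosed (fiberGraph ν G : Set (Lp F 2 ν × Lp F 2 ν)) := isClosed_fiberGraph h.closed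
  have h2 (z : Lp F 2 ν × Lp F 2 ν) (hz : z ∈ fiberGraph ν G) (h0 : z.1 = 0) : z.2 = 0 :=
    fiberGraph_single_valued h.single_valued hz h0
  refine extend_form_bound (E := Lp F 2 ν) h1 h2 (fun z hz => ?_) hx
  obtain ⟨t, ht, rfl⟩ := Submodule.mem_map.1 hz
  obtain ⟨y, hy⟩ := h.exists_mem_fiberGraph ht
  refine ⟨y, hy, (h.norm_sq_le ht hy).trans ?_⟩
  -- The form of `B` is that of `A ⊗ 1 + 1 ⊗ B` minus that of `A`, which is at least `c ‖x‖²`; this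
  -- is the source of the constant `b - a c`.
  simp only [totalPart_apply, inner_add_right, Complex.add_re]
  have := mul_le_mul_of_nonneg_left (freeTriples_lower hA ht) ha
  linarith

end FormBounded

/-! ### Families of coupling functions -/

section Families

variable {α : Type*} [TopologicalSpace α] {Y : Type} [MeasureSpace Y] {w : Y → ℝ}

/-- A family `g q = √w k q` of coupling functions such that `g q` and `k q` have norms bounded
uniformly in `q` and depend continuously on `q`, both in `L²`. -/
structure CouplingFamily (w : Y → ℝ) (g k : α → Y → ℂ) (N K : ℝ) : Prop where
  memLp_left : ∀ q, MemLp (g q) 2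
  memLp_right : ∀ q, MemLp (k q) 2
  factor : ∀ q y, g q y = (√(w y) : ℂ) * k q y
  bound_left : ∀ q, ∫ y, ‖g q y‖ ^ 2 ≤ N
  bound_right : ∀ q, ∫ y, ‖k q y‖ ^ 2 ≤ K
  continuous_left : ∀ q, Tendsto (fun q' => ∫ y, ‖(g q' - g q) y‖ ^ 2) (𝓝 q) (𝓝 0)
  continuous_right : ∀ q, Tendsto (fun q' => ∫ y, ‖(k q' - k q) y‖ ^ 2) (𝓝 q) (𝓝 0)

theorem continuous_of_norm_sq_le {F : Type*} [NormedAddCommGroup F] {θ : α → F} {m : α → α → ℝ}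
    (h : ∀ q q', ‖θ q' - θ q‖ ^ 2 ≤ m q q') (hm : ∀ q, Tendsto (m q) (𝓝 q) (𝓝 0)) :
    Continuous θ := by
  refine continuous_iff_continuousAt.2 fun q => ?_
  rw [ContinuousAt, tendsto_iff_norm_sub_tendsto_zero]
  have h1 : Tendsto (fun q' => ‖θ q' - θ q‖ ^ 2) (𝓝 q) (𝓝 0) :=
    squeeze_zero (fun _ => sq_nonneg _) (h q) (hm q)
  have h2 := h1.sqrt
  simpa [Real.sqrt_sq (norm_nonneg _)] using h2

variable {g k : α → Y → ℂ} {N K : ℝ}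

theorem CouplingFamily.factor_sub (h : CouplingFamily w g k N K) (q q' : α) (y : Y) :
    (g q' - g q) y = (√(w y) : ℂ) * (k q' - k q) y := by
  rw [Pi.sub_apply, Pi.sub_apply, h.factor, h.factor, mul_sub]

variable [SigmaFinite (volume : Measure Y)]

/-- Continuity in `q` follows from the same energy bound applied to the coupling function `g q' - g
q = √w (k q' - k q)`. The term with `N` is not needed here; it is included so that both kinds of
operators share the same constants. -/
theorem CouplingFamily.annihilation (h : CouplingFamily w g k N K) (hw : Measurable w)
    (hw0 : ∀ y, 0 ≤ w y) : FormBoundedFamily (fun q => annihilationGraph (g q))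
      (secondQuantizationGraph w) K N where
  closed q := isClosed_annihilationGraph (h.memLp_left q)
  single_valued q := annihilationGraph_single_valued (g q)
  bound q x hx := by
    obtain ⟨θ, h1, h2⟩ := exists_annihilation hw hw0 (φ := x.1) (χ := x.2) hx (h.memLp_left q)
      (h.memLp_right q) (h.factor q)
    refine ⟨θ, h1, h2.trans ?_⟩
    have h3 := mul_le_mul_of_nonneg_right (h.bound_right q) (secondQuantization_nonneg hw0 hx)
    have h4 : 0 ≤ N := (integral_nonneg fun _ => sq_nonneg _).trans (h.bound_left q)
    have h5 := mul_nonneg h4 (sq_nonneg ‖x.1‖)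
    linarith
  continuous x hx θ hθ := by
    refine continuous_of_norm_sq_le (m := fun q q' => (∫ y, ‖(k q' - k q) y‖ ^ 2) *
      (inner ℂ x.1 x.2 : ℂ).re) (fun q q' => ?_) fun q => ?_
    · obtain ⟨η, h1, h2⟩ := exists_annihilation hw hw0 (φ := x.1) (χ := x.2) hx
        ((h.memLp_left q').sub (h.memLp_left q)) ((h.memLp_right q').sub (h.memLp_right q))
        (h.factor_sub q q')
      have h3 := sub_mem_annihilationGraph (hθ q') (hθ q)
      have h4 : θ q' - θ q - η = 0 := annihilationGraph_single_valued _ _ (Submodule.sub_mem _ h3 h1) (sub_self _)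
      rw [sub_eq_zero.1 h4]
      exact h2
    · simpa using (h.continuous_right q).mul_const (inner ℂ x.1 x.2 : ℂ).re

theorem CouplingFamily.creation (h : CouplingFamily w g k N K) (hw0 : ∀ y, 0 ≤ w y) :
    FormBoundedFamily (fun q => creationGraph (g q)) (secondQuantizationGraph w) K N where
  closed q := isClosed_creationGraph (h.memLp_left q)
  single_valued q := creationGraph_single_valued (g q)
  bound q x hx := by
    obtain ⟨θ, h1, h2⟩ := exists_creation hw0 (φ := x.1) (χ := x.2) hx (h.memLp_left q)
      (h.memLp_right q) (h.factor q)
    refine ⟨θ, h1, h2.trans ?_⟩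
    have h3 := mul_le_mul_of_nonneg_right (h.bound_right q) (secondQuantization_nonneg hw0 hx)
    have h4 := mul_le_mul_of_nonneg_right (h.bound_left q) (sq_nonneg ‖x.1‖)
    linarith
  continuous x hx θ hθ := by
    refine continuous_of_norm_sq_le (m := fun q q' => (∫ y, ‖(g q' - g q) y‖ ^ 2) * ‖x.1‖ ^ 2 +
      (∫ y, ‖(k q' - k q) y‖ ^ 2) * (inner ℂ x.1 x.2 : ℂ).re) (fun q q' => ?_) fun q => ?_
    · obtain ⟨η, h1, h2⟩ := exists_creation hw0 (φ := x.1) (χ := x.2) hx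
        ((h.memLp_left q').sub (h.memLp_left q)) ((h.memLp_right q').sub (h.memLp_right q))
        (h.factor_sub q q')
      have h3 := sub_mem_creationGraph (hθ q') (hθ q)
      have h4 : θ q' - θ q - η = 0 := creationGraph_single_valued _ _ (Submodule.sub_mem _ h3 h1) (sub_self _)
      rw [sub_eq_zero.1 h4]
      exact h2
    · simpa using ((h.continuous_left q).mul_const (‖x.1‖ ^ 2)).add
        ((h.continuous_right q).mul_const (inner ℂ x.1 x.2 : ℂ).re)

end Families

/-! ### Square integrability and continuity of the coupling functions -/

section Coupling

variable {d n : ℕ}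

/-- Passing from the kernel `exp(-i k·y)` to `exp(-2πi k·y)` rescales the argument by `(2π)⁻¹`;
boundedness and square integrability are then inherited from Schwartz functions. -/
theorem fourier_eq_schwartz {ρ : EuclideanSpace ℝ (Fin n) → ℂ} (h : ContDiff ℝ ∞ ρ)
    (hc : HasCompactSupport ρ) (k : EuclideanSpace ℝ (Fin n)) :
    fourier ρ k = (((2 * Real.pi) ^ (-(n : ℝ) / 2) : ℝ) : ℂ) *
      (FourierTransform.fourier (hc.toSchwartzMap h)) ((2 * Real.pi)⁻¹ • k) := by
  rw [fourier, SchwartzMap.fourier_coe, Real.fourier_eq']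
  congr 1
  refine integral_congr_ae (Eventually.of_forall fun y => ?_)
  simp only [smul_eq_mul]
  congr 2
  rw [inner_smul_right, real_inner_comm]
  have : (Real.pi : ℂ) ≠ 0 := Complex.ofReal_ne_zero.2 Real.pi_ne_zero
  push_cast
  field_simp

theorem continuous_fourier {ρ : EuclideanSpace ℝ (Fin n) → ℂ} (h : ContDiff ℝ ∞ ρ)
    (hc : HasCompactSupport ρ) : Continuous (fourier ρ) := by
  rw [funext (fourier_eq_schwartz h hc)]
  have := (FourierTransform.fourier (hc.toSchwartzMap h)).continuous
  fun_prop

theorem integrable_norm_sq_fourier {ρ : EuclideanSpace ℝ (Fin n) → ℂ} (h : ContDiff ℝ ∞ ρ)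
    (hc : HasCompactSupport ρ) : Integrable fun k => ‖fourier ρ k‖ ^ 2 := by
  simp only [fourier_eq_schwartz h hc, norm_mul, mul_pow]
  refine Integrable.const_mul ?_ _
  have h1 : Integrable fun k => ‖(FourierTransform.fourier (hc.toSchwartzMap h)) k‖ ^ 2 :=
    (SchwartzMap.memLp _ 2 volume).integrable_norm_pow (by norm_num)
  exact h1.comp_smul (inv_ne_zero (by positivity))

theorem exists_norm_fourier_le {ρ : EuclideanSpace ℝ (Fin n) → ℂ} (h : ContDiff ℝ ∞ ρ)
    (hc : HasCompactSupport ρ) : ∃ M : ℝ, ∀ k, ‖fourier ρ k‖ ≤ M := by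
  obtain ⟨M, -, hM⟩ := (FourierTransform.fourier (hc.toSchwartzMap h)).decay 0 0
  refine ⟨‖(((2 * Real.pi) ^ (-(n : ℝ) / 2) : ℝ) : ℂ)‖ * M, fun k => ?_⟩
  rw [fourier_eq_schwartz h hc, norm_mul]
  refine mul_le_mul_of_nonneg_left ?_ (norm_nonneg _)
  simpa using hM ((2 * Real.pi)⁻¹ • k)

/-- In polar coordinates the integrand is `r^(n-1) r⁻² = r^(n-3)` on `(0, 1]`. This is where `n ≥ 3`
enters. -/
theorem integrable_indicator_norm_inv_sq (hn : 3 ≤ n) :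
    Integrable fun k : EuclideanSpace ℝ (Fin n) =>
      (Set.Iic (1 : ℝ)).indicator (fun r => (r ^ 2)⁻¹) ‖k‖ := by
  have : Nontrivial (EuclideanSpace ℝ (Fin n)) := by
    have : Nonempty (Fin n) := ⟨⟨0, by omega⟩⟩
    infer_instance
  rw [integrable_fun_norm_addHaar (μ := volume)
    (f := (Set.Iic (1 : ℝ)).indicator (fun r => (r ^ 2)⁻¹))]
  have h1 : IntegrableOn (fun r : ℝ => r ^ (n - 3)) (Set.Ioc 0 1) :=
    (continuous_pow _).integrableOn_Ioc
  have h2 := (integrable_indicator_iff measurableSet_Ioc).2 h1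
  refine h2.integrableOn.congr_fun (fun r hr => ?_) measurableSet_Ioi
  simp only [finrank_euclideanSpace, Fintype.card_fin, smul_eq_mul]
  have hr0 : (0 : ℝ) < r := hr
  by_cases hr1 : r ≤ 1
  · rw [Set.indicator_of_mem (show r ∈ Set.Ioc (0 : ℝ) 1 from ⟨hr0, hr1⟩),
      Set.indicator_of_mem (show r ∈ Set.Iic (1 : ℝ) from hr1)]
    obtain ⟨l, rfl⟩ := Nat.exists_eq_add_of_le hn
    rw [show 3 + l - 3 = l by omega, show 3 + l - 1 = l + 2 by omega, pow_add]
    field_simp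
  · rw [Set.indicator_of_notMem (fun h : r ∈ Set.Ioc (0 : ℝ) 1 => hr1 h.2),
      Set.indicator_of_notMem (show r ∉ Set.Iic (1 : ℝ) from hr1), mul_zero]

/-- A function dominated by `|ρ̂(k)|` times `1 + |k|⁻¹` near zero and by `|ρ̂(k)|` elsewhere is in
`L²`. -/
theorem memLp_two_of_norm_sq_le (hn : 3 ≤ n) {ρ : EuclideanSpace ℝ (Fin n) → ℂ}
    (h : ContDiff ℝ ∞ ρ) (hc : HasCompactSupport ρ) {s : ℝ → ℝ} (hs : Measurable s)
    (h0 : ∀ r, 0 ≤ r → r ≤ 1 → s r ^ 2 ≤ (r ^ 2)⁻¹) (h1 : ∀ r, 1 ≤ r → s r ^ 2 ≤ 1) :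
    MemLp (fun k => fourier ρ k * (s ‖k‖ : ℂ)) 2 := by
  obtain ⟨M, hM⟩ := exists_norm_fourier_le h hc
  have hm : AEStronglyMeasurable (fun k => fourier ρ k * (s ‖k‖ : ℂ)) := by
    refine (continuous_fourier h hc).aestronglyMeasurable.mul ?_
    have : Measurable fun k : EuclideanSpace ℝ (Fin n) => (s ‖k‖ : ℂ) := by fun_prop
    exact this.aestronglyMeasurable
  rw [memLp_two_iff_integrable_sq_norm hm]
  refine (((integrable_indicator_norm_inv_sq hn).const_mul (M ^ 2)).add
    (integrable_norm_sq_fourier h hc)).mono' (hm.norm.pow 2) (Eventually.of_forall fun k => ?_)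
  rw [Real.norm_of_nonneg (sq_nonneg _), norm_mul, mul_pow, Complex.norm_real, Real.norm_eq_abs,
    sq_abs, Pi.add_apply]
  have p0 := sq_nonneg ‖fourier ρ k‖
  rcases le_total ‖k‖ 1 with hk | hk
  · rw [Set.indicator_of_mem (show ‖k‖ ∈ Set.Iic (1 : ℝ) from hk)]
    have q1 : ‖fourier ρ k‖ ^ 2 ≤ M ^ 2 := pow_le_pow_left₀ (norm_nonneg _) (hM k) 2
    have q2 := mul_le_mul q1 (h0 _ (norm_nonneg k) hk) (sq_nonneg _) (sq_nonneg M)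
    linarith
  · have q1 := mul_le_mul_of_nonneg_left (h1 _ hk) p0
    have q2 : 0 ≤ M ^ 2 * (Set.Iic (1 : ℝ)).indicator (fun r => (r ^ 2)⁻¹) ‖k‖ :=
      mul_nonneg (sq_nonneg _) (Set.indicator_nonneg (fun r _ => by positivity) _)
    linarith

theorem memLp_mul_prod {α β : Type*} [MeasurableSpace α] [MeasurableSpace β] {μ : Measure α}
    {ν : Measure β} [SFinite ν] {f : α → ℂ} {g : β → ℂ} (hf : MemLp f 2 μ) (hg : MemLp g 2 ν) :
    MemLp (fun z : α × β => f z.1 * g z.2) 2 (μ.prod ν) := by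
  have hm : AEStronglyMeasurable (fun z : α × β => f z.1 * g z.2) (μ.prod ν) :=
    hf.1.comp_fst.mul hg.1.comp_snd
  rw [memLp_two_iff_integrable_sq_norm hm]
  simp only [norm_mul, mul_pow]
  exact Integrable.mul_prod (f := fun x => ‖f x‖ ^ 2) (g := fun y => ‖g y‖ ^ 2)
    (hf.integrable_norm_pow (by norm_num)) (hg.integrable_norm_pow (by norm_num))

theorem integral_norm_sq_mul_prod {α β : Type*} [MeasurableSpace α] [MeasurableSpace β]
    {μ : Measure α} {ν : Measure β} [SFinite μ] [SFinite ν] (f : α → ℂ) (g : β → ℂ) :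
    ∫ z, ‖f z.1 * g z.2‖ ^ 2 ∂(μ.prod ν) = (∫ x, ‖f x‖ ^ 2 ∂μ) * ∫ y, ‖g y‖ ^ 2 ∂ν := by
  simp only [norm_mul, mul_pow]
  exact integral_prod_mul (fun x => ‖f x‖ ^ 2) fun y => ‖g y‖ ^ 2

theorem tendsto_integral_norm_sq_translate {f : EuclideanSpace ℝ (Fin d) → ℂ} (hf : MemLp f 2)
    (q : EuclideanSpace ℝ (Fin d)) :
    Tendsto (fun q' => ∫ x, ‖f (x - q') - f (x - q)‖ ^ 2) (𝓝 q) (𝓝 0) := by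
  have hp (q : EuclideanSpace ℝ (Fin d)) : MemLp (fun x => f (x - q)) 2 :=
    hf.comp_measurePreserving (measurePreserving_sub_right volume q)
  have h1 := tendsto_eLpNorm_translate (by norm_num : (2 : ℝ≥0∞) ≠ ⊤) hf q
  have h2 := ((ENNReal.tendsto_toReal ENNReal.zero_ne_top).comp h1).pow 2
  simp only [ENNReal.toReal_zero, ne_eq, OfNat.ofNat_ne_zero, not_false_eq_true, zero_pow] at h2
  refine h2.congr fun q' => ?_
  have h3 := (hp q').sub (hp q)
  have h4 := norm_sq_eq_integral (h3.toLp _)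
  rw [Lp.norm_toLp] at h4
  refine h4.trans (integral_congr_ae ?_)
  filter_upwards [h3.coeFn_toLp] with x hx
  rw [hx, Pi.sub_apply]

/-- The particle position only translates the first factor, so norms are constant in `q` and
continuity is that of translation in `L²`. -/
theorem couplingFamily_translate {Z : Type} [MeasureSpace Z] [SigmaFinite (volume : Measure Z)]
    {w : EuclideanSpace ℝ (Fin d) × Z → ℝ} {f : EuclideanSpace ℝ (Fin d) → ℂ} {g k : Z → ℂ}
    (hf : MemLp f 2) (hg : MemLp g 2) (hk : MemLp k 2)
    (h : ∀ y, g y.2 = (√(w y) : ℂ) * k y.2) :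
    CouplingFamily w (fun q y => f (y.1 - q) * g y.2) (fun q y => f (y.1 - q) * k y.2)
      ((∫ x, ‖f x‖ ^ 2) * ∫ z, ‖g z‖ ^ 2) ((∫ x, ‖f x‖ ^ 2) * ∫ z, ‖k z‖ ^ 2) := by
  have hp (q : EuclideanSpace ℝ (Fin d)) : MemLp (fun x => f (x - q)) 2 :=
    hf.comp_measurePreserving (measurePreserving_sub_right volume q)
  have hb (u : Z → ℂ) (q : EuclideanSpace ℝ (Fin d)) :
      ∫ y : EuclideanSpace ℝ (Fin d) × Z, ‖f (y.1 - q) * u y.2‖ ^ 2 =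
        (∫ x, ‖f x‖ ^ 2) * ∫ z, ‖u z‖ ^ 2 := by
    rw [Measure.volume_eq_prod, integral_norm_sq_mul_prod (fun x => f (x - q)) u,
      integral_sub_right_eq_self (fun x => ‖f x‖ ^ 2) q]
  have ht (u : Z → ℂ) (q : EuclideanSpace ℝ (Fin d)) :
      Tendsto (fun q' => ∫ y : EuclideanSpace ℝ (Fin d) × Z,
        ‖((fun y : EuclideanSpace ℝ (Fin d) × Z => f (y.1 - q') * u y.2) -
          fun y : EuclideanSpace ℝ (Fin d) × Z => f (y.1 - q) * u y.2) y‖ ^ 2) (𝓝 q) (𝓝 0) := by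
    have h1 := (tendsto_integral_norm_sq_translate hf q).mul_const (∫ z, ‖u z‖ ^ 2)
    rw [zero_mul] at h1
    refine h1.congr fun q' => ?_
    rw [Measure.volume_eq_prod, ← integral_norm_sq_mul_prod (fun x => f (x - q') - f (x - q)) u]
    simp only [Pi.sub_apply, sub_mul]
  exact ⟨fun q => memLp_mul_prod (hp q) hg, fun q => memLp_mul_prod (hp q) hk,
    fun q y => by rw [h]; ring, fun q => (hb g q).le, fun q => (hb k q).le, ht g, ht k⟩

theorem exists_couplingFamily (hn : 3 ≤ n) {ρ₁ : EuclideanSpace ℝ (Fin d) → ℝ}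
    {ρ₂ : EuclideanSpace ℝ (Fin n) → ℂ} (hρ₁ : ContDiff ℝ ∞ ρ₁) (hρ₁c : HasCompactSupport ρ₁)
    (hρ₂ : ContDiff ℝ ∞ ρ₂) (hρ₂c : HasCompactSupport ρ₂) :
    ∃ k N K, 0 ≤ K ∧ CouplingFamily (dispersion (d := d) (n := n)) (coupling ρ₁ ρ₂) k N K := by
  have hf : MemLp (fun x => (ρ₁ x : ℂ)) 2 := (IsTest.ofReal hρ₁ hρ₁c).memLp
  have hg := memLp_two_of_norm_sq_le hn hρ₂ hρ₂c (s := fun r => (√(2 * r))⁻¹) (by fun_prop)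
    (fun r h0 h1 => by
      rw [inv_pow, Real.sq_sqrt (by positivity)]
      rcases h0.eq_or_lt with rfl | h0
      · simp
      · exact inv_anti₀ (by positivity) (by nlinarith))
    (fun r h1 => by
      rw [inv_pow, Real.sq_sqrt (by positivity)]
      exact inv_le_one_of_one_le₀ (by linarith))
  -- This is the radial factor of `g / √ω`, namely `1/(√2 |k|)`, the more singular of the two. At `k
  -- = 0` both factors are zero by convention for inverses, so the factorization holds at every
  -- point.
  have hk := memLp_two_of_norm_sq_le hn hρ₂ hρ₂c (s := fun r => (√2 * r)⁻¹) (by fun_prop)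
    (fun r h0 h1 => by
      rw [inv_pow, mul_pow, Real.sq_sqrt (by positivity)]
      rcases h0.eq_or_lt with rfl | h0
      · simp
      · exact inv_anti₀ (by positivity) (by nlinarith))
    (fun r h1 => by
      rw [inv_pow, mul_pow, Real.sq_sqrt (by positivity)]
      exact inv_le_one_of_one_le₀ (by nlinarith))
  have h := couplingFamily_translate (w := dispersion (d := d) (n := n)) hf hg hk fun y => by
    rw [mul_left_comm, ← Complex.ofReal_mul]
    congr 2
    rw [dispersion, Real.sqrt_mul (by norm_num), mul_inv, mul_inv, mul_left_comm]
    congr 1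
    rcases (norm_nonneg y.2).eq_or_lt with h0 | h0
    · rw [← h0]
      simp
    · have h1 : √‖y.2‖ ≠ 0 := (Real.sqrt_pos.2 h0).ne'
      rw [inv_eq_iff_eq_inv, mul_inv, inv_inv]
      nth_rw 3 [← Real.mul_self_sqrt h0.le]
      field_simp
  have e : coupling ρ₁ ρ₂ = fun (q : EuclideanSpace ℝ (Fin d)) (y : Boson d n) =>
      (ρ₁ (y.1 - q) : ℂ) * (fourier ρ₂ y.2 * ((√(2 * ‖y.2‖))⁻¹ : ℝ)) := by
    funext q y
    rw [coupling, div_eq_mul_inv, mul_assoc, Complex.ofReal_inv, dispersion]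
  rw [e]
  exact ⟨_, _, _, mul_nonneg (integral_nonneg fun _ => sq_nonneg _)
    (integral_nonneg fun _ => sq_nonneg _), h⟩

end Coupling

/-! ### The algebraic tensor sum of two operators in terms of triples -/

section Tensor

variable {α : Type*} {mα : MeasurableSpace α} {ν : Measure α} {F : Type*} [NormedAddCommGroup F]
  [InnerProductSpace ℂ F]

theorem map_totalPart_freeTriples (P : Lp ℂ 2 ν →ₗ.[ℂ] Lp ℂ 2 ν) (Q : F →ₗ.[ℂ] F) :
    (freeTriples P.graph Q.graph).map totalPart =
      Submodule.span ℂ (Set.range fun x : P.domain × Q.domain =>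
        (tmul (x.1 : Lp ℂ 2 ν) (x.2 : F),
          tmul (P x.1) (x.2 : F) + tmul (x.1 : Lp ℂ 2 ν) (Q x.2))) := by
  refine le_antisymm (Submodule.map_le_iff_le_comap.2 ?_) (Submodule.span_le.2 ?_)
  · rw [freeTriples]
    refine Submodule.span_le.2 ?_
    rintro z ⟨⟨⟨x, hx⟩, ⟨y, hy⟩⟩, rfl⟩
    obtain ⟨u, rfl⟩ := (LinearPMap.mem_graph_iff' _).1 hx
    obtain ⟨v, rfl⟩ := (LinearPMap.mem_graph_iff' _).1 hy
    rw [SetLike.mem_coe, Submodule.mem_comap, totalPart_apply]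
    exact Submodule.subset_span ⟨(u, v), rfl⟩
  · rintro z ⟨⟨x, y⟩, rfl⟩
    have h : (tmul (x : Lp ℂ 2 ν) (y : F), tmul (P x) (y : F), tmul (x : Lp ℂ 2 ν) (Q y)) ∈
        freeTriples P.graph Q.graph :=
      mem_freeTriples (x := ((x : Lp ℂ 2 ν), P x)) (y := ((y : F), Q y)) (P.mem_graph x)
        (Q.mem_graph y)
    have h' := Submodule.mem_map_of_mem (f := totalPart (E := Lp F 2 ν)) h
    rw [totalPart_apply] at h'
    exact h'

end Tensor

/-! ### The free Hamiltonian -/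

section FreeHamiltonian

variable {d : ℕ} {V : EuclideanSpace ℝ (Fin d) → ℝ}

theorem Hp_graph : (Hp V).graph = particleGraph V :=
  Submodule.toLinearPMap_graph_eq _ (particleGraph_single_valued V)

theorem Hf_graph (n : ℕ) : (Hf d n).graph = secondQuantizationGraph dispersion :=
  Submodule.toLinearPMap_graph_eq _ (secondQuantizationGraph_single_valued _)

theorem freeGraph_eq (n : ℕ) : freeGraph n V =
    (freeTriples (particleGraph V) (secondQuantizationGraph (dispersion (d := d) (n := n)))).map
      totalPart := by
  have h1 : freeTriples (Hp V).graph (Hf d n).graph =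
      freeTriples (particleGraph V) (secondQuantizationGraph (dispersion (d := d) (n := n))) :=
    congrArg₂ freeTriples Hp_graph (Hf_graph n)
  have h2 : freeGraph n V = (freeTriples (Hp V).graph (Hf d n).graph).map totalPart :=
    (map_totalPart_freeTriples (Hp V) (Hf d n)).symm
  exact h2.trans (congrArg (Submodule.map totalPart) h1)

theorem measurable_dispersion {n : ℕ} : Measurable (dispersion (d := d) (n := n)) := by
  unfold dispersion
  fun_prop

theorem dispersion_nonneg {n : ℕ} (y : Boson d n) : 0 ≤ dispersion y := norm_nonneg _

theorem truncatableGraph_dispersion (n : ℕ) :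
    TruncatableGraph (secondQuantizationGraph (dispersion (d := d) (n := n))) :=
  truncatableGraph_secondQuantization measurable_dispersion dispersion_nonneg

theorem semiboundedGraph_freeGraph (n : ℕ) (hV : ConditionC V)
    (hVb : d ≤ 3 ∨ ∃ c : ℝ, ∀ᵐ q, c ≤ V q) : SemiboundedGraph (freeGraph n V) := by
  obtain ⟨h1, h2⟩ := particle_semiboundedGraph hV hVb
  rw [freeGraph_eq]
  exact semiboundedGraph_freeTriples h1 h2 (truncatableGraph_dispersion n)

theorem freeGraph_domain_dense (n : ℕ) (hV : ConditionC V) {w : Total d n}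
    (h : ∀ x ∈ freeGraph n V, (inner ℂ x.1 w : ℂ) = 0) : w = 0 := by
  refine freeTriples_domain_dense (A := particleGraph V)
    (fun g hg => particleGraph_domain_dense hV.1 hg) (truncatableGraph_dispersion n)
    fun t ht => ?_
  refine h (totalPart t) ?_
  rw [freeGraph_eq]
  exact Submodule.mem_map_of_mem ht

/-- Conversion to an operator preserves the graph once it is single-valued. Here this follows from
symmetry together with the density of the domain. -/
theorem freeGraph_toLinearPMap_graph (n : ℕ) (hV : ConditionC V)
    (hVb : d ≤ 3 ∨ ∃ c : ℝ, ∀ᵐ q, c ≤ V q) :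
    (freeGraph n V).toLinearPMap.graph = freeGraph n V := by
  refine Submodule.toLinearPMap_graph_eq _ fun x hx h0 => freeGraph_domain_dense n hV fun y hy => ?_
  rw [(semiboundedGraph_freeGraph n hV hVb).symm y hy x hx, h0, inner_zero_right]

theorem dense_freeGraph_domain (n : ℕ) (hV : ConditionC V)
    (hVb : d ≤ 3 ∨ ∃ c : ℝ, ∀ᵐ q, c ≤ V q) :
    Dense ((freeGraph n V).toLinearPMap.domain : Set (Total d n)) := by
  rw [← LinearPMap.graph_map_fst_eq_domain, freeGraph_toLinearPMap_graph n hV hVb,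
    Submodule.dense_iff_topologicalClosure_eq_top, Submodule.topologicalClosure_eq_top_iff,
    Submodule.eq_bot_iff]
  intro w hw
  refine freeGraph_domain_dense n hV fun x hx => ?_
  exact (Submodule.mem_orthogonal _ _).1 hw _ (Submodule.mem_map_of_mem hx)

theorem freeGraph_isClosable (n : ℕ) (hV : ConditionC V)
    (hVb : d ≤ 3 ∨ ∃ c : ℝ, ∀ᵐ q, c ≤ V q) : (freeGraph n V).toLinearPMap.IsClosable := by
  refine isClosable_of_symm (dense_freeGraph_domain n hV hVb) ?_
  rw [freeGraph_toLinearPMap_graph n hV hVb]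
  exact semiboundedGraph_freeGraph n hV hVb

/-- Closability ensures that `closure` of the operator is the one whose graph is the closed graph,
not the default value. -/
theorem H0_graph (n : ℕ) (hV : ConditionC V) (hVb : d ≤ 3 ∨ ∃ c : ℝ, ∀ᵐ q, c ≤ V q) :
    (H0 n V).graph = (freeGraph n V).topologicalClosure := by
  rw [H0, ← (freeGraph_isClosable n hV hVb).graph_closure_eq_closure_graph,
    freeGraph_toLinearPMap_graph n hV hVb]

end FreeHamiltonian

/-! ### The interaction as a sum of direct integrals -/

section Interaction

variable {d n : ℕ} {ρ₁ : EuclideanSpace ℝ (Fin d) → ℝ} {ρ₂ : EuclideanSpace ℝ (Fin n) → ℂ}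

theorem HI_graph : (HI ρ₁ ρ₂).graph = interactionGraph ρ₁ ρ₂ :=
  Submodule.toLinearPMap_graph_eq _ (interactionGraph_single_valued ρ₁ ρ₂)

theorem mem_HI_graph {Ψ Φ Φ' : Total d n}
    (h1 : (Ψ, Φ) ∈ fiberGraph volume fun q => creationGraph (coupling ρ₁ ρ₂ q))
    (h2 : (Ψ, Φ') ∈ fiberGraph volume fun q => annihilationGraph (coupling ρ₁ ρ₂ q)) :
    (Ψ, Φ + Φ') ∈ (HI ρ₁ ρ₂).graph := by
  rw [HI_graph]
  change ∀ᵐ q, _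
  filter_upwards [h1, h2, Lp.coeFn_add Φ Φ'] with q m1 m2 e
  rw [mem_add_graph_iff]
  refine ⟨Φ q, Φ' q, ?_, ?_, e.symm⟩
  · rwa [creation, Submodule.toLinearPMap_graph_eq _ (creationGraph_single_valued _)]
  · rwa [annihilation, Submodule.toLinearPMap_graph_eq _ (annihilationGraph_single_valued _)]

end Interaction

/-! ### Kato–Rellich for the coupled system -/

section Perturbation

variable {α : Type*} {mα : MeasurableSpace α} [TopologicalSpace α] [OpensMeasurableSpace α]
  [SecondCountableTopology α] {ν : Measure α} {F : Type*} [NormedAddCommGroup F]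
  [InnerProductSpace ℂ F] [CompleteSpace F]
  {A : Submodule ℂ (Lp ℂ 2 ν × Lp ℂ 2 ν)} {B : Submodule ℂ (F × F)}
  {G G' : α → Submodule ℂ (F × F)} {a b : ℝ} {T W : Lp F 2 ν →ₗ.[ℂ] Lp F 2 ν}

/-- The Kato–Rellich theorem for `A ⊗ 1 + 1 ⊗ B` and the sum of two direct integrals of
form-bounded families that are formally adjoint to each other. -/
theorem kato_rellich_fiber (hT : SemiboundedGraph T.graph) (hTc : T.IsClosed)
    (hd : Dense (T.domain : Set (Lp F 2 ν)))
    (hTG : T.graph = ((freeTriples A B).map totalPart).topologicalClosure)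
    (hA : ∃ c : ℝ, ∀ x ∈ A, c * ‖x.1‖ ^ 2 ≤ (inner ℂ x.1 x.2 : ℂ).re) (ha : 0 ≤ a)
    (hG : FormBoundedFamily G B a b) (hG' : FormBoundedFamily G' B a b)
    (hadj : ∀ q, ∀ x ∈ G' q, ∀ y ∈ G q, (inner ℂ x.2 y.1 : ℂ) = inner ℂ x.1 y.2)
    (hW : ∀ Ψ Φ Φ', (Ψ, Φ) ∈ fiberGraph ν G → (Ψ, Φ') ∈ fiberGraph ν G' →
      (Ψ, Φ + Φ') ∈ W.graph) :
    (T + W).domain = T.domain ∧ IsSelfAdjoint (T + W) ∧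
      (∀ S : Submodule ℂ (Lp F 2 ν), T.HasCore S →
        EssentiallySelfAdjoint ((T + W).domRestrict S)) ∧
      BoundedFromBelow (T + W) := by
  obtain ⟨c, hlow⟩ := hA
  have hadj' (Ψ Φ Ψ' Φ' : Lp F 2 ν) (h1 : (Ψ, Φ) ∈ fiberGraph ν G')
      (h2 : (Ψ', Φ') ∈ fiberGraph ν G) : (inner ℂ Φ Ψ' : ℂ) = inner ℂ Ψ Φ' := by
    rw [L2.inner_def, L2.inner_def]
    refine integral_congr_ae ?_
    filter_upwards [h1, h2] with q m1 m2
    exact hadj q _ m1 _ m2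
  -- On the domain of `T` both parts of the interaction exist separately in `L²`. As the graph of
  -- `W` is single-valued, `W` is there the sum of the two, and symmetry and smallness can be
  -- checked on each part.
  have key : ∀ x ∈ T.graph, ∃ y z, (x.1, y) ∈ fiberGraph ν G ∧ (x.1, z) ∈ fiberGraph ν G' ∧
      ‖y‖ ^ 2 ≤ a * (inner ℂ x.1 x.2 : ℂ).re + (b - a * c) * ‖x.1‖ ^ 2 ∧
      ‖z‖ ^ 2 ≤ a * (inner ℂ x.1 x.2 : ℂ).re + (b - a * c) * ‖x.1‖ ^ 2 := by
    intro x hx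
    rw [hTG] at hx
    obtain ⟨y, h1, h2⟩ := hG.exists_of_mem_closure ha hlow hx
    obtain ⟨z, h3, h4⟩ := hG'.exists_of_mem_closure ha hlow hx
    exact ⟨y, z, h1, h3, h2, h4⟩
  refine kato_rellich hT hTc hd ?_ ?_ ?_
  · intro Ψ hΨ
    obtain ⟨y, z, h1, h2, -⟩ := key _ (T.mem_graph ⟨Ψ, hΨ⟩)
    exact LinearPMap.mem_domain_of_mem_graph (hW _ _ _ h1 h2)
  · rintro ⟨Ψ, Φ⟩ hx ⟨Ψ', Φ'⟩ hx' hd hd'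
    obtain ⟨y, z, h1, h2, -⟩ := key _ (T.mem_graph ⟨Ψ, hd⟩)
    obtain ⟨y', z', h1', h2', -⟩ := key _ (T.mem_graph ⟨Ψ', hd'⟩)
    have e : Φ = y + z := W.mem_graph_snd_inj hx (hW _ _ _ h1 h2) rfl
    have e' : Φ' = y' + z' := W.mem_graph_snd_inj hx' (hW _ _ _ h1' h2') rfl
    -- Symmetry of the sum: the adjoint relation exchanges the two parts.
    have a1 : (inner ℂ z Ψ' : ℂ) = inner ℂ Ψ y' := hadj' _ _ _ _ h2 h1'
    have a2 : (inner ℂ Ψ z' : ℂ) = inner ℂ y Ψ' := by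
      have := congrArg conj (hadj' _ _ _ _ h2' h1)
      rwa [inner_conj_symm, inner_conj_symm] at this
    change (inner ℂ Ψ Φ' : ℂ) = inner ℂ Φ Ψ'
    rw [e, e', inner_add_right, inner_add_left, a1, a2, add_comm]
  · intro ε hε
    obtain ⟨C, hC⟩ := norm_le_of_form_bound (E := Lp F 2 ν) (b := b - a * c) ha (half_pos hε)
    refine ⟨2 * C, fun x hx x' hx' h => ?_⟩
    obtain ⟨y, z, h1, h2, h3, h4⟩ := key x hx
    have e : x'.2 = y + z := W.mem_graph_snd_inj hx' (hW _ _ _ h1 h2) h.symm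
    rw [e]
    refine (norm_add_le _ _).trans ?_
    linarith [hC _ _ _ h3, hC _ _ _ h4]

end Perturbation

end FrictionModel

end

/-! ### The proposition -/

theorem proposition3p1 (d n : ℕ) (hn : 3 ≤ n)
    (V : EuclideanSpace ℝ (Fin d) → ℝ) (hV : FrictionModel.ConditionC V)
    (hVb : d ≤ 3 ∨ ∃ c : ℝ, ∀ᵐ q, c ≤ V q)
    (ρ₁ : EuclideanSpace ℝ (Fin d) → ℝ) (ρ₂ : EuclideanSpace ℝ (Fin n) → ℂ)
    (hρ₁ : ContDiff ℝ (⊤ : ℕ∞) ρ₁) (hρ₁c : HasCompactSupport ρ₁)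
    (hρ₁r : ∀ x y, ‖x‖ = ‖y‖ → ρ₁ x = ρ₁ y)
    (hρ₂ : ContDiff ℝ (⊤ : ℕ∞) ρ₂) (hρ₂c : HasCompactSupport ρ₂)
    (hρ₂r : ∀ x y, ‖x‖ = ‖y‖ → ρ₂ x = ρ₂ y) :
    (FrictionModel.H V ρ₁ ρ₂).domain = (FrictionModel.H0 n V).domain ∧
      IsSelfAdjoint (FrictionModel.H V ρ₁ ρ₂) ∧
      (∀ S : Submodule ℂ (FrictionModel.Total d n), (FrictionModel.H0 n V).HasCore S →
        FrictionModel.EssentiallySelfAdjoint ((FrictionModel.H V ρ₁ ρ₂).domRestrict S)) ∧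
      FrictionModel.BoundedFromBelow (FrictionModel.H V ρ₁ ρ₂) := by
  obtain ⟨k, N, K, hK, hc⟩ := FrictionModel.exists_couplingFamily hn hρ₁ hρ₁c hρ₂ hρ₂c
  have hG := FrictionModel.H0_graph n hV hVb
  have hsb : FrictionModel.SemiboundedGraph (FrictionModel.H0 n V).graph := by
    rw [hG]
    exact (FrictionModel.semiboundedGraph_freeGraph n hV hVb).closure
  rw [FrictionModel.freeGraph_eq] at hG
  exact FrictionModel.kato_rellich_fiber hsb
    (FrictionModel.freeGraph_isClosable n hV hVb).closure_isClosed
    ((FrictionModel.dense_freeGraph_domain n hV hVb).mono (LinearPMap.le_closure _).1) hG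
    (FrictionModel.particle_semiboundedGraph hV hVb).1.lower hK
    (hc.creation FrictionModel.dispersion_nonneg)
    (hc.annihilation FrictionModel.measurable_dispersion FrictionModel.dispersion_nonneg)
    (fun q _ hx _ hy => FrictionModel.inner_annihilation_creation (hc.memLp_left q) hx hy)
    fun _ _ _ h1 h2 => FrictionModel.mem_HI_graph h1 h2
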